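/- **Setting.** A *game* $\Gamma$ is a finite two-player zero-sum extensive-form game with explicit observations: a finite tree of nodes whose edges are labelled by actions; a real utility $u(z)$ for each terminal node $z$, which player $\oplus$ maximizes and player $\ominus$ minimizes; for each internal node, the mover (nature, $\oplus$ or $\ominus$) and the observation that each player makes there (which determines whether that player is to move); and, at nature's nodes, a distribution over the actions that gives each action positive probability. The *sequence* $s_i(h)$ is the list of all observations made and actions played by player $i$ on the way to $h$, including the observation at $h$; the *infosets* of player $i$ are the classes of internal nodes with equal $s_i$, and the same actions are available at all nodes of an infoset of the player to move. Strategies are sequence-form vectors $x\in\mathbb R^{\Sigma_i}$, where $\Sigma_i$ is the set of sequences of player $i$ and $x(s)$ is the probability that $i$ plays all the actions in $s$; write $x(h)=x(s_i(h))$, and $x(I)=x(h)$ for $h\in I$ if $I$ is an infoset of $i$. Let $p(h)$ be the product of nature's probabilities on the path to $h$, and $u(x,y)=\sum_z u(z)p(z)x(z)y(z)$. An *NE strategy* of $\oplus$ is an $x$ that is part of a Nash equilibrium $(x,y)$. An *affine equilibrium strategy* is a vector $\sum_{j=1}^k\alpha_j x_j$ with NE strategies $x_j$ of $\oplus$ and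 real $\alpha_j$ (of any sign) such that $\sum_j\alpha_j=1$. For an $\ominus$-infoset $K$, let $m(K)=\sum_{h\in K}p(h)x(h)$, and let $u^*(x|K)$ be $m(K)^{-1}$ times the minimum of $\sum_{z\,:\,s_\ominus(z)\succeq s_\ominus(K)}u(z)p(z)x(z)y(z)$ over the $\ominus$-strategies $y$ with $y(K)=1$, where $\succeq$ means "has as a prefix"; $u^*(x|Ka)$ is defined likewise for the sequence $Ka$ in place of $s_\ominus(K)$, with the same factor $m(K)^{-1}$. **1-KLSS at an infoset.** Let $x$ be a $\oplus$-strategy and $I$ an infoset at which $\oplus$ moves, with $x(I)>0$; let $\bar I$ be the set of the nodes at or below $I$. The gadget game $\Gamma[I]$ is built as follows. It starts at the $\ominus$-infosets $K$ that intersect $I$: at $K$, nature picks $h\in K$ with probability $p(h)x(h)/m(K)$, and the game goes on from $h$ as in $\Gamma$ (the players having their sequences at $h$ as first observations), except that outside $\bar I$ the strategy of $\oplus$ is fixed to $x$ (nature plays it). The alternate payoff $u^*(x|K)-g(K)$ is subtracted from the utilities of the terminal nodes below $K$, and the result is multiplied by some factor $\lambda(K)>0$. Here $0\le g(K)\le\sum_{K'a\preceq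 s_\ominus(K)}\bigl(u^*(x|K'a)-u^*(x|K')\bigr)$, where $K'$ ranges over the infosets at which $\ominus$ moves; $g=0$ is plain subgame solving, and other $g$ give reach subgame solving. In the *maxmargin* gadget game, $\ominus$ chooses $K$ at the root. In the *resolving* gadget game, nature chooses $K$ uniformly at random, and $\ominus$, who observes $K$, can exit with utility $0$ or play on. The kind of the gadget game, $g$ and $\lambda$ may be chosen freely at each solve. **Running 1-KLSS at every infoset** with blueprint $x$ is done in a nested manner. At each first infoset $I$ of the game at which $\oplus$ moves, if $x(I)>0$, compute some NE strategy $x_I$ of $\oplus$ in $\Gamma[I]$; then, with $\Gamma[I]$ in place of $\Gamma$ and $x_I$ as the new blueprint, proceed in the same way at each next infoset of $\oplus$ after $I$, and so on. If this results in the strategy $x_I'$ in $\Gamma[I]$ for each such $I$, then the strategy $x'$ that is created in $\Gamma$ is $x'(h)=x(I)\,x_I'(h)$ for $h\in\bar I$, and $x'(h)=x(h)$ for the nodes $h$ that lie in none of these $\bar I$. **Theorem.** Let $x$ be an NE strategy of $\oplus$ in a game $\Gamma$. If 1-KLSS is run with the blueprint $x$ at every infoset of the game, then every strategy $x'$ that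 can be created in this way is an affine equilibrium strategy of $\oplus$ in $\Gamma$. -/

import Mathlib

open scoped Classical

noncomputable section

/-- The two players: `plus` maximizes the utility, `minus` minimizes it. -/
inductive Player
  | plus
  | minus

/-- The data of a finite extensive-form zero-sum game with explicit observations. The tree is given
by its parent map: `parent h = some (g, a)` says that `h` is the child `ga` of `g`. `mover h = none`
says that nature moves at `h`; `chance c` is the probability with which nature, at the parent of
`c`, moves to `c`. The values of `mover`, `obs` at terminal nodes, of `util` at internal nodes, and of
`chance` at nodes whose parent does not belong to nature, are never used. -/
structure GameTree where
  Node : Type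
  Act : Type
  Obs : Player → Type
  finite_node : Finite Node
  root : Node
  parent : Node → Option (Node × Act)
  parent_eq_none_iff : ∀ h, parent h = none ↔ h = root
  parent_inj : ∀ h h' g a, parent h = some (g, a) → parent h' = some (g, a) → h = h'
  acyclic : ∃ rank : Node → ℕ, ∀ h g a, parent h = some (g, a) → rank g < rank h
  mover : Node → Option Player
  obs : ∀ i, Node → Obs i
  chance : Node → ℝ
  util : Node → ℝ

namespace GameTree

variable (Γ : GameTree)

instance : Fintype Γ.Node := @Fintype.ofFinite _ Γ.finite_node

/-- `c` is a child of `g`. -/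
def IsChild (g c : Γ.Node) : Prop := ∃ a, Γ.parent c = some (g, a)

def IsTerminal (h : Γ.Node) : Prop := ∀ c, ¬ Γ.IsChild h c

/-- `g ⪯ h`: the node `g` is an ancestor of `h`, or `h` itself. -/
def Anc (g h : Γ.Node) : Prop := Relation.ReflTransGen Γ.IsChild g h

/-- The set `S̄` of the nodes that lie at or below a node of `S`. -/
def below (S : Set Γ.Node) : Set Γ.Node := {h | ∃ g ∈ S, Γ.Anc g h}

/-- Some rank function that witnesses acyclicity (used only for termination). -/
def rank : Γ.Node → ℕ := Γ.acyclic.choose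

theorem rank_lt {h g : Γ.Node} {a : Γ.Act} (hp : Γ.parent h = some (g, a)) :
    Γ.rank g < Γ.rank h := Γ.acyclic.choose_spec h g a hp

/-- The observation made on reaching `h` (none is made at a terminal node). -/
def obsPart (i : Player) (h : Γ.Node) : List (Γ.Obs i ⊕ Γ.Act) :=
  if Γ.IsTerminal h then [] else [Sum.inl (Γ.obs i h)]

/-- The sequence of observations and own actions of player `i` on arrival at `h`, before she makes
the observation at `h`; the latest entry comes first. If `h = ga` and `i` moves at `g`, this is the
sequence `Ia` with `I` the infoset of `g`. -/
def preSeq (i : Player) (h : Γ.Node) : List (Γ.Obs i ⊕ Γ.Act) :=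
  match _hp : Γ.parent h with
  | none => []
  | some (g, a) =>
    (if Γ.mover g = some i then [Sum.inr a] else []) ++ (Γ.obsPart i g ++ preSeq i g)
termination_by Γ.rank h
decreasing_by exact Γ.rank_lt _hp

/-- The observation sequence `s_i(h)`, latest entry first: a prefix of a sequence is a suffix of the
list. -/
def seq (i : Player) (h : Γ.Node) : List (Γ.Obs i ⊕ Γ.Act) := Γ.obsPart i h ++ Γ.preSeq i h

/-- The set `Σ_i` of the sequences of player `i`. -/
def Seq (i : Player) : Type :=
  {s : List (Γ.Obs i ⊕ Γ.Act) // ∃ h, s = Γ.preSeq i h ∨ s = Γ.seq i h}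

/-- `s_i(h)` as an element of `Σ_i`. -/
def at' (i : Player) (h : Γ.Node) : Γ.Seq i := ⟨Γ.seq i h, h, Or.inr rfl⟩

/-- The sequence just before the observation at `h`, as an element of `Σ_i`. -/
def pre (i : Player) (h : Γ.Node) : Γ.Seq i := ⟨Γ.preSeq i h, h, Or.inl rfl⟩

/-- The infoset of player `i` at `h`. -/
def infoset (i : Player) (h : Γ.Node) : Set Γ.Node :=
  {h' | ¬ Γ.IsTerminal h' ∧ Γ.seq i h' = Γ.seq i h}

/-- `I` is an infoset of player `i`. -/
def IsInfoset (i : Player) (I : Set Γ.Node) : Prop :=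
  ∃ h, ¬ Γ.IsTerminal h ∧ I = Γ.infoset i h

/-- `I` is an infoset of player `i` at which she moves. -/
def IsDecisionInfoset (i : Player) (I : Set Γ.Node) : Prop :=
  ∃ h, ¬ Γ.IsTerminal h ∧ Γ.mover h = some i ∧ I = Γ.infoset i h

/-- `p(h)`: the probability that nature plays all its actions on the path from the root to `h`. -/
def reach (h : Γ.Node) : ℝ :=
  match _hp : Γ.parent h with
  | none => 1
  | some (g, _) => reach g * (if Γ.mover g = none then Γ.chance h else 1)
termination_by Γ.rank h
decreasing_by exact Γ.rank_lt _hp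

/-- Sequence-form mixed strategies of player `i`: vectors in `ℝ^{Σ_i}`, with `x(s)` the probability
that `i` plays all the actions in `s`. -/
structure IsStrategy (i : Player) (x : Γ.Seq i → ℝ) : Prop where
  nonneg : ∀ s, 0 ≤ x s
  root : x (Γ.pre i Γ.root) = 1
  observe : ∀ h, x (Γ.at' i h) = x (Γ.pre i h)
  flow : ∀ h, ¬ Γ.IsTerminal h → Γ.mover h = some i →
    ∑ c with Γ.IsChild h c, x (Γ.pre i c) = x (Γ.at' i h)

/-- The expected utility `u(x, y)`. -/
def payoff (x : Γ.Seq .plus → ℝ) (y : Γ.Seq .minus → ℝ) : ℝ :=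
  ∑ z with Γ.IsTerminal z, Γ.util z * Γ.reach z * x (Γ.at' .plus z) * y (Γ.at' .minus z)

/-- `(x, y)` is a Nash equilibrium. -/
def IsNash (x : Γ.Seq .plus → ℝ) (y : Γ.Seq .minus → ℝ) : Prop :=
  Γ.IsStrategy .plus x ∧ Γ.IsStrategy .minus y ∧
    (∀ x', Γ.IsStrategy .plus x' → Γ.payoff x' y ≤ Γ.payoff x y) ∧
    (∀ y', Γ.IsStrategy .minus y' → Γ.payoff x y ≤ Γ.payoff x y')

/-- `x` is an NE strategy of the player `plus`. -/
def IsNEStrategy (x : Γ.Seq .plus → ℝ) : Prop := ∃ y, Γ.IsNash x y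

/-- `x` is an affine combination of NE strategies. -/
def IsAffineEquilibrium (x : Γ.Seq .plus → ℝ) : Prop :=
  ∃ (k : ℕ) (α : Fin k → ℝ) (xs : Fin k → Γ.Seq .plus → ℝ),
    (∀ j, Γ.IsNEStrategy (xs j)) ∧ ∑ j, α j = 1 ∧ x = ∑ j, α j • xs j

/-- `∑_{h ∈ K} p(h) x(h)`. -/
def mass (x : Γ.Seq .plus → ℝ) (K : Set Γ.Node) : ℝ :=
  ∑ h with h ∈ K, Γ.reach h * x (Γ.at' .plus h)

/-- The counterfactual best-response value of `minus` against `x` from the sequence `s` on,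
normalized by the mass of the infoset `K`. -/
def brValue (x : Γ.Seq .plus → ℝ) (K : Set Γ.Node) (s : Γ.Seq .minus) : ℝ :=
  (Γ.mass x K)⁻¹ * sInf {r | ∃ y, Γ.IsStrategy .minus y ∧ y s = 1 ∧
    r = ∑ z with Γ.IsTerminal z ∧ s.1 <:+ Γ.seq .minus z,
      Γ.util z * Γ.reach z * x (Γ.at' .plus z) * y (Γ.at' .minus z)}

/-- `u*(x|K)` for the `minus`-infoset `K` of `h`: the best value that `minus` can get once she has
arrived at `K`. -/
def infosetValue (x : Γ.Seq .plus → ℝ) (h : Γ.Node) : ℝ :=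
  Γ.brValue x (Γ.infoset .minus h) (Γ.at' .minus h)

/-- If `c = ga` with `minus` to move at `g`, and `K` is the `minus`-infoset of `g`: the magnitude
`u*(x|Ka) - u*(x|K)` of the error that `minus` makes by playing `a` at `K`. Otherwise `0`. -/
def mistake (x : Γ.Seq .plus → ℝ) (c : Γ.Node) : ℝ :=
  match Γ.parent c with
  | none => 0
  | some (g, _) =>
    if Γ.mover g = some .minus then
      Γ.brValue x (Γ.infoset .minus g) (Γ.pre .minus c) - Γ.infosetValue x g
    else 0

/-- The total magnitude of the errors that `minus` makes by playing to reach `h`. -/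
def totalMistake (x : Γ.Seq .plus → ℝ) (h : Γ.Node) : ℝ :=
  ∑ c with Γ.Anc c h, Γ.mistake x c

/-- The sum of the probabilities `chance c` of the children `c` of `h`. -/
def chanceSum (h : Γ.Node) : ℝ := ∑ c with Γ.IsChild h c, Γ.chance c

end GameTree

/-- A finite extensive-form perfect-recall zero-sum game with explicit observations. Nature plays
each of its actions with positive probability. (Perfect recall is automatic: infosets are defined
through the sequences of all observations and own actions.) -/
structure Game extends GameTree where
  /-- An observation determines whether the observing player is to move. -/
  obs_mover : ∀ i h h', ¬ toGameTree.IsTerminal h → ¬ toGameTree.IsTerminal h' →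
    obs i h = obs i h' → mover h = some i → mover h' = some i
  /-- The same actions are available at all nodes of an infoset of the player to move. -/
  same_actions : ∀ i h h' c a, ¬ toGameTree.IsTerminal h → ¬ toGameTree.IsTerminal h' →
    mover h = some i → toGameTree.seq i h = toGameTree.seq i h' →
    parent c = some (h, a) → ∃ c', parent c' = some (h', a)
  chance_pos : ∀ h c, mover h = none → toGameTree.IsChild h c → 0 < chance c
  chance_sum : ∀ h, ¬ toGameTree.IsTerminal h → mover h = none →
    toGameTree.chanceSum h = 1

namespace GameTree

variable {Γ : GameTree}

theorem obsPart_of_not_terminal {i : Player} {h : Γ.Node} (ht : ¬ Γ.IsTerminal h) :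
    Γ.obsPart i h = [Sum.inl (Γ.obs i h)] := by simp [obsPart, ht]

theorem preSeq_of_parent (i : Player) {h g : Γ.Node} {a : Γ.Act} (hp : Γ.parent h = some (g, a)) :
    Γ.preSeq i h = (if Γ.mover g = some i then [Sum.inr a] else []) ++ Γ.seq i g := by
  rw [preSeq]
  split
  · simp_all
  · rename_i g' a' hp'
    rw [hp] at hp'
    simp only [Option.some.injEq, Prod.mk.injEq] at hp'
    obtain ⟨rfl, rfl⟩ := hp'
    rfl

theorem not_terminal_of_child {g c : Γ.Node} (hc : Γ.IsChild g c) : ¬ Γ.IsTerminal g :=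
  fun ht => ht c hc

theorem reach_pos (Γ : Game) (h : Γ.Node) : 0 < Γ.reach h := by
  induction hn : Γ.rank h using Nat.strong_induction_on generalizing h with
  | _ n ih =>
    rw [reach]
    split
    · norm_num
    · rename_i g a hp
      have h1 : 0 < Γ.reach g := ih _ (hn ▸ Γ.rank_lt hp) g rfl
      split_ifs with hm
      · exact mul_pos h1 (Γ.chance_pos g h hm ⟨a, hp⟩)
      · simpa using h1

/-- The number of observations in a sequence. -/
def obsCount {O A : Type} (l : List (O ⊕ A)) : ℕ := l.countP Sum.isLeft

theorem obsCount_inl {O A : Type} (o : O) (l : List (O ⊕ A)) :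
    obsCount (Sum.inl o :: l) = obsCount l + 1 := by simp [obsCount, List.countP_cons]

theorem obsCount_inr {O A : Type} (a : A) (l : List (O ⊕ A)) :
    obsCount (Sum.inr a :: l) = obsCount l := by simp [obsCount]

theorem obsCount_child (i : Player) {h g : Γ.Node} (hc : Γ.IsChild g h) :
    obsCount (Γ.preSeq i h) = obsCount (Γ.preSeq i g) + 1 := by
  obtain ⟨a, hp⟩ := hc
  rw [preSeq_of_parent i hp, seq, obsPart_of_not_terminal (not_terminal_of_child ⟨a, hp⟩)]
  split_ifs
  · exact (obsCount_inr _ _).trans (obsCount_inl _ _)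
  · exact obsCount_inl _ _

theorem obsCount_eq (h : Γ.Node) (i j : Player) :
    obsCount (Γ.preSeq i h) = obsCount (Γ.preSeq j h) := by
  induction hn : Γ.rank h using Nat.strong_induction_on generalizing h with
  | _ n ih =>
    cases hp : Γ.parent h with
    | none =>
      have key : ∀ k, Γ.preSeq k h = [] := by
        intro k
        rw [preSeq]
        split
        · rfl
        · simp_all
      rw [key, key]
      rfl
    | some q =>
      obtain ⟨g, a⟩ := q
      rw [obsCount_child i ⟨a, hp⟩, obsCount_child j ⟨a, hp⟩, ih _ (hn ▸ Γ.rank_lt hp) g rfl]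

theorem obsCount_seq {h : Γ.Node} (i : Player) (ht : ¬ Γ.IsTerminal h) :
    obsCount (Γ.seq i h) = obsCount (Γ.preSeq i h) + 1 := by
  rw [seq, obsPart_of_not_terminal ht]
  exact obsCount_inl _ _

theorem depth_eq {h h' : Γ.Node} {i : Player} (ht : ¬ Γ.IsTerminal h) (ht' : ¬ Γ.IsTerminal h')
    (e : Γ.seq i h = Γ.seq i h') :
    obsCount (Γ.preSeq .plus h) = obsCount (Γ.preSeq .plus h') := by
  have := obsCount_seq i ht
  rw [e, obsCount_seq i ht'] at this
  rw [obsCount_eq h .plus i, obsCount_eq h' .plus i]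
  omega

theorem depth_anc {g h : Γ.Node} (hA : Γ.Anc g h) :
    obsCount (Γ.preSeq .plus g) ≤ obsCount (Γ.preSeq .plus h) := by
  induction hA with
  | refl => rfl
  | tail _ hc ih => rw [obsCount_child .plus hc]; omega

theorem anc_eq_of_depth {g h : Γ.Node} (hA : Γ.Anc g h)
    (e : obsCount (Γ.preSeq .plus g) = obsCount (Γ.preSeq .plus h)) : g = h := by
  cases hA with
  | refl => rfl
  | tail h1 hc =>
    have := depth_anc h1
    rw [obsCount_child .plus hc] at e
    omega

theorem anc_parent {g h k : Γ.Node} {a : Γ.Act} (hA : Γ.Anc g h) (hne : g ≠ h)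
    (hp : Γ.parent h = some (k, a)) : Γ.Anc g k := by
  cases hA with
  | refl => exact absurd rfl hne
  | tail h1 hc =>
    obtain ⟨b, hb⟩ := hc
    rw [hp] at hb
    simp only [Option.some.injEq, Prod.mk.injEq] at hb
    rw [hb.1]
    exact h1

theorem IsStrategy.child_eq {i : Player} {x : Γ.Seq i → ℝ} (hx : Γ.IsStrategy i x) {g c : Γ.Node}
    (hc : Γ.IsChild g c) (hm : Γ.mover g ≠ some i) : x (Γ.at' i c) = x (Γ.at' i g) := by
  rw [hx.observe c]
  obtain ⟨a, hp⟩ := hc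
  have : Γ.pre i c = Γ.at' i g := by
    apply Subtype.ext
    change Γ.preSeq i c = Γ.seq i g
    rw [preSeq_of_parent i hp]
    simp [hm]
  rw [this]

theorem IsStrategy.flow' {i : Player} {x : Γ.Seq i → ℝ} (hx : Γ.IsStrategy i x) {h : Γ.Node}
    (ht : ¬ Γ.IsTerminal h) (hm : Γ.mover h = some i) :
    ∑ c with Γ.IsChild h c, x (Γ.at' i c) = x (Γ.at' i h) := by
  rw [← hx.flow h ht hm]
  exact Finset.sum_congr rfl fun c _ => hx.observe c

theorem IsStrategy.child_le {i : Player} {x : Γ.Seq i → ℝ} (hx : Γ.IsStrategy i x) {g c : Γ.Node}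
    (hc : Γ.IsChild g c) : x (Γ.at' i c) ≤ x (Γ.at' i g) := by
  by_cases hm : Γ.mover g = some i
  · rw [← hx.flow' (not_terminal_of_child hc) hm]
    exact Finset.single_le_sum (f := fun c => x (Γ.at' i c)) (fun _ _ => hx.nonneg _)
      (by simpa using hc)
  · exact (hx.child_eq hc hm).le

end GameTree

/-- Maxmargin or resolving gadget games. -/
inductive GadgetKind
  | maxmargin
  | resolving

/-- Nodes of a gadget game over a game with node type `N`. Here `𝒦` is the collection of the
`minus`-infosets at which the gadget game can start, and `T` is the set of the copied nodes.
* maxmargin: at `root`, `minus` picks `K ∈ 𝒦`, which leads to `deal K`;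
* resolving: at `root`, nature picks `K ∈ 𝒦`, which leads to `choice K`, where `minus` either exits
  (to the terminal node `exit K`) or plays on (to `deal K`).
At `deal K`, nature picks a node of `K`, and the game goes on from the copy of this node. -/
inductive GadgetNode {N : Type} (𝒦 : Set (Set N)) (T : Set N) : GadgetKind → Type
  | root (v : GadgetKind) : GadgetNode 𝒦 T v
  | choice (K : 𝒦) : GadgetNode 𝒦 T .resolving
  | exit (K : 𝒦) : GadgetNode 𝒦 T .resolving
  | deal (v : GadgetKind) (K : 𝒦) : GadgetNode 𝒦 T v
  | copy (v : GadgetKind) (h : T) : GadgetNode 𝒦 T v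

/-- Actions of a gadget game; `old a` are the copied actions. -/
inductive GadgetAct (N A : Type)
  | pick (K : Set N)
  | exit
  | play
  | deal (h : N)
  | old (a : A)

/-- Observations in a gadget game: `start` is the observation of `minus` at a root where she moves,
`choose K` that of `minus` at `choice K`, `entry s` is made at a copied start node (`s` is the
observation sequence there in the original game), `old o` at the copied nodes further below, and
`wait` is the empty observation. -/
inductive GadgetObs (N O A : Type)
  | start
  | choose (K : Set N)
  | wait
  | entry (s : List (O ⊕ A))
  | old (o : O)

namespace GadgetNode

theorem finite {N : Type} [Finite N] (𝒦 : Set (Set N)) (T : Set N) (v : GadgetKind) :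
    Finite (GadgetNode 𝒦 T v) := by
  let f : GadgetNode 𝒦 T v → Unit ⊕ 𝒦 ⊕ 𝒦 ⊕ 𝒦 ⊕ T := fun n => match n with
    | root _ => .inl ()
    | choice K => .inr (.inl K)
    | exit K => .inr (.inr (.inl K))
    | deal _ K => .inr (.inr (.inr (.inl K)))
    | copy _ h => .inr (.inr (.inr (.inr h)))
  refine Finite.of_injective f ?_
  intro m n e
  cases m <;> cases n <;> simp_all [f]

end GadgetNode

namespace GameTree

variable (Γ : GameTree)

/-- The collection of the `minus`-infosets that intersect `I`. -/
def oppInfosets (I : Set Γ.Node) : Set (Set Γ.Node) :=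
  {K | Γ.IsInfoset .minus K ∧ (K ∩ I).Nonempty}

/-- The union of the `minus`-infosets that intersect `I`, that is, `I²` if `I` is an infoset of
`plus`. -/
def top (I : Set Γ.Node) : Set Γ.Node :=
  {h | ¬ Γ.IsTerminal h ∧ ∃ h' ∈ I, Γ.seq .minus h = Γ.seq .minus h'}

/-- The nodes of the gadget game of 1-KLSS at `I`: those at or below `I²`, where the nodes outside
`Ī` that the fixed strategy `x` never reaches are left out. -/
def kept (x : Γ.Seq .plus → ℝ) (I : Set Γ.Node) : Set Γ.Node :=
  {h | h ∈ Γ.below (Γ.top I) ∧ (h ∈ Γ.below I ∨ 0 < x (Γ.at' .plus h))}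

variable {Γ}

/-- The node of `I²` on the path to `h`. -/
def entryNode {x : Γ.Seq .plus → ℝ} {I : Set Γ.Node} (h : Γ.kept x I) : Γ.Node := h.2.1.choose

/-- Subgame solving at an infoset `I` with blueprint `x`: what can be chosen.
* `kind`: a maxmargin or a resolving gadget game.
* `gift`: the alternate payoff at a `minus`-infoset `K` is `u*(x|K)` decreased by `gift K`. This is
  a lower bound on the magnitude of the error that `minus` has made by playing to reach `K`; plain
  (non-reach) subgame solving is the case `gift = 0`.
* `scale`: the positive factor by which the margin at `K` enters the gadget game. The factor `1`
  gives margins that are normalized by `∑_{h ∈ K} p(h) x(h)`; the factor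
  `(∑_{h ∈ K} p(h) x(h)) / (∑_{h ∈ K ∩ I} p(h) x(h))` gives those normalized by the mass of `K ∩ I`.
-/
structure SolveOptions (Γ : GameTree) (x : Γ.Seq .plus → ℝ) (I : Set Γ.Node) where
  kind : GadgetKind
  gift : Set Γ.Node → ℝ
  scale : Set Γ.Node → ℝ
  gift_nonneg : ∀ K ∈ Γ.oppInfosets I, 0 ≤ gift K
  gift_le : ∀ K ∈ Γ.oppInfosets I, ∀ h ∈ K, gift K ≤ Γ.totalMistake x h
  scale_pos : ∀ K ∈ Γ.oppInfosets I, 0 < scale K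

/-- `I` is an infoset where `plus` moves and which she reaches with positive probability. -/
def CanSolve (Γ : GameTree) (x : Γ.Seq .plus → ℝ) (I : Set Γ.Node) : Prop :=
  Γ.IsDecisionInfoset .plus I ∧ ∀ h ∈ I, 0 < x (Γ.at' .plus h)

section gadget

variable {x : Γ.Seq .plus → ℝ} {I : Set Γ.Node}

theorem CanSolve.not_terminal (hI : Γ.CanSolve x I) {h : Γ.Node} (hh : h ∈ I) :
    ¬ Γ.IsTerminal h := by
  obtain ⟨⟨g, -, -, rfl⟩, -⟩ := hI
  exact hh.1

theorem CanSolve.mem_top (hI : Γ.CanSolve x I) {h : Γ.Node} (hh : h ∈ I) : h ∈ Γ.top I :=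
  ⟨hI.not_terminal hh, h, hh, rfl⟩

theorem CanSolve.depth_top (hI : Γ.CanSolve x I) {h h' : Γ.Node} (hh : h ∈ Γ.top I)
    (hh' : h' ∈ Γ.top I) : obsCount (Γ.preSeq .plus h) = obsCount (Γ.preSeq .plus h') := by
  obtain ⟨ht, k, hk, e⟩ := hh
  obtain ⟨ht', k', hk', e'⟩ := hh'
  rw [depth_eq ht (hI.not_terminal hk) e, depth_eq ht' (hI.not_terminal hk') e']
  obtain ⟨⟨g, -, -, rfl⟩, -⟩ := hI
  exact depth_eq hk.1 hk'.1 (hk.2.trans hk'.2.symm)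

theorem CanSolve.child_not_top (hI : Γ.CanSolve x I) {g c : Γ.Node} (hg : g ∈ Γ.below (Γ.top I))
    (hc : Γ.IsChild g c) : c ∉ Γ.top I := by
  intro hct
  obtain ⟨k, hk, hA⟩ := hg
  have h1 := depth_anc hA
  have h2 := hI.depth_top hk hct
  rw [obsCount_child .plus hc] at h2
  omega

theorem CanSolve.mem_of_top (hI : Γ.CanSolve x I) {h : Γ.Node} (hh : h ∈ Γ.top I)
    (hb : h ∈ Γ.below I) : h ∈ I := by
  obtain ⟨g, hg, hA⟩ := hb
  have := anc_eq_of_depth hA (hI.depth_top (hI.mem_top hg) hh)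
  exact this ▸ hg

theorem infoset_mem_oppInfosets {h : Γ.Node} (hh : h ∈ Γ.top I) (hI : Γ.CanSolve x I) :
    Γ.infoset .minus h ∈ Γ.oppInfosets I := by
  obtain ⟨ht, k, hk, e⟩ := hh
  exact ⟨⟨h, ht, rfl⟩, k, ⟨hI.not_terminal hk, e.symm⟩, hk⟩

theorem mem_top_of_mem {K : Set Γ.Node} (hK : K ∈ Γ.oppInfosets I) {h : Γ.Node} (hh : h ∈ K) :
    h ∈ Γ.top I := by
  obtain ⟨⟨g, -, rfl⟩, k, hk, hkI⟩ := hK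
  exact ⟨hh.1, k, hkI, hh.2.trans hk.2.symm⟩

theorem infoset_eq_of_mem {K : Set Γ.Node} (hK : K ∈ Γ.oppInfosets I) {h : Γ.Node} (hh : h ∈ K) :
    Γ.infoset .minus h = K := by
  obtain ⟨⟨g, -, rfl⟩, -⟩ := hK
  ext k
  simp [infoset, hh.2]

theorem below_child {S : Set Γ.Node} {g c : Γ.Node} (hg : g ∈ Γ.below S) (hc : Γ.IsChild g c) :
    c ∈ Γ.below S := by
  obtain ⟨k, hk, hA⟩ := hg
  exact ⟨k, hk, hA.tail hc⟩

theorem kept_parent (hx : Γ.IsStrategy .plus x) (hI : Γ.CanSolve x I) {h : Γ.Node}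
    (hh : h ∈ Γ.kept x I) (hn : h ∉ Γ.top I) :
    ∃ q : Γ.kept x I × Γ.Act, Γ.parent h = some (q.1.1, q.2) := by
  obtain ⟨⟨k, hk, hA⟩, hor⟩ := hh
  have hne : k ≠ h := fun e => hn (e ▸ hk)
  cases hp : Γ.parent h with
  | none =>
    exfalso
    cases hA with
    | refl => exact hne rfl
    | tail _ hc => obtain ⟨a, ha⟩ := hc; simp [hp] at ha
  | some q =>
    obtain ⟨g, a⟩ := q
    refine ⟨(⟨g, ⟨k, hk, anc_parent hA hne hp⟩, ?_⟩, a), rfl⟩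
    rcases hor with ⟨k', hk', hA'⟩ | hpos
    · left
      refine ⟨k', hk', anc_parent hA' ?_ hp⟩
      rintro rfl
      exact hn (hI.mem_top hk')
    · exact Or.inr (hpos.trans_le (hx.child_le ⟨a, hp⟩))

variable (Γ x I)

/-- The parent map of the gadget game. -/
def gadgetParent (hx : Γ.IsStrategy .plus x) (hI : Γ.CanSolve x I) : (v : GadgetKind) →
    GadgetNode (Γ.oppInfosets I) (Γ.kept x I) v →
    Option (GadgetNode (Γ.oppInfosets I) (Γ.kept x I) v × GadgetAct Γ.Node Γ.Act)
  | _, .root _ => none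
  | _, .choice K => some (.root _, .pick K)
  | _, .exit K => some (.choice K, .exit)
  | .maxmargin, .deal _ K => some (.root _, .pick K)
  | .resolving, .deal _ K => some (.choice K, .play)
  | v, .copy _ h =>
    if ht : h.1 ∈ Γ.top I then
      some (.deal v ⟨Γ.infoset .minus h.1, infoset_mem_oppInfosets ht hI⟩, .deal h.1)
    else
      some (.copy v (kept_parent hx hI h.2 ht).choose.1,
        .old (kept_parent hx hI h.2 ht).choose.2)

/-- Who moves in the gadget game: at a copied node of `plus` outside `Ī`, her strategy is fixed,
so that nature moves there. -/
def gadgetMover : (v : GadgetKind) → GadgetNode (Γ.oppInfosets I) (Γ.kept x I) v → Option Player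
  | .maxmargin, .root _ => some .minus
  | .resolving, .root _ => none
  | _, .choice _ => some .minus
  | _, .exit _ => none
  | _, .deal _ _ => none
  | _, .copy _ h => if Γ.mover h.1 = some .plus ∧ h.1 ∉ Γ.below I then none else Γ.mover h.1

/-- The observations in the gadget game. -/
def gadgetObs : (i : Player) → (v : GadgetKind) →
    GadgetNode (Γ.oppInfosets I) (Γ.kept x I) v → GadgetObs Γ.Node (Γ.Obs i) Γ.Act
  | .minus, .maxmargin, .root _ => .start
  | .minus, _, .choice K => .choose K
  | .minus, _, .copy _ h =>
    if h.1 ∈ Γ.top I then .entry (Γ.seq .minus h.1) else .old (Γ.obs .minus h.1)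
  | .plus, _, .copy _ h =>
    if h.1 ∈ Γ.below I then
      if h.1 ∈ Γ.top I then .entry (Γ.seq .plus h.1) else .old (Γ.obs .plus h.1)
    else .wait
  | _, _, _ => .wait

/-- Nature's probabilities in the gadget game. In a resolving gadget game, nature starts uniformly
at random. At `deal K`, the node `h ∈ K` has a probability proportional to `p(h) x(h)`. At a copied
node `g` of `plus` outside `Ī`, nature plays as the blueprint `x` does. -/
def gadgetChance : (v : GadgetKind) → GadgetNode (Γ.oppInfosets I) (Γ.kept x I) v → ℝ
  | _, .choice _ => (Nat.card (Γ.oppInfosets I) : ℝ)⁻¹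
  | _, .copy _ h =>
    if h.1 ∈ Γ.top I then
      Γ.reach h.1 * x (Γ.at' .plus h.1) / Γ.mass x (Γ.infoset .minus h.1)
    else
      match Γ.parent h.1 with
      | none => 0
      | some (g, _) =>
        if Γ.mover g = some .plus then x (Γ.at' .plus h.1) / x (Γ.at' .plus g)
        else Γ.chance h.1
  | _, _ => 0

/-- The utility in the gadget game: the alternate payoff `u*(x|K) - gift K` is subtracted at the
terminal nodes below `K`. -/
def gadgetUtil (o : Γ.SolveOptions x I) : (v : GadgetKind) →
    GadgetNode (Γ.oppInfosets I) (Γ.kept x I) v → ℝ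
  | _, .copy _ z =>
    o.scale (Γ.infoset .minus (entryNode z)) * (Γ.util z.1 -
      (Γ.infosetValue x (entryNode z) - o.gift (Γ.infoset .minus (entryNode z))))
  | _, _ => 0

variable {Γ x I}

theorem gadgetParent_top {hx : Γ.IsStrategy .plus x} {hI : Γ.CanSolve x I} {v : GadgetKind}
    {h : Γ.kept x I} (ht : h.1 ∈ Γ.top I) :
    Γ.gadgetParent x I hx hI v (.copy v h) =
      some (.deal v ⟨Γ.infoset .minus h.1, infoset_mem_oppInfosets ht hI⟩, .deal h.1) := by
  cases v <;> simp [gadgetParent, ht]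

theorem gadgetParent_not_top {hx : Γ.IsStrategy .plus x} {hI : Γ.CanSolve x I} {v : GadgetKind}
    {h g : Γ.kept x I} {a : Γ.Act} (ht : h.1 ∉ Γ.top I) (hp : Γ.parent h.1 = some (g.1, a)) :
    Γ.gadgetParent x I hx hI v (.copy v h) = some (.copy v g, .old a) := by
  have hs := hp.symm.trans (kept_parent hx hI h.2 ht).choose_spec
  simp only [Option.some.injEq, Prod.mk.injEq] at hs
  have h1 : (kept_parent hx hI h.2 ht).choose.1 = g := Subtype.ext hs.1.symm
  cases v <;> simp [gadgetParent, ht, h1, ← hs.2]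

theorem gadgetParent_copy {hx : Γ.IsStrategy .plus x} {hI : Γ.CanSolve x I} {v : GadgetKind}
    (h : Γ.kept x I) :
    (∃ ht : h.1 ∈ Γ.top I, Γ.gadgetParent x I hx hI v (.copy v h) =
      some (.deal v ⟨Γ.infoset .minus h.1, infoset_mem_oppInfosets ht hI⟩, .deal h.1)) ∨
    (h.1 ∉ Γ.top I ∧ ∃ (g : Γ.kept x I) (a : Γ.Act), Γ.parent h.1 = some (g.1, a) ∧
      Γ.gadgetParent x I hx hI v (.copy v h) = some (.copy v g, .old a)) := by
  by_cases ht : h.1 ∈ Γ.top I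
  · exact Or.inl ⟨ht, gadgetParent_top ht⟩
  · obtain ⟨q, hq⟩ := kept_parent hx hI h.2 ht
    exact Or.inr ⟨ht, q.1, q.2, hq, gadgetParent_not_top ht hq⟩

theorem gadgetParent_inj {hx : Γ.IsStrategy .plus x} {hI : Γ.CanSolve x I} {v : GadgetKind}
    {h h' g : GadgetNode (Γ.oppInfosets I) (Γ.kept x I) v} {a : GadgetAct Γ.Node Γ.Act}
    (e : Γ.gadgetParent x I hx hI v h = some (g, a))
    (e' : Γ.gadgetParent x I hx hI v h' = some (g, a)) : h = h' := by
  rcases h with _ | K | K | ⟨v, K⟩ | ⟨v, k⟩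
  · simp [gadgetParent] at e
  · simp only [gadgetParent, Option.some.injEq, Prod.mk.injEq] at e
    obtain ⟨rfl, rfl⟩ := e
    rcases h' with _ | K' | K' | ⟨v, K'⟩ | ⟨v, k'⟩
    · simp [gadgetParent] at e'
    · simp only [gadgetParent, Option.some.injEq, Prod.mk.injEq, GadgetAct.pick.injEq] at e'
      rw [Subtype.ext e'.2]
    · simp [gadgetParent] at e'
    · simp [gadgetParent] at e'
    · rcases gadgetParent_copy (hx := hx) (hI := hI) (v := .resolving) k' with ⟨_, h1⟩ | ⟨_, _, _, _, h1⟩ <;>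
        simp [h1] at e'
  · simp only [gadgetParent, Option.some.injEq, Prod.mk.injEq] at e
    obtain ⟨rfl, rfl⟩ := e
    rcases h' with _ | K' | K' | ⟨v, K'⟩ | ⟨v, k'⟩
    · simp [gadgetParent] at e'
    · simp [gadgetParent] at e'
    · simp only [gadgetParent, Option.some.injEq, Prod.mk.injEq, GadgetNode.choice.injEq] at e'
      rw [e'.1]
    · simp [gadgetParent] at e'
    · rcases gadgetParent_copy (hx := hx) (hI := hI) (v := .resolving) k' with ⟨_, h1⟩ | ⟨_, _, _, _, h1⟩ <;>
        simp [h1] at e'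
  · cases v
    · simp only [gadgetParent, Option.some.injEq, Prod.mk.injEq] at e
      obtain ⟨rfl, rfl⟩ := e
      rcases h' with _ | K' | K' | ⟨v, K'⟩ | ⟨v, k'⟩
      · simp [gadgetParent] at e'
      · simp only [gadgetParent, Option.some.injEq, Prod.mk.injEq, GadgetAct.pick.injEq] at e'
        rw [Subtype.ext e'.2]
      · rcases gadgetParent_copy (hx := hx) (hI := hI) (v := .maxmargin) k' with ⟨_, h1⟩ | ⟨_, _, _, _, h1⟩ <;>
          simp [h1] at e'
    · simp only [gadgetParent, Option.some.injEq, Prod.mk.injEq] at e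
      obtain ⟨rfl, rfl⟩ := e
      rcases h' with _ | K' | K' | ⟨v, K'⟩ | ⟨v, k'⟩
      · simp [gadgetParent] at e'
      · simp [gadgetParent] at e'
      · simp [gadgetParent] at e'
      · simp only [gadgetParent, Option.some.injEq, Prod.mk.injEq, GadgetNode.choice.injEq] at e'
        rw [e'.1]
      · rcases gadgetParent_copy (hx := hx) (hI := hI) (v := .resolving) k' with ⟨_, h1⟩ | ⟨_, _, _, _, h1⟩ <;>
          simp [h1] at e'
  · rcases h' with _ | K' | K' | ⟨v, K'⟩ | ⟨v, k'⟩
    · simp [gadgetParent] at e'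
    · rcases gadgetParent_copy (hx := hx) (hI := hI) k with ⟨_, h1⟩ | ⟨_, _, _, _, h1⟩ <;>
        (rw [← e', h1] at e; simp [gadgetParent] at e)
    · rcases gadgetParent_copy (hx := hx) (hI := hI) k with ⟨_, h1⟩ | ⟨_, _, _, _, h1⟩ <;>
        (rw [← e', h1] at e; simp [gadgetParent] at e)
    · rcases gadgetParent_copy (hx := hx) (hI := hI) (v := v) k with ⟨_, h1⟩ | ⟨_, _, _, _, h1⟩ <;>
        (cases v <;> (rw [← e', h1] at e; simp [gadgetParent] at e))
    · rcases gadgetParent_copy (hx := hx) (hI := hI) (v := v) k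
        with ⟨_, h1⟩ | ⟨_, g1, a1, p1, h1⟩ <;>
      rcases gadgetParent_copy (hx := hx) (hI := hI) (v := v) k'
        with ⟨_, h2⟩ | ⟨_, g2, a2, p2, h2⟩
      · rw [← e', h1, h2] at e
        simp only [Option.some.injEq, Prod.mk.injEq, GadgetAct.deal.injEq] at e
        rw [Subtype.ext e.2]
      · rw [← e', h1, h2] at e
        simp at e
      · rw [← e', h1, h2] at e
        simp at e
      · rw [← e', h1, h2] at e
        simp only [Option.some.injEq, Prod.mk.injEq, GadgetNode.copy.injEq,
          GadgetAct.old.injEq] at e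
        rw [← e.1, ← e.2] at p2
        rw [Subtype.ext (Γ.parent_inj _ _ _ _ p1 p2)]

/-- A rank function for the gadget tree. -/
def gadgetRank : (v : GadgetKind) → GadgetNode (Γ.oppInfosets I) (Γ.kept x I) v → ℕ
  | _, .root _ => 0
  | _, .choice _ => 1
  | _, .exit _ => 2
  | _, .deal _ _ => 2
  | _, .copy _ h => Γ.rank h.1 + 3

/-- The data of a gadget game of the kind `v`, with the utility `u`. -/
def gadgetTree (hx : Γ.IsStrategy .plus x) (hI : Γ.CanSolve x I) (v : GadgetKind)
    (u : GadgetNode (Γ.oppInfosets I) (Γ.kept x I) v → ℝ) : GameTree where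
  Node := GadgetNode (Γ.oppInfosets I) (Γ.kept x I) v
  Act := GadgetAct Γ.Node Γ.Act
  Obs := fun i => GadgetObs Γ.Node (Γ.Obs i) Γ.Act
  finite_node := GadgetNode.finite _ _ _
  root := .root v
  parent := Γ.gadgetParent x I hx hI v
  parent_eq_none_iff := by
    intro h
    rcases h with _ | K | K | ⟨v, K⟩ | ⟨v, h⟩
    · simp [gadgetParent]
    · simp [gadgetParent]
    · simp [gadgetParent]
    · cases v <;> simp [gadgetParent]
    · rcases gadgetParent_copy (hx := hx) (hI := hI) (v := v) h
        with ⟨_, h1⟩ | ⟨_, _, _, _, h1⟩ <;> simp [h1]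
  parent_inj := fun _ _ _ _ e e' => gadgetParent_inj e e'
  acyclic := by
    refine ⟨gadgetRank v, ?_⟩
    intro h g a e
    rcases h with _ | K | K | ⟨v, K⟩ | ⟨v, h⟩
    · simp [gadgetParent] at e
    · simp only [gadgetParent, Option.some.injEq, Prod.mk.injEq] at e
      rw [← e.1]
      simp [gadgetRank]
    · simp only [gadgetParent, Option.some.injEq, Prod.mk.injEq] at e
      rw [← e.1]
      simp [gadgetRank]
    · cases v <;>
      · simp only [gadgetParent, Option.some.injEq, Prod.mk.injEq] at e
        rw [← e.1]
        simp [gadgetRank]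
    · rcases gadgetParent_copy (hx := hx) (hI := hI) (v := v) h
        with ⟨_, h1⟩ | ⟨_, _, _, hp, h1⟩
      · rw [h1] at e
        simp only [Option.some.injEq, Prod.mk.injEq] at e
        rw [← e.1]
        simp [gadgetRank]
      · rw [h1] at e
        simp only [Option.some.injEq, Prod.mk.injEq] at e
        rw [← e.1]
        simp [gadgetRank, Γ.rank_lt hp]
  mover := Γ.gadgetMover x I v
  obs := fun i => Γ.gadgetObs x I i v
  chance := Γ.gadgetChance x I v
  util := u

theorem gadget_parent_copy {hx : Γ.IsStrategy .plus x} {hI : Γ.CanSolve x I} {v : GadgetKind}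
    {n : GadgetNode (Γ.oppInfosets I) (Γ.kept x I) v} {h : Γ.kept x I}
    {b : GadgetAct Γ.Node Γ.Act} :
    Γ.gadgetParent x I hx hI v n = some (.copy v h, b) ↔
      ∃ (c : Γ.kept x I) (a : Γ.Act),
        n = .copy v c ∧ b = .old a ∧ Γ.parent c.1 = some (h.1, a) := by
  constructor
  · intro e
    rcases n with _ | K | K | ⟨v, K⟩ | ⟨v, c⟩
    · simp [gadgetParent] at e
    · simp [gadgetParent] at e
    · simp [gadgetParent] at e
    · cases v <;> simp [gadgetParent] at e
    · rcases gadgetParent_copy (hx := hx) (hI := hI) (v := v) c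
        with ⟨_, h1⟩ | ⟨_, g, a, hp, h1⟩
      · simp [h1] at e
      · rw [h1] at e
        simp only [Option.some.injEq, Prod.mk.injEq, GadgetNode.copy.injEq] at e
        exact ⟨c, a, rfl, e.2.symm, e.1 ▸ hp⟩
  · rintro ⟨c, a, rfl, rfl, hp⟩
    exact gadgetParent_not_top (hI.child_not_top h.2.1 ⟨a, hp⟩) hp

theorem gadget_parent_root {hx : Γ.IsStrategy .plus x} {hI : Γ.CanSolve x I}
    {n : GadgetNode (Γ.oppInfosets I) (Γ.kept x I) .resolving} {b : GadgetAct Γ.Node Γ.Act}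
    (hb : Γ.gadgetParent x I hx hI .resolving n = some (.root _, b)) : ∃ K, n = .choice K := by
  rcases n with _ | K' | K' | ⟨v, K'⟩ | ⟨v, k⟩
  · simp [gadgetParent] at hb
  · exact ⟨K', rfl⟩
  · simp [gadgetParent] at hb
  · simp [gadgetParent] at hb
  · rcases gadgetParent_copy (hx := hx) (hI := hI) (v := .resolving) k
      with ⟨_, h1⟩ | ⟨_, _, _, _, h1⟩ <;> simp [h1] at hb

theorem gadget_parent_exit {hx : Γ.IsStrategy .plus x} {hI : Γ.CanSolve x I}
    {n : GadgetNode (Γ.oppInfosets I) (Γ.kept x I) .resolving} {b : GadgetAct Γ.Node Γ.Act}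
    {K : Γ.oppInfosets I}
    (hb : Γ.gadgetParent x I hx hI .resolving n = some (.exit K, b)) : False := by
  rcases n with _ | K' | K' | ⟨v, K'⟩ | ⟨v, k⟩
  · simp [gadgetParent] at hb
  · simp [gadgetParent] at hb
  · simp [gadgetParent] at hb
  · simp [gadgetParent] at hb
  · rcases gadgetParent_copy (hx := hx) (hI := hI) (v := .resolving) k
      with ⟨_, h1⟩ | ⟨_, _, _, _, h1⟩ <;> simp [h1] at hb

theorem gadget_parent_deal {hx : Γ.IsStrategy .plus x} {hI : Γ.CanSolve x I} {v : GadgetKind}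
    {n : GadgetNode (Γ.oppInfosets I) (Γ.kept x I) v} {K : Γ.oppInfosets I} :
    (∃ b, Γ.gadgetParent x I hx hI v n = some (.deal v K, b)) ↔
      ∃ c : Γ.kept x I, n = .copy v c ∧ c.1 ∈ K.1 := by
  constructor
  · rintro ⟨b, e⟩
    rcases n with _ | K | K | ⟨v, K⟩ | ⟨v, c⟩
    · simp [gadgetParent] at e
    · simp [gadgetParent] at e
    · simp [gadgetParent] at e
    · cases v <;> simp [gadgetParent] at e
    · rcases gadgetParent_copy (hx := hx) (hI := hI) (v := v) c
        with ⟨ht, h1⟩ | ⟨_, g, a, hp, h1⟩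
      · rw [h1] at e
        simp only [Option.some.injEq, Prod.mk.injEq, GadgetNode.deal.injEq] at e
        refine ⟨c, rfl, ?_⟩
        rw [← e.1]
        exact ⟨ht.1, rfl⟩
      · simp [h1] at e
  · rintro ⟨c, rfl, hc⟩
    refine ⟨.deal c.1, ?_⟩
    rw [gadgetParent_top (mem_top_of_mem K.2 hc)]
    congr 3
    exact Subtype.ext (infoset_eq_of_mem K.2 hc)

variable {hx : Γ.IsStrategy .plus x} {hI : Γ.CanSolve x I} {v : GadgetKind}
  {u : GadgetNode (Γ.oppInfosets I) (Γ.kept x I) v → ℝ}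

variable (hx hI v u) in
/-- The copy of `h` as a node of the gadget game. -/
def gadgetCopy (h : Γ.kept x I) : (gadgetTree hx hI v u).Node := GadgetNode.copy v h

theorem gadget_child_copy {n : (gadgetTree hx hI v u).Node} {h : Γ.kept x I} :
    (gadgetTree hx hI v u).IsChild (gadgetCopy hx hI v u h) n ↔
      ∃ c : Γ.kept x I, n = gadgetCopy hx hI v u c ∧ Γ.IsChild h.1 c.1 := by
  constructor
  · rintro ⟨b, e⟩
    obtain ⟨c, a, h1, -, h3⟩ := (gadget_parent_copy (hx := hx) (hI := hI)).1 e
    exact ⟨c, h1, a, h3⟩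
  · rintro ⟨c, h1, a, h3⟩
    exact ⟨.old a, (gadget_parent_copy (hx := hx) (hI := hI)).2 ⟨c, a, h1, rfl, h3⟩⟩

theorem kept_child_of_below {h c : Γ.Node} (hh : h ∈ Γ.kept x I) (hb : h ∈ Γ.below I)
    (hc : Γ.IsChild h c) : c ∈ Γ.kept x I :=
  ⟨below_child hh.1 hc, Or.inl (below_child hb hc)⟩

theorem kept_child_of_mover (hx : Γ.IsStrategy .plus x) {h c : Γ.Node} (hh : h ∈ Γ.kept x I)
    (hm : Γ.mover h ≠ some .plus) (hc : Γ.IsChild h c) : c ∈ Γ.kept x I := by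
  refine ⟨below_child hh.1 hc, ?_⟩
  rcases hh.2 with hb | hpos
  · exact Or.inl (below_child hb hc)
  · right
    rwa [hx.child_eq hc hm]

theorem gadget_terminal_copy {h : Γ.kept x I} :
    (gadgetTree hx hI v u).IsTerminal (gadgetCopy hx hI v u h) ↔ Γ.IsTerminal h.1 := by
  constructor
  · intro ht
    by_contra hn
    have hn' := hn
    simp only [IsTerminal, not_forall, not_not] at hn'
    obtain ⟨c, hc⟩ := hn'
    have key : ∃ c, Γ.IsChild h.1 c ∧ c ∈ Γ.kept x I := by
      by_cases hb : h.1 ∈ Γ.below I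
      · exact ⟨c, hc, kept_child_of_below h.2 hb hc⟩
      · by_cases hm : Γ.mover h.1 = some .plus
        · have hpos : 0 < x (Γ.at' .plus h.1) := h.2.2.resolve_left hb
          rw [← hx.flow' hn hm] at hpos
          obtain ⟨d, hd, hd'⟩ := (Finset.sum_pos_iff_of_nonneg fun d _ => hx.nonneg _).1 hpos
          have hd2 := (Finset.mem_filter.1 hd).2
          exact ⟨d, hd2, below_child h.2.1 hd2, Or.inr hd'⟩
        · exact ⟨c, hc, kept_child_of_mover hx h.2 hm hc⟩
    obtain ⟨d, hd, hk⟩ := key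
    exact ht _ (gadget_child_copy.2 ⟨⟨d, hk⟩, rfl, hd⟩)
  · intro ht n hn
    obtain ⟨c, -, hc⟩ := gadget_child_copy.1 hn
    exact ht _ hc

theorem gadget_sum {S : (gadgetTree hx hI v u).Node → Prop} {P : Γ.Node → Prop}
    (hS : ∀ n, S n ↔ ∃ c : Γ.kept x I, n = gadgetCopy hx hI v u c ∧ P c.1)
    (F : (gadgetTree hx hI v u).Node → ℝ) (f : Γ.Node → ℝ)
    (hF : ∀ c : Γ.kept x I, P c.1 → F (gadgetCopy hx hI v u c) = f c.1)
    (hf : ∀ c, P c → c ∉ Γ.kept x I → f c = 0) :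
    ∑ n with S n, F n = ∑ c with P c, f c := by
  have h1 : ∑ c with P c, f c = ∑ c with P c ∧ c ∈ Γ.kept x I, f c := by
    rw [← Finset.filter_filter]
    refine (Finset.sum_filter_of_ne ?_).symm
    intro c hc hne
    by_contra hk
    exact hne (hf c (by simpa using hc) hk)
  rw [h1]
  symm
  refine Finset.sum_bij
    (fun c hc => gadgetCopy hx hI v u ⟨c, (Finset.mem_filter.1 hc).2.2⟩) ?_ ?_ ?_ ?_
  · intro c hc
    have hc' := (Finset.mem_filter.1 hc).2
    exact Finset.mem_filter.2 ⟨Finset.mem_univ _, (hS _).2 ⟨⟨c, hc'.2⟩, rfl, hc'.1⟩⟩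
  · intro c hc d hd e
    have := GadgetNode.copy.inj e
    exact congrArg Subtype.val this
  · intro n hn
    obtain ⟨c, rfl, hc⟩ := (hS n).1 (Finset.mem_filter.1 hn).2
    exact ⟨c.1, Finset.mem_filter.2 ⟨Finset.mem_univ _, hc, c.2⟩, rfl⟩
  · intro c hc
    have hc' := (Finset.mem_filter.1 hc).2
    exact (hF ⟨c, hc'.2⟩ hc'.1).symm

/-- Translates sequences of a gadget game back to sequences of the original game. -/
def decodeSeq {N O A : Type} : List (GadgetObs N O A ⊕ GadgetAct N A) → List (O ⊕ A)
  | [] => []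
  | .inl (.entry s) :: _ => s
  | .inl (.old o) :: l => .inl o :: decodeSeq l
  | .inr (.old a) :: l => .inr a :: decodeSeq l
  | _ :: l => decodeSeq l

theorem decode_copy (i : Player) (h : Γ.kept x I) (hi : i = .plus → h.1 ∈ Γ.below I)
    (ht : ¬ Γ.IsTerminal h.1) :
    decodeSeq ((gadgetTree hx hI v u).seq i (gadgetCopy hx hI v u h)) = Γ.seq i h.1 := by
  induction hn : Γ.rank h.1 using Nat.strong_induction_on generalizing h with
  | _ n ih =>
    have ht' : ¬ (gadgetTree hx hI v u).IsTerminal (gadgetCopy hx hI v u h) :=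
      fun e => ht (gadget_terminal_copy.1 e)
    rw [seq.eq_1 (gadgetTree hx hI v u), obsPart_of_not_terminal ht']
    by_cases htop : h.1 ∈ Γ.top I
    · have ho : (gadgetTree hx hI v u).obs i (gadgetCopy hx hI v u h) =
          GadgetObs.entry (Γ.seq i h.1) := by
        cases i
        · have hb := hi rfl
          cases v <;> simp [gadgetTree, gadgetCopy, gadgetObs, htop, hb]
        · cases v <;> simp [gadgetTree, gadgetCopy, gadgetObs, htop]
      rw [ho]
      rfl
    · have ho : (gadgetTree hx hI v u).obs i (gadgetCopy hx hI v u h) =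
          GadgetObs.old (Γ.obs i h.1) := by
        cases i
        · have hb := hi rfl
          cases v <;> simp [gadgetTree, gadgetCopy, gadgetObs, htop, hb]
        · cases v <;> simp [gadgetTree, gadgetCopy, gadgetObs, htop]
      rw [ho]
      obtain ⟨⟨g, a⟩, hp⟩ := kept_parent hx hI h.2 htop
      have hp' : (gadgetTree hx hI v u).parent (gadgetCopy hx hI v u h) =
          some (gadgetCopy hx hI v u g, GadgetAct.old a) :=
        gadgetParent_not_top (hx := hx) (hI := hI) (v := v) htop hp
      have hgi : i = .plus → g.1 ∈ Γ.below I := by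
        intro e
        obtain ⟨k, hk, hA⟩ := hi e
        refine ⟨k, hk, anc_parent hA ?_ hp⟩
        rintro rfl
        exact htop (hI.mem_top hk)
      have hm : (gadgetTree hx hI v u).mover (gadgetCopy hx hI v u g) = some i ↔
          Γ.mover g.1 = some i := by
        have : (gadgetTree hx hI v u).mover (gadgetCopy hx hI v u g) =
            if Γ.mover g.1 = some .plus ∧ g.1 ∉ Γ.below I then none else Γ.mover g.1 := by
          cases v <;> rfl
        rw [this]
        split_ifs with hc
        · rw [hc.1]
          cases i
          · exact absurd (hgi rfl) hc.2
          · simp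
        · rfl
      have hg := ih _ (hn ▸ Γ.rank_lt hp) g hgi (not_terminal_of_child ⟨a, hp⟩) rfl
      have hR : Γ.seq i h.1 = Sum.inl (Γ.obs i h.1) ::
          ((if Γ.mover g.1 = some i then [Sum.inr a] else []) ++ Γ.seq i g.1) := by
        rw [seq, obsPart_of_not_terminal ht, preSeq_of_parent i hp]
        rfl
      rw [preSeq_of_parent i hp', hR, ← hg]
      by_cases hmi : Γ.mover g.1 = some i
      · rw [if_pos hmi, if_pos (hm.2 hmi)]
        rfl
      · rw [if_neg hmi, if_neg (fun e => hmi (hm.1 e))]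
        rfl

theorem gadget_mover_copy (h : Γ.kept x I) : (gadgetTree hx hI v u).mover (gadgetCopy hx hI v u h) =
    if Γ.mover h.1 = some .plus ∧ h.1 ∉ Γ.below I then none else Γ.mover h.1 := by
  cases v <;> rfl

theorem gadget_mover_eq {h : Γ.kept x I} {i : Player}
    (e : (gadgetTree hx hI v u).mover (gadgetCopy hx hI v u h) = some i) :
    Γ.mover h.1 = some i ∧ (i = .plus → h.1 ∈ Γ.below I) := by
  rw [gadget_mover_copy] at e
  split_ifs at e with hc
  refine ⟨e, ?_⟩
  rintro rfl
  by_contra hb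
  exact hc ⟨e, hb⟩

/-- The observation at a copied node of the player to move. -/
theorem gadget_obs_copy {h : Γ.kept x I} {i : Player} (hi : i = .plus → h.1 ∈ Γ.below I) :
    (gadgetTree hx hI v u).obs i (gadgetCopy hx hI v u h) =
      if h.1 ∈ Γ.top I then GadgetObs.entry (Γ.seq i h.1) else GadgetObs.old (Γ.obs i h.1) := by
  cases i
  · have hb := hi rfl
    cases v <;> simp [gadgetTree, gadgetCopy, gadgetObs, hb]
  · cases v <;> simp [gadgetTree, gadgetCopy, gadgetObs]

/-- A node with the same observation as a copied node of the player to move is such a copy. -/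
theorem gadget_obs_eq {h : Γ.kept x I} {n : (gadgetTree hx hI v u).Node}
    {i : Player} (hi : i = .plus → h.1 ∈ Γ.below I)
    (e : (gadgetTree hx hI v u).obs i (gadgetCopy hx hI v u h) = (gadgetTree hx hI v u).obs i n) :
    ∃ h' : Γ.kept x I, n = gadgetCopy hx hI v u h' ∧ (i = .plus → h'.1 ∈ Γ.below I) := by
  rw [gadget_obs_copy hi] at e
  rcases n with _ | K | K | ⟨v, K⟩ | ⟨v, h'⟩
  · cases i <;> cases v <;> split_ifs at e <;> simp [gadgetTree, gadgetObs] at e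
  · cases i <;> split_ifs at e <;> simp [gadgetTree, gadgetObs] at e
  · cases i <;> split_ifs at e <;> simp [gadgetTree, gadgetObs] at e
  · cases i <;> cases v <;> split_ifs at e <;> simp [gadgetTree, gadgetObs] at e
  · refine ⟨h', rfl, ?_⟩
    rintro rfl
    by_contra hb
    cases v <;> split_ifs at e <;> simp [gadgetTree, gadgetObs, hb] at e

theorem mass_pos {Γ : Game} {x : Γ.Seq .plus → ℝ} (hx : Γ.IsStrategy .plus x)
    {K : Set Γ.Node} {h : Γ.Node} (hh : h ∈ K) (hpos : 0 < x (Γ.at' .plus h)) :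
    0 < Γ.mass x K := by
  refine (Finset.sum_pos_iff_of_nonneg fun k _ => ?_).2 ⟨h, by simpa using hh, ?_⟩
  · exact mul_nonneg (reach_pos Γ k).le (hx.nonneg _)
  · exact mul_pos (reach_pos Γ h) hpos

theorem kept_top_pos (hI : Γ.CanSolve x I) {h : Γ.Node} (hk : h ∈ Γ.kept x I)
    (ht : h ∈ Γ.top I) : 0 < x (Γ.at' .plus h) := by
  rcases hk.2 with hb | hpos
  · exact hI.2 h (hI.mem_of_top ht hb)
  · exact hpos

theorem gadget_chance_top (h : Γ.kept x I) (ht : h.1 ∈ Γ.top I) :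
    (gadgetTree hx hI v u).chance (gadgetCopy hx hI v u h) =
      Γ.reach h.1 * x (Γ.at' .plus h.1) / Γ.mass x (Γ.infoset .minus h.1) := by
  cases v <;> simp [gadgetTree, gadgetCopy, gadgetChance, ht]

theorem gadget_chance_not_top (h : Γ.kept x I) {g : Γ.Node} {a : Γ.Act} (ht : h.1 ∉ Γ.top I)
    (hp : Γ.parent h.1 = some (g, a)) :
    (gadgetTree hx hI v u).chance (gadgetCopy hx hI v u h) =
      if Γ.mover g = some .plus then x (Γ.at' .plus h.1) / x (Γ.at' .plus g)
      else Γ.chance h.1 := by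
  cases v <;> simp [gadgetTree, gadgetCopy, gadgetChance, ht, hp]

theorem gadget_child_deal {n : (gadgetTree hx hI v u).Node} {K : Γ.oppInfosets I} :
    (gadgetTree hx hI v u).IsChild (GadgetNode.deal v K) n ↔
      ∃ c : Γ.kept x I, n = gadgetCopy hx hI v u c ∧ c.1 ∈ K.1 :=
  gadget_parent_deal (hx := hx) (hI := hI)

theorem gadget_obs_mover {Γ : Game} {x : Γ.Seq .plus → ℝ} {I : Set Γ.Node}
    {hx : Γ.IsStrategy .plus x} {hI : Γ.CanSolve x I} {v : GadgetKind}
    {u : GadgetNode (Γ.oppInfosets I) (Γ.kept x I) v → ℝ} (i : Player)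
    (h h' : (gadgetTree hx hI v u).Node) (ht : ¬ (gadgetTree hx hI v u).IsTerminal h)
    (ht' : ¬ (gadgetTree hx hI v u).IsTerminal h')
    (e : (gadgetTree hx hI v u).obs i h = (gadgetTree hx hI v u).obs i h')
    (hm : (gadgetTree hx hI v u).mover h = some i) :
    (gadgetTree hx hI v u).mover h' = some i := by
  rcases h with _ | K | K | ⟨v, K⟩ | ⟨v, h⟩
  · cases v
    · have hi : i = .minus := by simpa [gadgetTree, gadgetMover, eq_comm] using hm
      subst hi
      rcases h' with _ | K' | K' | ⟨v, K'⟩ | ⟨v, h'⟩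
      · rfl
      · simp [gadgetTree, gadgetObs] at e
      · simp only [gadgetTree, gadgetObs] at e
        split_ifs at e
    · simp [gadgetTree, gadgetMover] at hm
  · have hi : i = .minus := by simpa [gadgetTree, gadgetMover, eq_comm] using hm
    subst hi
    rcases h' with _ | K' | K' | ⟨v, K'⟩ | ⟨v, h'⟩
    · simp [gadgetTree, gadgetObs] at e
    · rfl
    · simp [gadgetTree, gadgetObs] at e
    · simp [gadgetTree, gadgetObs] at e
    · simp only [gadgetTree, gadgetObs] at e
      split_ifs at e
  · simp [gadgetTree, gadgetMover] at hm
  · cases v <;> simp [gadgetTree, gadgetMover] at hm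
  · change ¬ (gadgetTree hx hI v u).IsTerminal (gadgetCopy hx hI v u h) at ht
    change (gadgetTree hx hI v u).obs i (gadgetCopy hx hI v u h) = _ at e
    obtain ⟨hm', hb⟩ := gadget_mover_eq hm
    obtain ⟨k, rfl, hb'⟩ := gadget_obs_eq hb e
    rw [gadget_terminal_copy] at ht ht'
    rw [gadget_obs_copy hb, gadget_obs_copy hb'] at e
    have key : Γ.mover k.1 = some i := by
      split_ifs at e
      · have e1 := GadgetObs.entry.inj e
        rw [seq, seq, obsPart_of_not_terminal ht, obsPart_of_not_terminal ht'] at e1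
        simp only [List.cons_append, List.nil_append, List.cons.injEq, Sum.inl.injEq] at e1
        exact Γ.obs_mover i _ _ ht ht' e1.1 hm'
      · exact Γ.obs_mover i _ _ ht ht' (GadgetObs.old.inj e) hm'
    rw [gadget_mover_copy, if_neg, key]
    rintro ⟨h1, h2⟩
    rw [key] at h1
    exact h2 (hb' (by simpa using h1))

theorem gadget_same_actions {Γ : Game} {x : Γ.Seq .plus → ℝ} {I : Set Γ.Node}
    {hx : Γ.IsStrategy .plus x} {hI : Γ.CanSolve x I} {v : GadgetKind}
    {u : GadgetNode (Γ.oppInfosets I) (Γ.kept x I) v → ℝ} (i : Player)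
    (h h' c : (gadgetTree hx hI v u).Node) (a : (gadgetTree hx hI v u).Act)
    (ht : ¬ (gadgetTree hx hI v u).IsTerminal h)
    (ht' : ¬ (gadgetTree hx hI v u).IsTerminal h')
    (hm : (gadgetTree hx hI v u).mover h = some i)
    (es : (gadgetTree hx hI v u).seq i h = (gadgetTree hx hI v u).seq i h')
    (hc : (gadgetTree hx hI v u).parent c = some (h, a)) :
    ∃ c', (gadgetTree hx hI v u).parent c' = some (h', a) := by
  have e : (gadgetTree hx hI v u).obs i h = (gadgetTree hx hI v u).obs i h' := by
    have es' := es
    rw [seq, seq, obsPart_of_not_terminal ht, obsPart_of_not_terminal ht'] at es'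
    simp only [List.cons_append, List.nil_append, List.cons.injEq, Sum.inl.injEq] at es'
    exact es'.1
  rcases h with _ | K | K | ⟨v, K⟩ | ⟨v, h⟩
  · cases v
    · have hi : i = .minus := by simpa [gadgetTree, gadgetMover, eq_comm] using hm
      subst hi
      rcases h' with _ | K' | K' | ⟨v, K'⟩ | ⟨v, h'⟩
      · exact ⟨c, hc⟩
      · simp [gadgetTree, gadgetObs] at e
      · simp only [gadgetTree, gadgetObs] at e
        split_ifs at e
    · simp [gadgetTree, gadgetMover] at hm
  · have hi : i = .minus := by simpa [gadgetTree, gadgetMover, eq_comm] using hm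
    subst hi
    rcases h' with _ | K' | K' | ⟨v, K'⟩ | ⟨v, h'⟩
    · simp [gadgetTree, gadgetObs] at e
    · simp only [gadgetTree, gadgetObs, GadgetObs.choose.injEq] at e
      rw [← Subtype.ext e]
      exact ⟨c, hc⟩
    · simp [gadgetTree, gadgetObs] at e
    · simp [gadgetTree, gadgetObs] at e
    · simp only [gadgetTree, gadgetObs] at e
      split_ifs at e
  · simp [gadgetTree, gadgetMover] at hm
  · cases v <;> simp [gadgetTree, gadgetMover] at hm
  · change ¬ (gadgetTree hx hI v u).IsTerminal (gadgetCopy hx hI v u h) at ht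
    change (gadgetTree hx hI v u).obs i (gadgetCopy hx hI v u h) = _ at e
    change (gadgetTree hx hI v u).seq i (gadgetCopy hx hI v u h) = _ at es
    obtain ⟨hm', hb⟩ := gadget_mover_eq hm
    obtain ⟨k, rfl, hb'⟩ := gadget_obs_eq hb e
    rw [gadget_terminal_copy] at ht ht'
    have es2 := congrArg decodeSeq es
    rw [decode_copy i h hb ht, decode_copy i k hb' ht'] at es2
    obtain ⟨d, b, rfl, rfl, hd⟩ := (gadget_parent_copy (hx := hx) (hI := hI)).1 hc
    obtain ⟨d', hd'⟩ := Γ.same_actions i _ _ _ _ ht ht' hm' es2 hd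
    have hk : d' ∈ Γ.kept x I := by
      by_cases hkb : k.1 ∈ Γ.below I
      · exact kept_child_of_below k.2 hkb ⟨b, hd'⟩
      · refine kept_child_of_mover hx k.2 ?_ ⟨b, hd'⟩
        intro hmk
        have h1 : Γ.mover k.1 = some i := by
          have hobs := es2
          rw [seq, seq, obsPart_of_not_terminal ht, obsPart_of_not_terminal ht'] at hobs
          simp only [List.cons_append, List.nil_append, List.cons.injEq, Sum.inl.injEq] at hobs
          exact Γ.obs_mover i _ _ ht ht' hobs.1 hm'
        rw [hmk] at h1
        exact hkb (hb' (by simpa using h1.symm))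
    exact ⟨GadgetNode.copy v ⟨d', hk⟩,
      (gadget_parent_copy (hx := hx) (hI := hI) (v := v)).2 ⟨⟨d', hk⟩, b, rfl, rfl, hd'⟩⟩

theorem gadget_chance_pos {Γ : Game} {x : Γ.Seq .plus → ℝ} {I : Set Γ.Node}
    {hx : Γ.IsStrategy .plus x} {hI : Γ.CanSolve x I} {v : GadgetKind}
    {u : GadgetNode (Γ.oppInfosets I) (Γ.kept x I) v → ℝ}
    (h c : (gadgetTree hx hI v u).Node) (hm : (gadgetTree hx hI v u).mover h = none)
    (hc : (gadgetTree hx hI v u).IsChild h c) : 0 < (gadgetTree hx hI v u).chance c := by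
  have hne : 0 < (Nat.card (Γ.oppInfosets I) : ℝ)⁻¹ ∨ IsEmpty (Γ.oppInfosets I) := by
    rcases isEmpty_or_nonempty (Γ.oppInfosets I) with he | hn
    · exact Or.inr he
    · left
      have : 0 < Nat.card (Γ.oppInfosets I) := Nat.card_pos
      positivity
  rcases h with _ | K | K | ⟨v, K⟩ | ⟨v, h⟩
  · cases v
    · simp [gadgetTree, gadgetMover] at hm
    · obtain ⟨b, hb⟩ := hc
      obtain ⟨K', rfl⟩ := gadget_parent_root (hx := hx) (hI := hI) hb
      exact hne.resolve_right (fun he => he.false K')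
  · simp [gadgetTree, gadgetMover] at hm
  · exfalso
    obtain ⟨b, hb⟩ := hc
    exact gadget_parent_exit (hx := hx) (hI := hI) hb
  · obtain ⟨k, rfl, hk⟩ := gadget_child_deal.1 hc
    have ht := mem_top_of_mem K.2 hk
    have hpos := kept_top_pos hI k.2 ht
    rw [gadget_chance_top k ht]
    exact div_pos (mul_pos (reach_pos Γ k.1) hpos) (mass_pos hx ⟨ht.1, rfl⟩ hpos)
  · change (gadgetTree hx hI v u).mover (gadgetCopy hx hI v u h) = _ at hm
    obtain ⟨k, rfl, hk⟩ := gadget_child_copy.1 hc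
    have ht := hI.child_not_top h.2.1 hk
    have hk' := hk
    obtain ⟨a, hp⟩ := hk'
    rw [gadget_chance_not_top k ht hp]
    rw [gadget_mover_copy] at hm
    split_ifs with hpl
    · split_ifs at hm with hcon
      · have hkb : k.1 ∉ Γ.below I := by
          rintro ⟨g, hg, hA⟩
          refine hcon.2 ⟨g, hg, anc_parent hA ?_ hp⟩
          rintro rfl
          exact ht (hI.mem_top hg)
        exact div_pos (k.2.2.resolve_left hkb) (h.2.2.resolve_left hcon.2)
      · simp [hpl] at hm
    · split_ifs at hm with hcon
      · exact absurd hcon.1 hpl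
      · exact Γ.chance_pos _ _ hm hk

theorem gadget_chance_sum {Γ : Game} {x : Γ.Seq .plus → ℝ} {I : Set Γ.Node}
    {hx : Γ.IsStrategy .plus x} {hI : Γ.CanSolve x I} {v : GadgetKind}
    {u : GadgetNode (Γ.oppInfosets I) (Γ.kept x I) v → ℝ}
    (h : (gadgetTree hx hI v u).Node) (hnt : ¬ (gadgetTree hx hI v u).IsTerminal h)
    (hm : (gadgetTree hx hI v u).mover h = none) : (gadgetTree hx hI v u).chanceSum h = 1 := by
  rcases h with _ | K | K | ⟨v, K⟩ | ⟨v, h⟩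
  · cases v
    · simp [gadgetTree, gadgetMover] at hm
    · have hiff : ∀ n, (gadgetTree hx hI .resolving u).IsChild (GadgetNode.root .resolving) n ↔
          ∃ K, n = GadgetNode.choice K := by
        intro n
        constructor
        · rintro ⟨b, hb⟩
          exact gadget_parent_root (hx := hx) (hI := hI) hb
        · rintro ⟨K, rfl⟩
          exact ⟨.pick K.1, rfl⟩
      have hK : Nonempty (Γ.oppInfosets I) := by
        by_contra he
        refine hnt fun n hn => ?_
        obtain ⟨K, -⟩ := (hiff n).1 hn
        exact he ⟨K⟩
      have hfin : Fintype (Γ.oppInfosets I) := Fintype.ofFinite _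
      have key : (gadgetTree hx hI .resolving u).chanceSum (GadgetNode.root .resolving) =
          ∑ _K : Γ.oppInfosets I, (Nat.card (Γ.oppInfosets I) : ℝ)⁻¹ := by
        symm
        refine Finset.sum_bij (fun K _ => GadgetNode.choice K) ?_ ?_ ?_ ?_
        · intro K _
          exact Finset.mem_filter.2 ⟨Finset.mem_univ _, (hiff _).2 ⟨K, rfl⟩⟩
        · intro K _ K' _ e
          exact GadgetNode.choice.inj e
        · intro n hn
          obtain ⟨K, rfl⟩ := (hiff n).1 (Finset.mem_filter.1 hn).2
          exact ⟨K, Finset.mem_univ _, rfl⟩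
        · intro K _
          rfl
      rw [key, Finset.sum_const, Finset.card_univ, ← Nat.card_eq_fintype_card, nsmul_eq_mul]
      have : (Nat.card (Γ.oppInfosets I) : ℝ) ≠ 0 := by
        exact_mod_cast Nat.card_pos.ne'
      field_simp
  · simp [gadgetTree, gadgetMover] at hm
  · exfalso
    refine hnt fun c hc => ?_
    obtain ⟨b, hb⟩ := hc
    exact gadget_parent_exit (hx := hx) (hI := hI) hb
  · have hpos : 0 < Γ.mass x K.1 := by
      obtain ⟨-, k, hk, hkI⟩ := K.2
      exact mass_pos hx hk (hI.2 k hkI)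
    have := gadget_sum (fun n => gadget_child_deal (n := n) (K := K))
      (gadgetTree hx hI v u).chance
      (fun c => Γ.reach c * x (Γ.at' .plus c) / Γ.mass x K.1) ?_ ?_
    · refine this.trans ?_
      rw [← Finset.sum_div]
      exact div_self hpos.ne'
    · intro c hc
      rw [gadget_chance_top c (mem_top_of_mem K.2 hc), infoset_eq_of_mem K.2 hc]
    · intro c hc hk
      have h0 : x (Γ.at' .plus c) = 0 := by
        refine le_antisymm (not_lt.1 fun hp => hk ?_) (hx.nonneg _)
        exact ⟨⟨c, mem_top_of_mem K.2 hc, .refl⟩, Or.inr hp⟩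
      simp [h0]
  · change (gadgetTree hx hI v u).mover (gadgetCopy hx hI v u h) = _ at hm
    change ¬ (gadgetTree hx hI v u).IsTerminal (gadgetCopy hx hI v u h) at hnt
    rw [gadget_terminal_copy] at hnt
    rw [gadget_mover_copy] at hm
    by_cases hpl : Γ.mover h.1 = some .plus
    · split_ifs at hm with hcon
      · have hpos := h.2.2.resolve_left hcon.2
        have := gadget_sum (fun n => gadget_child_copy (n := n) (h := h))
          (gadgetTree hx hI v u).chance
          (fun c => x (Γ.at' .plus c) / x (Γ.at' .plus h.1)) ?_ ?_
        · refine this.trans ?_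
          rw [← Finset.sum_div, hx.flow' hnt hpl]
          exact div_self hpos.ne'
        · intro c hc
          have hc' := hc
          obtain ⟨a, hp⟩ := hc'
          rw [gadget_chance_not_top c (hI.child_not_top h.2.1 hc) hp, if_pos hpl]
        · intro c hc hk
          have h0 : x (Γ.at' .plus c) = 0 := by
            refine le_antisymm (not_lt.1 fun hp => hk ?_) (hx.nonneg _)
            exact ⟨below_child h.2.1 hc, Or.inr hp⟩
          simp [h0]
      · simp [hpl] at hm
    · have hm' : Γ.mover h.1 = none := by
        split_ifs at hm with hcon
        · exact absurd hcon.1 hpl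
        · exact hm
      have := gadget_sum (fun n => gadget_child_copy (n := n) (h := h))
        (gadgetTree hx hI v u).chance Γ.chance ?_ ?_
      · exact this.trans (Γ.chance_sum h.1 hnt hm')
      · intro c hc
        have hc' := hc
        obtain ⟨a, hp⟩ := hc'
        rw [gadget_chance_not_top c (hI.child_not_top h.2.1 hc) hp, if_neg hpl]
      · intro c hc hk
        exact absurd (kept_child_of_mover hx h.2 hpl hc) hk

end gadget

end GameTree

namespace Game

variable (Γ : Game)

/-- The gadget game `Γ[I]` of 1-KLSS at the infoset `I` with the blueprint `x`. -/
def gadget {x : Γ.Seq .plus → ℝ} {I : Set Γ.Node} (hx : Γ.IsStrategy .plus x)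
    (hI : Γ.CanSolve x I) (o : Γ.SolveOptions x I) : Game where
  toGameTree := GameTree.gadgetTree hx hI o.kind (Γ.gadgetUtil x I o o.kind)
  obs_mover := GameTree.gadget_obs_mover
  same_actions := GameTree.gadget_same_actions
  chance_pos := GameTree.gadget_chance_pos
  chance_sum := GameTree.gadget_chance_sum

variable {Γ} in
/-- The copy in `Γ[I]` of a node `h` of `Γ`. -/
def copy {x : Γ.Seq .plus → ℝ} {I : Set Γ.Node} (hx : Γ.IsStrategy .plus x)
    (hI : Γ.CanSolve x I) (o : Γ.SolveOptions x I) (h : Γ.kept x I) : (Γ.gadget hx hI o).Node :=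
  GadgetNode.copy o.kind h

/-- `I` is a next infoset of `plus` after those that make up the set `done`: she moves there, it is
not among those in `done`, and all earlier nodes at which she moves are in `done`. -/
def IsNext (done I : Set Γ.Node) : Prop :=
  Γ.IsDecisionInfoset .plus I ∧ ∀ h ∈ I, h ∉ done ∧
    ∀ g, Γ.Anc g h → g ≠ h → Γ.mover g = some .plus → g ∈ done

/-- `KLSSRun Γ done x x'`: nested 1-KLSS in the game `Γ` with the blueprint `x`, performed at every
infoset that `plus` reaches after those in `done` (at which subgame solving has been performed
already), can create the strategy `x'`. At each next infoset `I` that is reached, an NE strategy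
`sol I` of the gadget game `Γ[I]` is computed; then `Γ[I]` replaces `Γ`, and `sol I` replaces the
blueprint, which leads to the strategy `cont I` in `Γ[I]`. The strategy `x'` plays `cont I` in `Ī`,
for each of these `I`, and it plays `x` elsewhere. -/
inductive KLSSRun : (Γ : Game) → (done : Set Γ.Node) → (x x' : Γ.Seq .plus → ℝ) → Prop
  | run (Γ : Game) (done : Set Γ.Node) (x x' : Γ.Seq .plus → ℝ)
      (hx : Γ.IsStrategy .plus x) (hx' : Γ.IsStrategy .plus x')
      (o : ∀ I, Γ.IsNext done I → Γ.CanSolve x I → Γ.SolveOptions x I)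
      (sol cont : ∀ (I : Set Γ.Node) (hN : Γ.IsNext done I) (hI : Γ.CanSolve x I),
        (Γ.gadget hx hI (o I hN hI)).Seq .plus → ℝ)
      (sol_ne : ∀ I hN hI, (Γ.gadget hx hI (o I hN hI)).IsNEStrategy (sol I hN hI))
      (nested : ∀ I hN hI, KLSSRun (Γ.gadget hx hI (o I hN hI))
        {n | ∃ h : Γ.kept x I, h.1 ∈ I ∧ n = copy hx hI (o I hN hI) h}
        (sol I hN hI) (cont I hN hI))
      (inside : ∀ I hN hI, ∀ g ∈ I, ∀ h : Γ.kept x I, Γ.Anc g h.1 →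
        x' (Γ.at' .plus h.1) = x (Γ.at' .plus g) *
          cont I hN hI ((Γ.gadget hx hI (o I hN hI)).at' .plus (copy hx hI (o I hN hI) h)))
      (outside : ∀ h, (∀ I, Γ.IsNext done I → Γ.CanSolve x I → h ∉ Γ.below I) →
        x' (Γ.at' .plus h) = x (Γ.at' .plus h)) :
      KLSSRun Γ done x x'

end Game

end

/-! The theorem rests on a safety statement about a single solve, `IsComposite.isNEStrategy`: if the
blueprint `x` is an NE strategy and `w` is an NE strategy of the gadget game at `I`, then the
composite X that follows `w` at and below `I` and `x` elsewhere is again an NE strategy.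

Safety has three ingredients. First, the blueprint itself earns at least 0 in the gadget game,
because the alternate payoffs never exceed the values that it guarantees at the start infosets
(`blueprint_payoff_nonneg`). So an equilibrium strategy `w` earns at least 0 against every opponent.
Second, `minus` may commit to one start infoset K and continue there as in any strategy of the
original game; hence X concedes at K at most the gift relative to u*(x|K) (`IsComposite.margin`).
Third, such a concession costs nothing overall. The potential of an internal node is u*(x|K) minus
the errors that `minus` has made on the way, and that of a terminal node is its utility. Under `x`
and any `y`, the expected potential does not decrease from one depth to the next
(`sum_potential_le`), because best responses at the infosets following an action combine into one
strategy (`cfValue_pre_le`). Thus a value guaranteed by `x` is bounded by what is collected up to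
the depth of `I` plus the expected potential there (`le_sum_potential`). Up to that depth X
coincides with `x`; below it, the margins bound the potential at infosets meeting `I`, and at all
others X still plays like `x`. This gives `IsComposite.le_payoff`.

For the nested procedure one inducts on the run. The new blueprint in a gadget game is an
equilibrium strategy there, so by induction the final strategy in that game is an affine combination
of equilibrium strategies. Forming the composite is affine in the gadget strategy, so safety,
applied to each term, puts the composite V_I in the affine span of the NE strategies of the original
game (`exists_affine_composite`). The regions below distinct next infosets are disjoint
(`IsNext.eq_of_below`), so the created strategy equals x + ∑_I (V_I - x), which lies in the same
affine span. Coefficients outside [0, 1] appear here because the differences are added up, not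
averaged. -/

namespace GameTree

/-! ### Depth, ancestors and sums over the game tree. -/

variable {Γ : GameTree}

/-- The number of proper ancestors of `h`. -/
noncomputable def depth (h : Γ.Node) : ℕ := obsCount (Γ.preSeq .plus h)

theorem depth_child {g c : Γ.Node} (hc : Γ.IsChild g c) : depth c = depth g + 1 :=
  obsCount_child .plus hc

theorem obsCount_preSeq (i : Player) (h : Γ.Node) : obsCount (Γ.preSeq i h) = depth h :=
  obsCount_eq h i .plus

theorem parent_root : Γ.parent Γ.root = none := (Γ.parent_eq_none_iff _).2 rfl

theorem preSeq_root (i : Player) : Γ.preSeq i Γ.root = [] := by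
  rw [preSeq]
  split
  · rfl
  · simp_all [parent_root]

theorem depth_root : depth Γ.root = 0 := by
  rw [depth, preSeq_root]
  rfl

theorem exists_parent {h : Γ.Node} (hr : h ≠ Γ.root) : ∃ g, Γ.IsChild g h := by
  cases hp : Γ.parent h with
  | none => exact absurd ((Γ.parent_eq_none_iff h).1 hp) hr
  | some q => exact ⟨q.1, q.2, hp⟩

theorem isChild_unique {g g' c : Γ.Node} (h : Γ.IsChild g c) (h' : Γ.IsChild g' c) : g = g' := by
  obtain ⟨a, ha⟩ := h
  obtain ⟨b, hb⟩ := h'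
  rw [ha] at hb
  simp only [Option.some.injEq, Prod.mk.injEq] at hb
  exact hb.1

theorem depth_eq_zero {h : Γ.Node} (hd : depth h = 0) : h = Γ.root := by
  by_contra hr
  obtain ⟨g, hg⟩ := exists_parent hr
  rw [depth_child hg] at hd
  omega

/-- Induction from the root towards the terminal nodes. -/
theorem down_induction {P : Γ.Node → Prop} (root : P Γ.root)
    (child : ∀ g c, Γ.IsChild g c → P g → P c) (h : Γ.Node) : P h := by
  induction hd : depth h generalizing h with
  | zero => rwa [depth_eq_zero hd]
  | succ d ih =>
    have hr : h ≠ Γ.root := by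
      rintro rfl
      rw [depth_root] at hd
      omega
    obtain ⟨g, hg⟩ := exists_parent hr
    refine child g h hg (ih g ?_)
    rw [depth_child hg] at hd
    omega

/-- Induction from the terminal nodes towards the root. -/
theorem up_induction {P : Γ.Node → Prop} (step : ∀ h, (∀ c, Γ.IsChild h c → P c) → P h)
    (h : Γ.Node) : P h := by
  obtain ⟨N, hN⟩ : ∃ N, ∀ k : Γ.Node, depth k ≤ N :=
    ⟨Finset.univ.sup depth, fun k => Finset.le_sup (Finset.mem_univ k)⟩
  induction hd : N - depth h using Nat.strong_induction_on generalizing h with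
  | _ n ih =>
    refine step h fun c hc => ih (N - depth c) ?_ c rfl
    have := hN c
    have := depth_child hc
    omega

theorem Anc.depth_le {g h : Γ.Node} (hA : Γ.Anc g h) : depth g ≤ depth h := depth_anc hA

theorem Anc.trans' {g h k : Γ.Node} (h1 : Γ.Anc g h) (h2 : Γ.Anc h k) : Γ.Anc g k :=
  Relation.ReflTransGen.trans h1 h2

theorem Anc.of_child {g h : Γ.Node} (h1 : Γ.IsChild g h) : Γ.Anc g h :=
  Relation.ReflTransGen.single h1

theorem anc_refl (h : Γ.Node) : Γ.Anc h h := Relation.ReflTransGen.refl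

theorem anc_root (h : Γ.Node) : Γ.Anc Γ.root h :=
  down_induction (anc_refl _) (fun _ _ hc hA => hA.tail hc) h

theorem Anc.eq_or_child {g h : Γ.Node} (hA : Γ.Anc g h) :
    g = h ∨ ∃ c, Γ.IsChild g c ∧ Γ.Anc c h :=
  (Relation.ReflTransGen.cases_head hA).imp id id

theorem Anc.not_terminal {g h : Γ.Node} (hA : Γ.Anc g h) (hne : g ≠ h) : ¬ Γ.IsTerminal g := by
  obtain ⟨c, hc, -⟩ := hA.eq_or_child.resolve_left hne
  exact not_terminal_of_child hc

/-- Each node has a single parent, so the ancestors of `z` form a chain, ordered by depth. -/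
theorem Anc.of_depth_le {a b z : Γ.Node} (ha : Γ.Anc a z) (hb : Γ.Anc b z)
    (hd : depth a ≤ depth b) : Γ.Anc a b := by
  induction hb with
  | refl => exact ha
  | @tail y z hby hyz ih =>
    by_cases hne : a = z
    · subst hne
      have h1 : depth b ≤ depth y := Anc.depth_le hby
      have h2 := depth_child hyz
      omega
    · obtain ⟨e, he⟩ := hyz
      exact ih (anc_parent ha hne he)

theorem Anc.eq_of_depth {a b z : Γ.Node} (ha : Γ.Anc a z) (hb : Γ.Anc b z)
    (hd : depth a = depth b) : a = b :=
  anc_eq_of_depth (ha.of_depth_le hb hd.le) hd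

theorem exists_anc_depth {d : ℕ} {z : Γ.Node} (hd : d ≤ depth z) :
    ∃ h, Γ.Anc h z ∧ depth h = d := by
  revert hd
  refine down_induction (P := fun z => d ≤ depth z → ∃ h, Γ.Anc h z ∧ depth h = d) ?_ ?_ z
  · intro hd
    rw [depth_root] at hd
    exact ⟨Γ.root, anc_refl _, by rw [depth_root]; omega⟩
  · intro g c hc ih hd
    rcases Nat.lt_or_ge (depth g) d with h1 | h1
    · refine ⟨c, anc_refl _, ?_⟩
      rw [depth_child hc] at hd ⊢
      omega
    · obtain ⟨h, hA, e⟩ := ih h1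
      exact ⟨h, hA.tail hc, e⟩

/-- A sum over nodes below an antichain, split along the antichain. -/
theorem sum_below {H : Γ.Node → Prop} [DecidablePred H] {d : ℕ} (hH : ∀ h, H h → depth h = d)
    (T : Γ.Node → Prop)
    (F : Γ.Node → ℝ) :
    ∑ z with T z ∧ ∃ h, H h ∧ Γ.Anc h z, F z = ∑ h with H h, ∑ z with T z ∧ Γ.Anc h z, F z := by
  rw [← Finset.sum_biUnion]
  · refine Finset.sum_congr ?_ fun _ _ => rfl
    ext z
    simp only [Finset.mem_filter, Finset.mem_univ, true_and, Finset.mem_biUnion]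
    exact ⟨fun ⟨h1, h, h2, h3⟩ => ⟨h, h2, h1, h3⟩, fun ⟨h, h2, h1, h3⟩ => ⟨h1, h, h2, h3⟩⟩
  · intro a ha b hb hne
    refine Finset.disjoint_left.2 fun z hz hz' => hne ?_
    simp only [Finset.coe_filter, Finset.mem_univ, true_and, Set.mem_ofPred_eq,
      Finset.mem_filter] at ha hb hz hz'
    -- Two ancestors of `z` at the same depth coincide, so the sets below distinct nodes of the
    -- family are disjoint.
    exact hz.2.eq_of_depth hz'.2 ((hH a ha).trans (hH b hb).symm)

theorem sum_terminal_of_terminal {h : Γ.Node} (ht : Γ.IsTerminal h) (F : Γ.Node → ℝ) :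
    ∑ z with Γ.IsTerminal z ∧ Γ.Anc h z, F z = F h := by
  rw [Finset.sum_eq_single_of_mem h]
  · simpa using ⟨ht, anc_refl h⟩
  · intro b hb hne
    simp only [Finset.mem_filter, Finset.mem_univ, true_and] at hb
    by_contra
    exact hb.2.not_terminal (Ne.symm hne) ht

theorem sum_terminal_of_not_terminal {h : Γ.Node} (ht : ¬ Γ.IsTerminal h) (F : Γ.Node → ℝ) :
    ∑ z with Γ.IsTerminal z ∧ Γ.Anc h z, F z =
      ∑ c with Γ.IsChild h c, ∑ z with Γ.IsTerminal z ∧ Γ.Anc c z, F z := by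
  rw [← sum_below (d := depth h + 1) (fun c hc => depth_child hc)]
  refine Finset.sum_congr (Finset.filter_congr fun z _ => and_congr_right fun hz => ?_)
    fun _ _ => rfl
  constructor
  · intro hA
    refine hA.eq_or_child.resolve_left ?_
    rintro rfl
    exact ht hz
  · rintro ⟨c, hc, hA⟩
    exact (Anc.of_child hc).trans' hA

/-- If a function on nodes is conserved at internal nodes, then its value at `h` is the sum of its
values at the terminal nodes below `h`. -/
theorem sum_terminal_eq {F : Γ.Node → ℝ}
    (hF : ∀ h, ¬ Γ.IsTerminal h → ∑ c with Γ.IsChild h c, F c = F h) (h : Γ.Node) :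
    ∑ z with Γ.IsTerminal z ∧ Γ.Anc h z, F z = F h := by
  refine up_induction (P := fun h => ∑ z with Γ.IsTerminal z ∧ Γ.Anc h z, F z = F h) ?_ h
  intro h ih
  by_cases ht : Γ.IsTerminal h
  · exact sum_terminal_of_terminal ht F
  · rw [sum_terminal_of_not_terminal ht, ← hF h ht]
    exact Finset.sum_congr rfl fun c hc => ih c (Finset.mem_filter.1 hc).2

theorem sum_sum_child (P : Γ.Node → Prop) [DecidablePred P] (F : Γ.Node → ℝ) :
    ∑ h with P h, ∑ c with Γ.IsChild h c, F c = ∑ c with ∃ h, P h ∧ Γ.IsChild h c, F c := by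
  rw [← Finset.sum_biUnion]
  · refine Finset.sum_congr ?_ fun _ _ => rfl
    ext z
    simp
  · intro a _ b _ hne
    refine Finset.disjoint_left.2 fun z hz hz' => hne ?_
    exact isChild_unique (Finset.mem_filter.1 hz).2 (Finset.mem_filter.1 hz').2

theorem reach_root : Γ.reach Γ.root = 1 := by
  rw [reach]
  split
  · rfl
  · simp_all [parent_root]

theorem reach_child {g c : Γ.Node} (hc : Γ.IsChild g c) :
    Γ.reach c = Γ.reach g * (if Γ.mover g = none then Γ.chance c else 1) := by
  obtain ⟨a, hp⟩ := hc
  rw [reach]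
  split
  · simp_all
  · rename_i g' a' hp'
    rw [hp] at hp'
    simp only [Option.some.injEq, Prod.mk.injEq] at hp'
    obtain ⟨rfl, rfl⟩ := hp'
    rfl

/-! ### Sequences -/

variable {i : Player}

theorem seq_of_not_terminal {h : Γ.Node} (ht : ¬ Γ.IsTerminal h) :
    Γ.seq i h = Sum.inl (Γ.obs i h) :: Γ.preSeq i h := by
  rw [seq, obsPart_of_not_terminal ht]
  rfl

theorem seq_of_terminal {h : Γ.Node} (ht : Γ.IsTerminal h) : Γ.seq i h = Γ.preSeq i h := by
  rw [seq, obsPart, if_pos ht]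
  rfl

theorem preSeq_suffix_seq (h : Γ.Node) : Γ.preSeq i h <:+ Γ.seq i h := ⟨_, rfl⟩

theorem preSeq_child_of_mover {g c : Γ.Node} {a : Γ.Act} (hp : Γ.parent c = some (g, a))
    (hm : Γ.mover g = some i) : Γ.preSeq i c = Sum.inr a :: Γ.seq i g := by
  rw [preSeq_of_parent i hp, if_pos hm]
  rfl

theorem preSeq_child_of_ne {g c : Γ.Node} (hc : Γ.IsChild g c)
    (hm : Γ.mover g ≠ some i) : Γ.preSeq i c = Γ.seq i g := by
  obtain ⟨a, hp⟩ := hc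
  rw [preSeq_of_parent i hp, if_neg hm]
  rfl

theorem seq_suffix_preSeq_child {g c : Γ.Node} (hc : Γ.IsChild g c) :
    Γ.seq i g <:+ Γ.preSeq i c := by
  obtain ⟨a, hp⟩ := hc
  exact ⟨_, (preSeq_of_parent i hp).symm⟩

theorem Anc.seq_suffix {g h : Γ.Node} (hA : Γ.Anc g h) : Γ.seq i g <:+ Γ.seq i h := by
  induction hA with
  | refl => exact List.suffix_rfl
  | tail _ hc ih => exact ih.trans ((seq_suffix_preSeq_child hc).trans (preSeq_suffix_seq _))

theorem Anc.preSeq_suffix {g h : Γ.Node} (hA : Γ.Anc g h) : Γ.preSeq i g <:+ Γ.preSeq i h := by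
  induction hA with
  | refl => exact List.suffix_rfl
  | tail _ hc ih => exact ih.trans ((preSeq_suffix_seq _).trans (seq_suffix_preSeq_child hc))

theorem Anc.seq_suffix_preSeq {g h : Γ.Node} (hA : Γ.Anc g h) (hne : g ≠ h) :
    Γ.seq i g <:+ Γ.preSeq i h := by
  cases hA with
  | refl => exact absurd rfl hne
  | tail h1 hc => exact (Anc.seq_suffix h1).trans (seq_suffix_preSeq_child hc)

/-- A prefix of the sequence at `h` is a sequence at an ancestor of `h`. -/
theorem exists_anc_of_suffix {l : List (Γ.Obs i ⊕ Γ.Act)} {h : Γ.Node} (hl : l <:+ Γ.seq i h) :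
    ∃ k, Γ.Anc k h ∧ (l = Γ.preSeq i k ∨ (¬ Γ.IsTerminal k ∧ l = Γ.seq i k)) := by
  revert hl
  refine down_induction (P := fun h => l <:+ Γ.seq i h →
    ∃ k, Γ.Anc k h ∧ (l = Γ.preSeq i k ∨ (¬ Γ.IsTerminal k ∧ l = Γ.seq i k))) ?_ ?_ h
  · intro hl
    refine ⟨Γ.root, anc_refl _, ?_⟩
    by_cases ht : Γ.IsTerminal Γ.root
    · rw [seq_of_terminal ht, preSeq_root, List.suffix_nil] at hl
      exact Or.inl (by rw [hl, preSeq_root])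
    · rw [seq_of_not_terminal ht, List.suffix_cons_iff] at hl
      rcases hl with hl | hl
      · exact Or.inr ⟨ht, by rw [hl, seq_of_not_terminal ht]⟩
      · rw [preSeq_root, List.suffix_nil] at hl
        exact Or.inl (by rw [hl, preSeq_root])
  · intro g c hc ih hl
    have key : l <:+ Γ.preSeq i c →
        ∃ k, Γ.Anc k c ∧ (l = Γ.preSeq i k ∨ (¬ Γ.IsTerminal k ∧ l = Γ.seq i k)) := by
      intro hl
      have key2 : l <:+ Γ.seq i g →
          ∃ k, Γ.Anc k c ∧ (l = Γ.preSeq i k ∨ (¬ Γ.IsTerminal k ∧ l = Γ.seq i k)) := by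
        intro hl
        obtain ⟨k, hk, e⟩ := ih hl
        exact ⟨k, hk.tail hc, e⟩
      by_cases hm : Γ.mover g = some i
      · obtain ⟨a, hp⟩ := hc
        rw [preSeq_child_of_mover hp hm, List.suffix_cons_iff] at hl
        rcases hl with hl | hl
        · exact ⟨c, anc_refl _, Or.inl (by rw [hl, preSeq_child_of_mover hp hm])⟩
        · exact key2 hl
      · rw [preSeq_child_of_ne hc hm] at hl
        exact key2 hl
    by_cases ht : Γ.IsTerminal c
    · rw [seq_of_terminal ht] at hl
      exact key hl
    · rw [seq_of_not_terminal ht, List.suffix_cons_iff] at hl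
      rcases hl with hl | hl
      · exact ⟨c, anc_refl _, Or.inr ⟨ht, by rw [hl, seq_of_not_terminal ht]⟩⟩
      · exact key hl

/-- A sequence ending in an observation that is the sequence just before a node is the sequence at
the parent of this node, where the player does not move. -/
theorem parent_of_preSeq_eq_seq {k h : Γ.Node} (ht : ¬ Γ.IsTerminal k)
    (e : Γ.seq i k = Γ.preSeq i h) :
    ∃ g, Γ.IsChild g h ∧ Γ.mover g ≠ some i ∧ Γ.seq i g = Γ.seq i k := by
  have hr : h ≠ Γ.root := by
    rintro rfl
    rw [preSeq_root, seq_of_not_terminal ht] at e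
    simp at e
  obtain ⟨g, hc⟩ := exists_parent hr
  by_cases hm : Γ.mover g = some i
  · obtain ⟨a, hp⟩ := hc
    rw [preSeq_child_of_mover hp hm, seq_of_not_terminal ht] at e
    simp at e
  · exact ⟨g, hc, hm, by rw [e, preSeq_child_of_ne hc hm]⟩

theorem seq_inj {h h' : Γ.Node} (ht : ¬ Γ.IsTerminal h) (ht' : ¬ Γ.IsTerminal h')
    (e : Γ.seq i h = Γ.seq i h') : Γ.obs i h = Γ.obs i h' ∧ Γ.preSeq i h = Γ.preSeq i h' := by
  rw [seq_of_not_terminal ht, seq_of_not_terminal ht'] at e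
  simpa using e

theorem depth_eq' {h h' : Γ.Node} (ht : ¬ Γ.IsTerminal h) (ht' : ¬ Γ.IsTerminal h')
    (e : Γ.seq i h = Γ.seq i h') : depth h = depth h' := depth_eq ht ht' e

/-- Both players observe something at every internal node, so the number of observations in a
sequence recovers the depth. This synchrony is what allows arguments that go depth by depth. -/
theorem depth_eq_of_preSeq {h h' : Γ.Node} (e : Γ.preSeq i h = Γ.preSeq i h') :
    depth h = depth h' := by
  rw [← obsCount_preSeq i, e, obsCount_preSeq]

theorem obsCount_le_of_suffix {O A : Type} {l l' : List (O ⊕ A)} (h : l <:+ l') :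
    obsCount l ≤ obsCount l' := List.Sublist.countP_le h.sublist

/-- A node strictly below which another one lies has a longer sequence. -/
theorem depth_lt_of_seq_suffix_preSeq {k h : Γ.Node} (ht : ¬ Γ.IsTerminal k)
    (e : Γ.seq i k <:+ Γ.preSeq i h) : depth k < depth h := by
  have := obsCount_le_of_suffix e
  rw [obsCount_seq i ht, obsCount_preSeq, obsCount_preSeq] at this
  omega

/-- Two nodes at equal depths with sequences that are prefixes of the same sequence. -/
theorem seq_eq_of_suffix {k k' : Γ.Node} {l : List (Γ.Obs i ⊕ Γ.Act)} (ht : ¬ Γ.IsTerminal k)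
    (ht' : ¬ Γ.IsTerminal k') (hd : depth k = depth k') (h1 : Γ.seq i k <:+ l)
    (h2 : Γ.seq i k' <:+ l) : Γ.seq i k = Γ.seq i k' := by
  rcases List.suffix_or_suffix_of_suffix h1 h2 with h | h
  · rw [seq_of_not_terminal ht', List.suffix_cons_iff] at h
    rcases h with h | h
    · rw [h, seq_of_not_terminal ht']
    · have := depth_lt_of_seq_suffix_preSeq ht h
      omega
  · rw [seq_of_not_terminal ht, List.suffix_cons_iff] at h
    rcases h with h | h
    · rw [h, seq_of_not_terminal ht]
    · have := depth_lt_of_seq_suffix_preSeq ht' h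
      omega

/-- The nodes `z` with `s_i(k) ⪯ s_i(z)` are those below the infoset of `k`. -/
theorem seq_suffix_seq_iff {k z : Γ.Node} (ht : ¬ Γ.IsTerminal k) :
    Γ.seq i k <:+ Γ.seq i z ↔ ∃ g, g ∈ Γ.infoset i k ∧ Γ.Anc g z := by
  constructor
  · intro h
    obtain ⟨g, hg, e | ⟨hgt, e⟩⟩ := exists_anc_of_suffix h
    · obtain ⟨g', hc, -, e'⟩ := parent_of_preSeq_eq_seq ht e
      exact ⟨g', ⟨not_terminal_of_child hc, e'⟩, (Anc.of_child hc).trans' hg⟩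
    · exact ⟨g, ⟨hgt, e.symm⟩, hg⟩
  · rintro ⟨g, hg, hA⟩
    rw [← hg.2]
    exact hA.seq_suffix

theorem mover_eq_of_seq {Γ : Game} {i : Player} {h h' : Γ.Node} (ht : ¬ Γ.IsTerminal h)
    (ht' : ¬ Γ.IsTerminal h') (e : Γ.seq i h = Γ.seq i h') (hm : Γ.mover h = some i) :
    Γ.mover h' = some i :=
  Γ.obs_mover i h h' ht ht' (seq_inj ht ht' e).1 hm

/-- If `i` moves at `k`, the entry after this sequence is always an action. Were it the sequence
just before some node, it would be the sequence at a parent in the infoset of `k` where `i` does not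
move, but an observation determines whether she moves. -/
theorem preSeq_ne_seq {Γ : Game} {i : Player} {h k : Γ.Node} (ht : ¬ Γ.IsTerminal k)
    (hm : Γ.mover k = some i) : Γ.preSeq i h ≠ Γ.seq i k := by
  intro e
  obtain ⟨g, hc, hg, e'⟩ := parent_of_preSeq_eq_seq ht e.symm
  exact hg (mover_eq_of_seq ht (not_terminal_of_child hc) e'.symm hm)

/-- The prefix occurs on the path to `z` either just before a node or at an internal node `g`. In
the second case `i` cannot move at `g`, so the next node on the path has this same sequence just
before it; `hz` ensures that there is such a next node. -/
theorem exists_anc_preSeq_eq {Γ : Game} {i : Player} {c z : Γ.Node}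
    (h : Γ.preSeq i c <:+ Γ.seq i z) (hz : Γ.IsTerminal z ∨ Γ.preSeq i c ≠ Γ.seq i z) :
    ∃ d, Γ.preSeq i d = Γ.preSeq i c ∧ Γ.Anc d z := by
  obtain ⟨g, hg, e | ⟨hgt, e⟩⟩ := exists_anc_of_suffix h
  · exact ⟨g, e.symm, hg⟩
  · have hgz : g ≠ z := by
      rintro rfl
      exact hz.elim hgt fun hne => hne e
    obtain ⟨d, hd, hA⟩ := hg.eq_or_child.resolve_left hgz
    refine ⟨d, ?_, hA⟩
    rw [e, preSeq_child_of_ne hd fun hm => preSeq_ne_seq hgt hm e]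

/-- The terminal nodes `z` with `s ⪯ s_i(z)`, where `s` is the sequence just before `c`. -/
theorem preSeq_suffix_seq_iff {Γ : Game} {i : Player} {c z : Γ.Node} (hz : Γ.IsTerminal z) :
    Γ.preSeq i c <:+ Γ.seq i z ↔ ∃ d, Γ.preSeq i d = Γ.preSeq i c ∧ Γ.Anc d z := by
  refine ⟨fun h => exists_anc_preSeq_eq h (Or.inl hz), ?_⟩
  rintro ⟨d, e, hA⟩
  rw [← e]
  exact hA.preSeq_suffix.trans (preSeq_suffix_seq z)

/-- At nodes with equal sequences, the player to move has the same children, up to sequences. -/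
theorem sum_child_congr {Γ : Game} {i : Player} {g k : Γ.Node} (ht : ¬ Γ.IsTerminal g)
    (ht' : ¬ Γ.IsTerminal k) (e : Γ.seq i g = Γ.seq i k) (hm : Γ.mover g = some i)
    (F : List (Γ.Obs i ⊕ Γ.Act) → ℝ) :
    ∑ c with Γ.IsChild g c, F (Γ.preSeq i c) = ∑ c with Γ.IsChild k c, F (Γ.preSeq i c) := by
  have hm' := mover_eq_of_seq ht ht' e hm
  -- An action determines a child, so the sequences just before the children are distinct; both sums
  -- then run over one common set of sequences.
  have inj : ∀ {g : Γ.Node}, Γ.mover g = some i → Set.InjOn (Γ.preSeq i)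
      (Finset.univ.filter fun c => Γ.IsChild g c : Finset Γ.Node) := by
    intro g hm c hc d hd hcd
    obtain ⟨a, ha⟩ := (Finset.mem_filter.1 hc).2
    obtain ⟨b, hb⟩ := (Finset.mem_filter.1 hd).2
    rw [preSeq_child_of_mover ha hm, preSeq_child_of_mover hb hm] at hcd
    simp only [List.cons.injEq, Sum.inr.injEq, and_true] at hcd
    exact Γ.parent_inj _ _ _ _ ha (hcd ▸ hb)
  have sub : ∀ {g k : Γ.Node}, ¬ Γ.IsTerminal g → ¬ Γ.IsTerminal k → Γ.seq i g = Γ.seq i k →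
      Γ.mover g = some i → Γ.mover k = some i → ∀ c, Γ.IsChild g c →
      ∃ d, Γ.IsChild k d ∧ Γ.preSeq i d = Γ.preSeq i c := by
    rintro g k ht ht' e hm hm' c ⟨a, ha⟩
    obtain ⟨d, hd⟩ := Γ.same_actions i g k c a ht ht' hm e ha
    exact ⟨d, ⟨a, hd⟩, by rw [preSeq_child_of_mover ha hm, preSeq_child_of_mover hd hm', e]⟩
  rw [← Finset.sum_image (f := F) (inj hm), ← Finset.sum_image (f := F) (inj hm')]
  refine Finset.sum_congr ?_ fun _ _ => rfl
  ext l
  simp only [Finset.mem_image, Finset.mem_filter, Finset.mem_univ, true_and]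
  constructor
  · rintro ⟨c, hc, rfl⟩
    exact sub ht ht' e hm hm' c hc
  · rintro ⟨c, hc, rfl⟩
    exact sub ht' ht e.symm hm' hm c hc

end GameTree

/-! ### Sequence-form strategies: construction from functions on lists or nodes, and extension of
partial strategies. -/

namespace GameTree

variable {Γ : GameTree} {i : Player}

/-- A strategy as a function on all lists. -/
noncomputable def listValue (x : Γ.Seq i → ℝ) (l : List (Γ.Obs i ⊕ Γ.Act)) : ℝ :=
  if h : ∃ h, l = Γ.preSeq i h ∨ l = Γ.seq i h then x ⟨l, h⟩ else 0

theorem listValue_coe (x : Γ.Seq i → ℝ) (s : Γ.Seq i) : listValue x s.1 = x s := dif_pos s.2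

theorem listValue_preSeq (x : Γ.Seq i → ℝ) (h : Γ.Node) :
    listValue x (Γ.preSeq i h) = x (Γ.pre i h) := listValue_coe x (Γ.pre i h)

theorem listValue_seq (x : Γ.Seq i → ℝ) (h : Γ.Node) :
    listValue x (Γ.seq i h) = x (Γ.at' i h) := listValue_coe x (Γ.at' i h)

theorem at'_eq {h h' : Γ.Node} (e : Γ.seq i h = Γ.seq i h') : Γ.at' i h = Γ.at' i h' :=
  Subtype.ext e

theorem pre_eq {h h' : Γ.Node} (e : Γ.preSeq i h = Γ.preSeq i h') : Γ.pre i h = Γ.pre i h' :=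
  Subtype.ext e

theorem listValue_nonneg {x : Γ.Seq i → ℝ} (hx : Γ.IsStrategy i x)
    (l : List (Γ.Obs i ⊕ Γ.Act)) : 0 ≤ listValue x l := by
  unfold listValue
  split_ifs
  · exact hx.nonneg _
  · exact le_rfl

theorem Seq.cases (s : Γ.Seq i) : ∃ h, s = Γ.pre i h ∨ s = Γ.at' i h := by
  obtain ⟨l, h, e | e⟩ := s
  · exact ⟨h, Or.inl (Subtype.ext e)⟩
  · exact ⟨h, Or.inr (Subtype.ext e)⟩

theorem IsStrategy.anc_le {x : Γ.Seq i → ℝ} (hx : Γ.IsStrategy i x) {g h : Γ.Node}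
    (hA : Γ.Anc g h) : x (Γ.at' i h) ≤ x (Γ.at' i g) := by
  induction hA with
  | refl => exact le_rfl
  | tail _ hc ih => exact (hx.child_le hc).trans ih

theorem IsStrategy.at_root {x : Γ.Seq i → ℝ} (hx : Γ.IsStrategy i x) :
    x (Γ.at' i Γ.root) = 1 := (hx.observe _).trans hx.root

theorem IsStrategy.le_one {x : Γ.Seq i → ℝ} (hx : Γ.IsStrategy i x) (s : Γ.Seq i) : x s ≤ 1 := by
  have key : ∀ h, x (Γ.at' i h) ≤ 1 := fun h => (hx.anc_le (anc_root h)).trans hx.at_root.le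
  obtain ⟨k, rfl | rfl⟩ := s.cases
  · rw [← hx.observe]
    exact key k
  · exact key k

/-- A sequence is played with at most the probability of its prefixes. -/
theorem IsStrategy.le_of_suffix {x : Γ.Seq i → ℝ} (hx : Γ.IsStrategy i x) {s : Γ.Seq i}
    {h : Γ.Node} (hs : s.1 <:+ Γ.seq i h) : x (Γ.at' i h) ≤ x s := by
  obtain ⟨k, hk, e | ⟨-, e⟩⟩ := exists_anc_of_suffix hs
  · have : s = Γ.pre i k := Subtype.ext e
    rw [this, ← hx.observe]
    exact hx.anc_le hk
  · have : s = Γ.at' i k := Subtype.ext e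
    rw [this]
    exact hx.anc_le hk

/-- A function on lists that satisfies the constraints of a strategy. -/
theorem isStrategy_of_list {X : List (Γ.Obs i ⊕ Γ.Act) → ℝ} (nonneg : ∀ h, 0 ≤ X (Γ.preSeq i h))
    (root : X [] = 1)
    (observe : ∀ h, ¬ Γ.IsTerminal h → X (Γ.seq i h) = X (Γ.preSeq i h))
    (flow : ∀ h, ¬ Γ.IsTerminal h → Γ.mover h = some i →
      ∑ c with Γ.IsChild h c, X (Γ.preSeq i c) = X (Γ.seq i h)) :
    Γ.IsStrategy i fun s => X s.1 := by
  have obs' : ∀ h, X (Γ.seq i h) = X (Γ.preSeq i h) := by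
    intro h
    by_cases ht : Γ.IsTerminal h
    · rw [seq_of_terminal ht]
    · exact observe h ht
  refine ⟨?_, ?_, obs', flow⟩
  · intro s
    obtain ⟨k, rfl | rfl⟩ := s.cases
    · exact nonneg k
    · exact (nonneg k).trans_eq (obs' k).symm
  · exact (congrArg X (preSeq_root i)).trans root

/-- A function on nodes that satisfies the constraints of a strategy comes from a strategy. -/
theorem exists_strategy_of_node {f : Γ.Node → ℝ} (nonneg : ∀ h, 0 ≤ f h) (root : f Γ.root = 1)
    (resp : ∀ h h', Γ.preSeq i h = Γ.preSeq i h' → f h = f h')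
    (child : ∀ g c, Γ.IsChild g c → Γ.mover g ≠ some i → f c = f g)
    (flow : ∀ h, ¬ Γ.IsTerminal h → Γ.mover h = some i →
      ∑ c with Γ.IsChild h c, f c = f h) :
    ∃ x, Γ.IsStrategy i x ∧ ∀ h, x (Γ.at' i h) = f h := by
  let P : List (Γ.Obs i ⊕ Γ.Act) → Γ.Node → Prop := fun l h =>
    l = Γ.preSeq i h ∨ l = Γ.seq i h
  -- The same list can be the sequence just before one node and the sequence at another one. Then it
  -- is also the sequence at the parent of the former, where `i` does not move, which `child` and
  -- `resp` cover.
  have mixed : ∀ h h', Γ.preSeq i h = Γ.seq i h' → f h = f h' := by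
    intro h h' e
    by_cases ht : Γ.IsTerminal h'
    · rw [seq_of_terminal ht] at e
      exact resp _ _ e
    · obtain ⟨g, hc, hm, e'⟩ := parent_of_preSeq_eq_seq ht e.symm
      rw [child g h hc hm]
      exact resp _ _ (seq_inj (not_terminal_of_child hc) ht e').2
  have main : ∀ l h h', P l h → P l h' → f h = f h' := by
    rintro l h h' (e | e) (e' | e')
    · exact resp _ _ (e.symm.trans e')
    · exact mixed _ _ (e.symm.trans e')
    · exact (mixed _ _ (e'.symm.trans e)).symm
    · by_cases ht : Γ.IsTerminal h
      · rw [seq_of_terminal ht] at e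
        exact mixed _ _ (e.symm.trans e')
      by_cases ht' : Γ.IsTerminal h'
      · rw [seq_of_terminal ht'] at e'
        exact (mixed _ _ (e'.symm.trans e)).symm
      exact resp _ _ (seq_inj ht ht' (e.symm.trans e')).2
  -- `main` makes the value independent of the node that represents a sequence.
  let X : List (Γ.Obs i ⊕ Γ.Act) → ℝ := fun l => if h : ∃ h, P l h then f h.choose else 0
  have hX : ∀ l h, P l h → X l = f h := by
    intro l h hP
    have he : ∃ h, P l h := ⟨h, hP⟩
    simp only [X, dif_pos he]
    exact main l _ _ he.choose_spec hP
  have hpre : ∀ h, X (Γ.preSeq i h) = f h := fun h => hX _ h (Or.inl rfl)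
  have hat : ∀ h, X (Γ.seq i h) = f h := fun h => hX _ h (Or.inr rfl)
  refine ⟨fun s => X s.1, isStrategy_of_list ?_ ?_ ?_ ?_, hat⟩
  · intro h
    rw [hpre]
    exact nonneg h
  · rw [← preSeq_root (Γ := Γ) i, hpre, root]
  · intro h _
    rw [hpre, hat]
  · intro h ht hm
    rw [hat, ← flow h ht hm]
    exact Finset.sum_congr rfl fun c _ => hpre c

/-- Extends a function on lists from a set `D` by playing the actions `α` outside `D`. -/
noncomputable def extend {O A : Type} (D : Set (List (O ⊕ A))) (f : List (O ⊕ A) → ℝ)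
    (α : List (O ⊕ A) → Option A) : List (O ⊕ A) → ℝ
  | [] => if [] ∈ D then f [] else 1
  | .inl o :: l => if .inl o :: l ∈ D then f (.inl o :: l) else extend D f α l
  | .inr a :: l => if .inr a :: l ∈ D then f (.inr a :: l) else
      if α l = some a then extend D f α l else 0

theorem extend_of_mem {O A : Type} {D : Set (List (O ⊕ A))} {f : List (O ⊕ A) → ℝ}
    {α : List (O ⊕ A) → Option A} {l : List (O ⊕ A)} (hl : l ∈ D) : extend D f α l = f l := by
  rcases l with _ | ⟨_ | _, l⟩ <;> simp [extend, hl]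

theorem extend_nonneg {O A : Type} {D : Set (List (O ⊕ A))} {f : List (O ⊕ A) → ℝ}
    (hf : ∀ l ∈ D, 0 ≤ f l) (α : List (O ⊕ A) → Option A) (l : List (O ⊕ A)) :
    0 ≤ extend D f α l := by
  induction l with
  | nil =>
    rw [extend]
    split_ifs with h
    · exact hf _ h
    · exact zero_le_one
  | cons e l ih =>
    rcases e with o | a
    · rw [extend]
      split_ifs with h
      · exact hf _ h
      · exact ih
    · rw [extend]
      split_ifs with h
      · exact hf _ h
      · exact ih
      · exact le_rfl

/-- A partial strategy, given on a prefix-closed set `D` of sequences, extends to a strategy. -/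
theorem exists_strategy_extending {Γ : Game} {i : Player} (D : Set (List (Γ.Obs i ⊕ Γ.Act)))
    (f : List (Γ.Obs i ⊕ Γ.Act) → ℝ) (closed : ∀ l l', l' <:+ l → l ∈ D → l' ∈ D)
    (nonneg : ∀ l ∈ D, 0 ≤ f l) (root : [] ∈ D → f [] = 1)
    (observe : ∀ h, ¬ Γ.IsTerminal h → Γ.seq i h ∈ D → f (Γ.seq i h) = f (Γ.preSeq i h))
    (flow : ∀ h, ¬ Γ.IsTerminal h → Γ.mover h = some i → Γ.seq i h ∈ D →
      ∃ k, ¬ Γ.IsTerminal k ∧ Γ.seq i k = Γ.seq i h ∧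
        (∀ c, Γ.IsChild k c → Γ.preSeq i c ∈ D) ∧
        ∑ c with Γ.IsChild k c, f (Γ.preSeq i c) = f (Γ.seq i k)) :
    ∃ x, Γ.IsStrategy i x ∧ ∀ s, s.1 ∈ D → x s = f s.1 := by
  -- Outside `D`, one available action is fixed for each decision sequence and is played with
  -- certainty.
  let Q : List (Γ.Obs i ⊕ Γ.Act) → Γ.Act → Prop := fun l a =>
    ∃ h c, Γ.seq i h = l ∧ Γ.mover h = some i ∧ Γ.parent c = some (h, a)
  let α : List (Γ.Obs i ⊕ Γ.Act) → Option Γ.Act := fun l =>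
    if h : ∃ a, Q l a then some h.choose else none
  refine ⟨fun s => extend D f α s.1, isStrategy_of_list (fun h => extend_nonneg nonneg _ _) ?_ ?_ ?_,
    fun s hs => extend_of_mem hs⟩
  · rw [extend]
    split_ifs with h
    · exact root h
    · rfl
  · intro h ht
    by_cases hD : Γ.seq i h ∈ D
    · rw [extend_of_mem hD, extend_of_mem (closed _ _ (preSeq_suffix_seq h) hD)]
      exact observe h ht hD
    · rw [seq_of_not_terminal ht] at hD ⊢
      rw [extend, if_neg hD]
  · intro h ht hm
    by_cases hD : Γ.seq i h ∈ D
    · obtain ⟨k, hkt, hk, hkD, hsum⟩ := flow h ht hm hD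
      -- The flow condition at one representative `k` of the infoset suffices, since all its nodes
      -- have the same children up to sequences. This matters later, when only some nodes of an
      -- infoset survive in a gadget game.
      rw [sum_child_congr ht hkt hk.symm hm (extend D f α), extend_of_mem hD, ← hk, ← hsum]
      exact Finset.sum_congr rfl fun c hc => extend_of_mem (hkD c (Finset.mem_filter.1 hc).2)
    · have hex : ∃ a, Q (Γ.seq i h) a := by
        have ht' := ht
        simp only [IsTerminal, not_forall, not_not] at ht'
        obtain ⟨c, a, hc⟩ := ht'
        exact ⟨a, h, c, rfl, hm, hc⟩
      obtain ⟨k, d, hk, hmk, hd⟩ := hex.choose_spec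
      have hα : α (Γ.seq i h) = some hex.choose := dif_pos hex
      obtain ⟨c, hc⟩ := Γ.same_actions i k h d hex.choose (not_terminal_of_child ⟨_, hd⟩) ht hmk hk hd
      -- As `D` is prefix-closed, no child is in `D` either: the chosen action inherits the full
      -- value and all others get 0.
      have val : ∀ e b, Γ.parent e = some (h, b) → extend D f α (Γ.preSeq i e) =
          if b = hex.choose then extend D f α (Γ.seq i h) else 0 := by
        intro e b he
        have hnD : Γ.preSeq i e ∉ D := fun hh => hD (closed _ _ (seq_suffix_preSeq_child ⟨b, he⟩) hh)
        rw [preSeq_child_of_mover he hm] at hnD ⊢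
        rw [extend, if_neg hnD, hα]
        simp only [Option.some.injEq, eq_comm]
      rw [Finset.sum_eq_single_of_mem c (by simpa using ⟨_, hc⟩), val c _ hc, if_pos rfl]
      intro e he hne
      obtain ⟨b, hb⟩ := (Finset.mem_filter.1 he).2
      rw [val e b hb, if_neg]
      rintro rfl
      exact hne (Γ.parent_inj _ _ _ _ hb hc)

/-- Every sequence is played with certainty by some strategy. -/
theorem exists_strategy_reaching {Γ : Game} {i : Player} (s : Γ.Seq i) :
    ∃ x, Γ.IsStrategy i x ∧ x s = 1 := by
  suffices key : ∀ h, ∃ x, Γ.IsStrategy i x ∧ x (Γ.pre i h) = 1 by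
    obtain ⟨k, rfl | rfl⟩ := s.cases
    · exact key k
    · obtain ⟨x, hx, h1⟩ := key k
      exact ⟨x, hx, by rw [hx.observe, h1]⟩
  intro h
  let S := Γ.preSeq i h
  -- The prefixes of the target and all sequences one action off it. The indicator of the prefixes
  -- plays towards the target, and gives 0 to actions that deviate from it.
  let D : Set (List (Γ.Obs i ⊕ Γ.Act)) := {l | l <:+ S ∨ ∃ a t, l = .inr a :: t ∧ t <:+ S}
  let f : List (Γ.Obs i ⊕ Γ.Act) → ℝ := fun l => if l <:+ S then 1 else 0
  have seqD : ∀ k, ¬ Γ.IsTerminal k → Γ.seq i k ∈ D → Γ.seq i k <:+ S := by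
    rintro k ht (hk | ⟨a, t, e, -⟩)
    · exact hk
    · rw [seq_of_not_terminal ht] at e
      simp at e
  suffices hex : ∃ x, Γ.IsStrategy i x ∧ ∀ s : Γ.Seq i, s.1 ∈ D → x s = f s.1 by
    obtain ⟨x, hx, hval⟩ := hex
    refine ⟨x, hx, ?_⟩
    rw [hval _ (Or.inl List.suffix_rfl)]
    exact if_pos List.suffix_rfl
  refine exists_strategy_extending D f ?_ ?_ ?_ ?_ ?_
  · rintro l l' hl (h1 | ⟨a, t, rfl, ht⟩)
    · exact Or.inl (hl.trans h1)
    · rcases List.suffix_cons_iff.1 hl with rfl | hl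
      · exact Or.inr ⟨a, t, rfl, ht⟩
      · exact Or.inl (hl.trans ht)
  · intro l _
    simp only [f]
    split_ifs <;> norm_num
  · intro _
    exact if_pos List.nil_suffix
  · intro k ht hk
    have := seqD k ht hk
    simp only [f]
    rw [if_pos this, if_pos ((preSeq_suffix_seq k).trans this)]
  · intro k ht hm hk
    have hsuf := seqD k ht hk
    -- The target cannot stop at a decision observation, so it prescribes a next entry, which must
    -- be an action.
    have hcons : ∃ e, e :: Γ.seq i k <:+ S := by
      obtain ⟨t, ht'⟩ := hsuf
      rcases List.eq_nil_or_concat t with rfl | ⟨t', e, rfl⟩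
      · exact absurd ht'.symm (preSeq_ne_seq ht hm)
      · exact ⟨e, t', by rw [← ht']; simp⟩
    obtain ⟨e, he⟩ := hcons
    have hact : ∃ g c a, ¬ Γ.IsTerminal g ∧ Γ.seq i g = Γ.seq i k ∧ Γ.parent c = some (g, a) ∧
        Γ.mover g = some i ∧ Γ.preSeq i c <:+ S := by
      obtain ⟨d, hd, e' | ⟨hdt, e'⟩⟩ := exists_anc_of_suffix (he.trans (preSeq_suffix_seq h))
      · have hr : d ≠ Γ.root := by
          rintro rfl
          rw [preSeq_root] at e'
          simp at e'
        obtain ⟨g, a, hg⟩ := exists_parent hr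
        have hgt := not_terminal_of_child ⟨a, hg⟩
        by_cases hgm : Γ.mover g = some i
        · rw [preSeq_child_of_mover hg hgm] at e'
          simp only [List.cons.injEq] at e'
          refine ⟨g, d, a, hgt, e'.2.symm, hg, hgm, ?_⟩
          exact hd.preSeq_suffix
        · rw [preSeq_child_of_ne ⟨a, hg⟩ hgm, seq_of_not_terminal hgt] at e'
          simp only [List.cons.injEq] at e'
          exact absurd e'.2.symm (preSeq_ne_seq ht hm)
      · rw [seq_of_not_terminal hdt] at e'
        simp only [List.cons.injEq] at e'
        exact absurd e'.2.symm (preSeq_ne_seq ht hm)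
    obtain ⟨g, c, a, hgt, hgk, hc, hgm, hcS⟩ := hact
    refine ⟨g, hgt, hgk, ?_, ?_⟩
    · rintro d ⟨b, hd⟩
      refine Or.inr ⟨b, Γ.seq i g, preSeq_child_of_mover hd hgm, ?_⟩
      rw [hgk]
      exact hsuf
    · rw [Finset.sum_eq_single_of_mem c (by simpa using ⟨a, hc⟩)]
      · simp only [f]
        rw [if_pos hcS, if_pos (by rw [hgk]; exact hsuf)]
      · intro d hd hne
        obtain ⟨b, hb⟩ := (Finset.mem_filter.1 hd).2
        refine if_neg fun hdS => hne ?_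
        -- Sibling sequences have equal length, and a list has only one prefix of a given length.
        have hlen : (Γ.preSeq i d).length = (Γ.preSeq i c).length := by
          rw [preSeq_child_of_mover hb hgm, preSeq_child_of_mover hc hgm]
          rfl
        have heq := (List.suffix_of_suffix_length_le hdS hcS hlen.le).eq_of_length hlen
        rw [preSeq_child_of_mover hb hgm, preSeq_child_of_mover hc hgm] at heq
        simp only [List.cons.injEq, Sum.inr.injEq, and_true] at heq
        exact Γ.parent_inj _ _ _ _ hb (heq ▸ hc)

end GameTree

/-! ### Conditioning on a sequence, counterfactual best-response values and the errors of the
minimizing player. -/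

namespace GameTree

variable {Γ : GameTree} {i : Player}

/-- Replaces a strategy at and after the sequence `s`, on a set `D` of sequences. -/
theorem exists_strategy_replacing {Γ : Game} {i : Player} {y : Γ.Seq i → ℝ}
    (hy : Γ.IsStrategy i y) (s : Γ.Seq i) (D : Set (List (Γ.Obs i ⊕ Γ.Act)))
    (f : List (Γ.Obs i ⊕ Γ.Act) → ℝ)
    (closed : ∀ l l', s.1 <:+ l' → l' <:+ l → l ∈ D → l' ∈ D) (mem : s.1 ∈ D)
    (nonneg : ∀ l ∈ D, 0 ≤ f l) (start : f s.1 = y s)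
    (observe : ∀ h, ¬ Γ.IsTerminal h → Γ.seq i h ∈ D → s.1 <:+ Γ.preSeq i h →
      f (Γ.seq i h) = f (Γ.preSeq i h))
    (flow : ∀ h, ¬ Γ.IsTerminal h → Γ.mover h = some i → Γ.seq i h ∈ D → s.1 <:+ Γ.seq i h →
      ∃ k, ¬ Γ.IsTerminal k ∧ Γ.seq i k = Γ.seq i h ∧
        (∀ c, Γ.IsChild k c → Γ.preSeq i c ∈ D) ∧
        ∑ c with Γ.IsChild k c, f (Γ.preSeq i c) = f (Γ.seq i k)) :
    ∃ x, Γ.IsStrategy i x ∧ (∀ t, ¬ s.1 <:+ t.1 → x t = y t) ∧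
      ∀ t, s.1 <:+ t.1 → t.1 ∈ D → x t = f t.1 := by
  -- All sequences that do not come after `s`, together with the prescribed ones that do: this set
  -- is prefix-closed, and the old values are kept in its first part.
  let E : Set (List (Γ.Obs i ⊕ Γ.Act)) := {l | s.1 <:+ l → l ∈ D}
  let F : List (Γ.Obs i ⊕ Γ.Act) → ℝ := fun l => if s.1 <:+ l then f l else listValue y l
  suffices hex : ∃ x, Γ.IsStrategy i x ∧ ∀ t : Γ.Seq i, t.1 ∈ E → x t = F t.1 by
    obtain ⟨x, hx, hval⟩ := hex
    refine ⟨x, hx, ?_, ?_⟩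
    · intro t ht
      rw [hval t fun h => absurd h ht]
      simp only [F, if_neg ht, listValue_coe]
    · intro t ht hD
      rw [hval t fun _ => hD]
      simp only [F, if_pos ht]
  -- By `start`, the old and the new values agree at the junction `s`.
  have Fs : ∀ t : Γ.Seq i, (s.1 <:+ t.1 → t.1 = s.1) → F t.1 = y t := by
    intro t ht
    simp only [F]
    split_ifs with h
    · rw [ht h, start, Subtype.ext (ht h)]
    · exact listValue_coe y t
  refine exists_strategy_extending E F ?_ ?_ ?_ ?_ ?_
  · intro l l' hl hE hs
    exact closed l l' hs hl (hE (hs.trans hl))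
  · intro l hl
    simp only [F]
    split_ifs with h
    · exact nonneg l (hl h)
    · exact listValue_nonneg hy l
  · intro _
    have := Fs (Γ.pre i Γ.root) ?_
    · change F (Γ.preSeq i Γ.root) = _ at this
      rw [preSeq_root] at this
      rw [this, hy.root]
    · intro h
      change s.1 <:+ Γ.preSeq i Γ.root at h
      change Γ.preSeq i Γ.root = _
      rw [preSeq_root] at h ⊢
      exact (List.suffix_nil.1 h).symm
  · intro h ht hE
    by_cases hs : s.1 <:+ Γ.preSeq i h
    · have hs' := hs.trans (preSeq_suffix_seq h)
      simp only [F, if_pos hs, if_pos hs']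
      exact observe h ht (hE hs') hs
    · have h1 := Fs (Γ.pre i h) fun hh => absurd hh hs
      have h2 := Fs (Γ.at' i h) fun hh => by
        change s.1 <:+ Γ.seq i h at hh
        change Γ.seq i h = s.1
        rw [seq_of_not_terminal ht] at hh ⊢
        exact ((List.suffix_cons_iff.1 hh).resolve_right hs).symm
      exact h2.trans ((hy.observe h).trans h1.symm)
  · intro h ht hm hE
    by_cases hs : s.1 <:+ Γ.seq i h
    · obtain ⟨k, hkt, hk, hkD, hsum⟩ := flow h ht hm (hE hs) hs
      refine ⟨k, hkt, hk, fun c hc _ => hkD c hc, ?_⟩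
      simp only [F]
      rw [if_pos (hk ▸ hs), ← hsum]
      refine Finset.sum_congr rfl fun c hc => if_pos ?_
      rw [← hk] at hs
      exact hs.trans (seq_suffix_preSeq_child (Finset.mem_filter.1 hc).2)
    · have key : ∀ c, Γ.IsChild h c → s.1 <:+ Γ.preSeq i c → Γ.preSeq i c = s.1 := by
        rintro c ⟨a, hc⟩ hh
        rw [preSeq_child_of_mover hc hm] at hh ⊢
        exact ((List.suffix_cons_iff.1 hh).resolve_right hs).symm
      refine ⟨h, ht, rfl, ?_, ?_⟩
      · intro c hc hh
        rw [key c hc hh]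
        exact mem
      · have h2 := Fs (Γ.at' i h) fun hh => absurd hh hs
        refine Eq.trans ?_ ((hy.flow h ht hm).trans h2.symm)
        exact Finset.sum_congr rfl fun c hc => Fs (Γ.pre i c) (key c (Finset.mem_filter.1 hc).2)

/-- A strategy, conditioned on playing `s`. -/
theorem exists_strategy_conditional {Γ : Game} {i : Player} {y : Γ.Seq i → ℝ}
    (hy : Γ.IsStrategy i y) {s : Γ.Seq i} (hs : 0 < y s) :
    ∃ x, Γ.IsStrategy i x ∧ x s = 1 ∧ ∀ t, s.1 <:+ t.1 → x t = y t / y s := by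
  -- Dividing by the probability of `s` is legitimate only after `s`; before it, a strategy that
  -- heads for `s` with certainty is used.
  obtain ⟨y0, hy0, h1⟩ := exists_strategy_reaching s
  obtain ⟨x, hx, -, hval⟩ := exists_strategy_replacing hy0 s Set.univ (fun l => listValue y l / y s)
    (fun _ _ _ _ _ => Set.mem_univ _) (Set.mem_univ _)
    (fun l _ => div_nonneg (listValue_nonneg hy l) hs.le)
    (by rw [listValue_coe, h1, div_self hs.ne'])
    (by
      intro h _ _ _
      rw [listValue_seq, listValue_preSeq, hy.observe])
    (by
      intro h ht hm _ _
      refine ⟨h, ht, rfl, fun _ _ => Set.mem_univ _, ?_⟩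
      rw [← Finset.sum_div, listValue_seq, ← hy.flow h ht hm]
      simp only [listValue_preSeq])
  have hval' : ∀ t, s.1 <:+ t.1 → x t = y t / y s := by
    intro t ht
    rw [hval t ht (Set.mem_univ _), listValue_coe]
  refine ⟨x, hx, ?_, hval'⟩
  rw [hval' s List.suffix_rfl, div_self hs.ne']

/-- The part of the utility that comes from the terminal nodes at which `minus` has played `s`. -/
noncomputable def cfSum (x : Γ.Seq .plus → ℝ) (s : Γ.Seq .minus) (y : Γ.Seq .minus → ℝ) : ℝ :=
  ∑ z with Γ.IsTerminal z ∧ s.1 <:+ Γ.seq .minus z,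
    Γ.util z * Γ.reach z * x (Γ.at' .plus z) * y (Γ.at' .minus z)

/-- The counterfactual best-response value at the sequence `s`, without normalization. -/
noncomputable def cfValue (x : Γ.Seq .plus → ℝ) (s : Γ.Seq .minus) : ℝ :=
  sInf {r | ∃ y, Γ.IsStrategy .minus y ∧ y s = 1 ∧ r = cfSum x s y}

theorem brValue_eq (x : Γ.Seq .plus → ℝ) (K : Set Γ.Node) (s : Γ.Seq .minus) :
    Γ.brValue x K s = (Γ.mass x K)⁻¹ * cfValue x s := rfl

/-- All constraints are closed and confine strategies to the cube [0, 1]^Σ. Compactness is needed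
for best responses to exist. -/
theorem isCompact_strategies (s : Γ.Seq i) : IsCompact {y | Γ.IsStrategy i y ∧ y s = 1} := by
  refine (isCompact_Icc (a := (0 : Γ.Seq i → ℝ)) (b := 1)).of_isClosed_subset ?_ ?_
  · have : {y | Γ.IsStrategy i y ∧ y s = 1} = (⋂ t, {y : Γ.Seq i → ℝ | 0 ≤ y t}) ∩
        {y | y (Γ.pre i Γ.root) = 1} ∩ (⋂ h, {y | y (Γ.at' i h) = y (Γ.pre i h)}) ∩
        (⋂ h, ⋂ (_ : ¬ Γ.IsTerminal h), ⋂ (_ : Γ.mover h = some i),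
          {y | ∑ c with Γ.IsChild h c, y (Γ.pre i c) = y (Γ.at' i h)}) ∩ {y | y s = 1} := by
      ext y
      simp only [Set.mem_inter_iff, Set.mem_iInter, Set.mem_ofPred_eq]
      constructor
      · rintro ⟨⟨h1, h2, h3, h4⟩, h5⟩
        exact ⟨⟨⟨⟨h1, h2⟩, h3⟩, h4⟩, h5⟩
      · rintro ⟨⟨⟨⟨h1, h2⟩, h3⟩, h4⟩, h5⟩
        exact ⟨⟨h1, h2, h3, h4⟩, h5⟩
    rw [this]
    refine ((((isClosed_iInter fun t => ?_).inter ?_).inter (isClosed_iInter fun h => ?_)).inter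
      (isClosed_iInter fun h => isClosed_iInter fun _ => isClosed_iInter fun _ => ?_)).inter ?_
    · exact isClosed_le continuous_const (continuous_apply t)
    · exact isClosed_eq (continuous_apply _) continuous_const
    · exact isClosed_eq (continuous_apply _) (continuous_apply _)
    · exact isClosed_eq (continuous_finsetSum _ fun _ _ => continuous_apply _) (continuous_apply _)
    · exact isClosed_eq (continuous_apply _) continuous_const
  · rintro y ⟨hy, -⟩
    exact ⟨hy.nonneg, hy.le_one⟩

/-- The objective is linear in `y`, hence continuous, and the feasible set is compact and nonempty,
so that the infimum is attained. -/
theorem exists_cfValue {Γ : Game} (x : Γ.Seq .plus → ℝ) (s : Γ.Seq .minus) :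
    ∃ y, Γ.IsStrategy .minus y ∧ y s = 1 ∧ cfSum x s y = cfValue x s ∧
      ∀ y', Γ.IsStrategy .minus y' → y' s = 1 → cfValue x s ≤ cfSum x s y' := by
  have hcont : Continuous fun y => cfSum x s y := by
    unfold cfSum
    exact continuous_finsetSum _ fun _ _ => continuous_const.mul (continuous_apply _)
  obtain ⟨y, ⟨hy, h1⟩, hmin⟩ := (isCompact_strategies s).exists_isMinOn
    (exists_strategy_reaching s) hcont.continuousOn
  have hleast : IsLeast {r | ∃ y, Γ.IsStrategy .minus y ∧ y s = 1 ∧ r = cfSum x s y}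
      (cfSum x s y) := by
    refine ⟨⟨y, hy, h1, rfl⟩, ?_⟩
    rintro r ⟨y', hy', h1', rfl⟩
    exact hmin ⟨hy', h1'⟩
  have he : cfValue x s = cfSum x s y := hleast.csInf_eq
  refine ⟨y, hy, h1, he.symm, fun y' hy' h1' => ?_⟩
  rw [he]
  exact hmin ⟨hy', h1'⟩

theorem cfValue_le {Γ : Game} (x : Γ.Seq .plus → ℝ) {s : Γ.Seq .minus} {y : Γ.Seq .minus → ℝ}
    (hy : Γ.IsStrategy .minus y) (h1 : y s = 1) : cfValue x s ≤ cfSum x s y :=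
  (exists_cfValue x s).choose_spec.2.2.2 y hy h1

/-- Homogeneous form of the best-response bound: a strategy that plays `s` with positive probability
can be conditioned on `s`, and with probability 0 all the terms vanish. -/
theorem mul_cfValue_le {Γ : Game} (x : Γ.Seq .plus → ℝ) (s : Γ.Seq .minus)
    {y : Γ.Seq .minus → ℝ} (hy : Γ.IsStrategy .minus y) :
    y s * cfValue x s ≤ cfSum x s y := by
  rcases (hy.nonneg s).eq_or_lt with h0 | hpos
  · rw [← h0, zero_mul]
    refine (Finset.sum_eq_zero fun z hz => ?_).ge
    have h2 := hy.le_of_suffix (Finset.mem_filter.1 hz).2.2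
    rw [le_antisymm (h2.trans h0.ge) (hy.nonneg _), mul_zero]
  · obtain ⟨y', hy', h1, hval⟩ := exists_strategy_conditional hy hpos
    have h2 := mul_le_mul_of_nonneg_left (cfValue_le x hy' h1) hpos.le
    refine h2.trans_eq ?_
    rw [cfSum, cfSum, Finset.mul_sum]
    refine Finset.sum_congr rfl fun z hz => ?_
    rw [hval (Γ.at' .minus z) (Finset.mem_filter.1 hz).2.2]
    field_simp

/-- Used to compare sums over nodes one infoset, or one sequence, at a time. -/
theorem sum_le_sum_of_fibers {N β : Type} [Fintype N] [DecidableEq β] (P : N → Prop)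
    [DecidablePred P] (e : N → β) (A B : N → ℝ)
    (h : ∀ k, P k → ∑ n with P n ∧ e n = e k, A n ≤ ∑ n with P n ∧ e n = e k, B n) :
    ∑ n with P n, A n ≤ ∑ n with P n, B n := by
  have key : ∀ F : N → ℝ, ∑ n with P n, F n =
      ∑ b ∈ (Finset.univ.filter P).image e, ∑ n with P n ∧ e n = b, F n := by
    intro F
    rw [← Finset.sum_fiberwise_of_maps_to (t := (Finset.univ.filter P).image e) (g := e)
      fun n hn => Finset.mem_image_of_mem e hn]
    simp only [Finset.filter_filter]
  rw [key A, key B]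
  refine Finset.sum_le_sum fun b hb => ?_
  obtain ⟨k, hk, rfl⟩ := Finset.mem_image.1 hb
  exact h k (Finset.mem_filter.1 hk).2

/-- A part of the utility, split along an infoset. -/
theorem cfSum_at {k : Γ.Node} (ht : ¬ Γ.IsTerminal k) (x : Γ.Seq .plus → ℝ)
    (y : Γ.Seq .minus → ℝ) : cfSum x (Γ.at' .minus k) y =
      ∑ h with h ∈ Γ.infoset .minus k, ∑ z with Γ.IsTerminal z ∧ Γ.Anc h z,
        Γ.util z * Γ.reach z * x (Γ.at' .plus z) * y (Γ.at' .minus z) := by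
  rw [← sum_below (d := depth k) fun h hh => depth_eq' hh.1 ht hh.2]
  exact Finset.sum_congr (Finset.filter_congr fun z _ => and_congr_right fun _ =>
    seq_suffix_seq_iff ht) fun _ _ => rfl

theorem cfSum_pre {Γ : Game} {c : Γ.Node} (x : Γ.Seq .plus → ℝ)
    (y : Γ.Seq .minus → ℝ) : cfSum x (Γ.pre .minus c) y =
      ∑ h with Γ.preSeq .minus h = Γ.preSeq .minus c, ∑ z with Γ.IsTerminal z ∧ Γ.Anc h z,
        Γ.util z * Γ.reach z * x (Γ.at' .plus z) * y (Γ.at' .minus z) := by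
  rw [← sum_below (d := depth c) fun h hh => depth_eq_of_preSeq hh]
  exact Finset.sum_congr (Finset.filter_congr fun z _ => and_congr_right fun hz =>
    preSeq_suffix_seq_iff hz) fun _ _ => rfl

/-- Clears the normalizing factor even at mass 0. There the inverse is 0 by convention, and the
unnormalized value is 0 as well, because `x` reaches no node of the infoset. -/
theorem mass_mul_infosetValue {Γ : Game} {x : Γ.Seq .plus → ℝ} (hx : Γ.IsStrategy .plus x)
    {k : Γ.Node} (ht : ¬ Γ.IsTerminal k) :
    Γ.mass x (Γ.infoset .minus k) * Γ.infosetValue x k = cfValue x (Γ.at' .minus k) := by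
  rw [infosetValue, brValue_eq]
  by_cases h0 : Γ.mass x (Γ.infoset .minus k) = 0
  · rw [h0, zero_mul]
    obtain ⟨y, -, -, hy, -⟩ := exists_cfValue x (Γ.at' .minus k)
    rw [← hy, cfSum_at ht]
    refine (Finset.sum_eq_zero fun h hh => Finset.sum_eq_zero fun z hz => ?_).symm
    have h1 : x (Γ.at' .plus h) = 0 := by
      refine le_antisymm (not_lt.1 fun hp => ?_) (hx.nonneg _)
      exact (mass_pos hx (Finset.mem_filter.1 hh).2 hp).ne' h0
    have h2 : x (Γ.at' .plus z) = 0 :=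
      le_antisymm ((hx.anc_le (Finset.mem_filter.1 hz).2.2).trans h1.le) (hx.nonneg _)
    simp [h2]
  · rw [mul_inv_cancel_left₀ h0]

/-- The probability of reaching `h`. -/
noncomputable def prob (x : Γ.Seq .plus → ℝ) (y : Γ.Seq .minus → ℝ) (h : Γ.Node) : ℝ :=
  Γ.reach h * x (Γ.at' .plus h) * y (Γ.at' .minus h)

theorem prob_nonneg {Γ : Game} {x : Γ.Seq .plus → ℝ} {y : Γ.Seq .minus → ℝ}
    (hx : Γ.IsStrategy .plus x) (hy : Γ.IsStrategy .minus y) (h : Γ.Node) : 0 ≤ prob x y h :=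
  mul_nonneg (mul_nonneg (reach_pos Γ h).le (hx.nonneg _)) (hy.nonneg _)

/-- At each node only one of nature and the two players distributes probability among the children,
while the other two factors stay constant. -/
theorem sum_prob_child {Γ : Game} {x : Γ.Seq .plus → ℝ} {y : Γ.Seq .minus → ℝ}
    (hx : Γ.IsStrategy .plus x) (hy : Γ.IsStrategy .minus y) {h : Γ.Node}
    (ht : ¬ Γ.IsTerminal h) : ∑ c with Γ.IsChild h c, prob x y c = prob x y h := by
  rcases hm : Γ.mover h with _ | i
  · have : ∀ c ∈ Finset.univ.filter (fun c => Γ.IsChild h c),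
        prob x y c = prob x y h * Γ.chance c := by
      intro c hc
      have hc' := (Finset.mem_filter.1 hc).2
      rw [prob, prob, reach_child hc', if_pos hm, hx.child_eq hc' (by simp [hm]),
        hy.child_eq hc' (by simp [hm])]
      ring
    rw [Finset.sum_congr rfl this, ← Finset.mul_sum]
    have h1 := Γ.chance_sum h ht hm
    rw [chanceSum] at h1
    rw [h1, mul_one]
  · cases i
    · have : ∀ c ∈ Finset.univ.filter (fun c => Γ.IsChild h c),
          prob x y c = Γ.reach h * y (Γ.at' .minus h) * x (Γ.at' .plus c) := by
        intro c hc
        have hc' := (Finset.mem_filter.1 hc).2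
        rw [prob, reach_child hc', if_neg (by simp [hm]), hy.child_eq hc' (by simp [hm])]
        ring
      rw [Finset.sum_congr rfl this, ← Finset.mul_sum, hx.flow' ht hm, prob]
      ring
    · have : ∀ c ∈ Finset.univ.filter (fun c => Γ.IsChild h c),
          prob x y c = Γ.reach h * x (Γ.at' .plus h) * y (Γ.at' .minus c) := by
        intro c hc
        have hc' := (Finset.mem_filter.1 hc).2
        rw [prob, reach_child hc', if_neg (by simp [hm]), hx.child_eq hc' (by simp [hm])]
        ring
      rw [Finset.sum_congr rfl this, ← Finset.mul_sum, hy.flow' ht hm, prob]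

/-- If the sequence just before `c` is played with certainty, then no other action is played at
the infoset before `c`. -/
theorem IsStrategy.eq_zero_of_pre {Γ : Game} {i : Player} {y : Γ.Seq i → ℝ}
    (hy : Γ.IsStrategy i y) {g c k d : Γ.Node} (hc : Γ.IsChild g c) (h1 : y (Γ.pre i c) = 1)
    (hd : Γ.IsChild k d) (e : Γ.seq i k = Γ.seq i g) (hne : Γ.preSeq i d ≠ Γ.preSeq i c) :
    y (Γ.at' i d) = 0 := by
  have hg := not_terminal_of_child hc
  have hk := not_terminal_of_child hd
  by_cases hm : Γ.mover g = some i
  · have hmk := mover_eq_of_seq hg hk e.symm hm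
    obtain ⟨a, ha⟩ := hc
    obtain ⟨c', hc'⟩ := Γ.same_actions i g k c a hg hk hm e.symm ha
    have hpre : Γ.preSeq i c' = Γ.preSeq i c := by
      rw [preSeq_child_of_mover ha hm, preSeq_child_of_mover hc' hmk, e]
    have hsum := hy.flow' hk hmk
    have hsub : ({c', d} : Finset Γ.Node) ⊆ Finset.univ.filter (fun c => Γ.IsChild k c) := by
      intro n hn
      simp only [Finset.mem_insert, Finset.mem_singleton] at hn
      rcases hn with rfl | rfl
      · simpa using ⟨a, hc'⟩
      · simpa using hd
    have hle := Finset.sum_le_sum_of_subset_of_nonneg (f := fun c => y (Γ.at' i c)) hsub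
      fun n _ _ => hy.nonneg _
    rw [hsum, Finset.sum_pair (by rintro rfl; exact hne hpre), hy.observe c',
      pre_eq hpre, h1] at hle
    have := hy.le_one (Γ.at' i k)
    exact le_antisymm (by linarith) (hy.nonneg _)
  · refine absurd ?_ hne
    have hmk : Γ.mover k ≠ some i := fun h => hm (mover_eq_of_seq hk hg e h)
    rw [preSeq_child_of_ne hc hm, preSeq_child_of_ne hd hmk, e]

theorem IsStrategy.at_of_pre {y : Γ.Seq i → ℝ} (hy : Γ.IsStrategy i y) {g c : Γ.Node}
    (hc : Γ.IsChild g c) (h1 : y (Γ.pre i c) = 1) : y (Γ.at' i g) = 1 := by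
  refine le_antisymm (hy.le_one _) ?_
  rw [← h1, ← hy.observe]
  exact hy.child_le hc

/-- The sequence just before `c` is that at `g`, with an action added if `i` moves there. Its last
entry tells which of the two cases holds, so it determines the sequence at the parent. -/
theorem exists_infoset_parent {Γ : Game} {i : Player} {g c d : Γ.Node} (hc : Γ.IsChild g c)
    (e : Γ.preSeq i d = Γ.preSeq i c) : ∃ k, Γ.IsChild k d ∧ Γ.seq i k = Γ.seq i g := by
  have hgt := not_terminal_of_child hc
  by_cases hm : Γ.mover g = some i
  · obtain ⟨a, ha⟩ := hc
    rw [preSeq_child_of_mover ha hm] at e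
    have hr : d ≠ Γ.root := by
      rintro rfl
      rw [preSeq_root] at e
      simp at e
    obtain ⟨k, b, hk⟩ := exists_parent hr
    have hkt := not_terminal_of_child ⟨b, hk⟩
    by_cases hmk : Γ.mover k = some i
    · rw [preSeq_child_of_mover hk hmk] at e
      simp only [List.cons.injEq] at e
      exact ⟨k, ⟨b, hk⟩, e.2⟩
    · rw [preSeq_child_of_ne ⟨b, hk⟩ hmk, seq_of_not_terminal hkt] at e
      simp at e
  · rw [preSeq_child_of_ne hc hm] at e
    obtain ⟨k, hk, -, e'⟩ := parent_of_preSeq_eq_seq hgt e.symm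
    exact ⟨k, hk, e'⟩

/-- The nodes just after a sequence have the same mass as the infoset before it. -/
theorem sum_pre_eq_mass {Γ : Game} {x : Γ.Seq .plus → ℝ} (hx : Γ.IsStrategy .plus x)
    {g c : Γ.Node} (hc : Γ.IsChild g c) :
    ∑ d with Γ.preSeq .minus d = Γ.preSeq .minus c, Γ.reach d * x (Γ.at' .plus d) =
      Γ.mass x (Γ.infoset .minus g) := by
  -- Against a `y` that plays the sequence before `c` with certainty, the masses are reaching
  -- probabilities. These are conserved from the infoset to its children, and the children after
  -- other actions have probability 0.
  obtain ⟨y, hy, h1⟩ := exists_strategy_reaching (Γ.pre .minus c)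
  have hg := not_terminal_of_child hc
  have hA : Γ.mass x (Γ.infoset .minus g) =
      ∑ h with h ∈ Γ.infoset .minus g, ∑ d with Γ.IsChild h d, prob x y d := by
    refine Finset.sum_congr rfl fun h hh => ?_
    have hh' := (Finset.mem_filter.1 hh).2
    rw [sum_prob_child hx hy hh'.1, prob, at'_eq hh'.2, hy.at_of_pre hc h1, mul_one]
  rw [hA, sum_sum_child, Finset.sum_subset_zero_on_sdiff (g := prob x y)]
  · intro d hd
    simp only [Finset.mem_filter, Finset.mem_univ, true_and] at hd ⊢
    obtain ⟨k, hk, e⟩ := exists_infoset_parent hc hd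
    exact ⟨k, ⟨not_terminal_of_child hk, e⟩, hk⟩
  · intro d hd
    simp only [Finset.mem_sdiff, Finset.mem_filter, Finset.mem_univ, true_and] at hd
    obtain ⟨⟨k, hk, hkd⟩, hne⟩ := hd
    rw [prob, hy.eq_zero_of_pre hc h1 hkd hk.2 hne, mul_zero]
  · intro d hd
    have hd' := (Finset.mem_filter.1 hd).2
    rw [prob, hy.observe d, pre_eq hd', h1, mul_one]

/-- `minus` cannot gain by restricting herself to an action. -/
theorem cfValue_at_le_pre {Γ : Game} (x : Γ.Seq .plus → ℝ) {g c : Γ.Node} (hc : Γ.IsChild g c) :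
    cfValue x (Γ.at' .minus g) ≤ cfValue x (Γ.pre .minus c) := by
  obtain ⟨y, hy, h1, he, -⟩ := exists_cfValue x (Γ.pre .minus c)
  rw [← he]
  refine (cfValue_le x hy (hy.at_of_pre hc h1)).trans_eq ?_
  symm
  refine Finset.sum_subset_zero_on_sdiff ?_ ?_ fun _ _ => rfl
  · intro z hz
    simp only [Finset.mem_filter, Finset.mem_univ, true_and] at hz ⊢
    exact ⟨hz.1, (seq_suffix_preSeq_child hc).trans hz.2⟩
  -- The extra terminal nodes lie below other actions at the infoset, which `y` never plays.
  · intro z hz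
    simp only [Finset.mem_sdiff, Finset.mem_filter, Finset.mem_univ, true_and, not_and] at hz
    obtain ⟨⟨hzt, hz1⟩, hz2⟩ := hz
    obtain ⟨k, hk, hA⟩ := (seq_suffix_seq_iff (not_terminal_of_child hc)).1 hz1
    obtain ⟨d, hd, hA'⟩ := hA.eq_or_child.resolve_left (by rintro rfl; exact hk.1 hzt)
    have h0 : y (Γ.at' .minus d) = 0 := by
      refine hy.eq_zero_of_pre hc h1 hd hk.2 fun e => hz2 hzt ?_
      exact (preSeq_suffix_seq_iff hzt).2 ⟨d, e, hA'⟩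
    rw [le_antisymm ((hy.anc_le hA').trans h0.le) (hy.nonneg _), mul_zero]

theorem mass_nonneg {Γ : Game} {x : Γ.Seq .plus → ℝ} (hx : Γ.IsStrategy .plus x)
    (K : Set Γ.Node) : 0 ≤ Γ.mass x K :=
  Finset.sum_nonneg fun h _ => mul_nonneg (reach_pos Γ h).le (hx.nonneg _)

/-- The distinction by mover disappears: where `minus` does not move, the sequence just before `c`
is the one at `g`, and the difference is 0 anyway. -/
theorem mistake_child (x : Γ.Seq .plus → ℝ) {g c : Γ.Node} (hc : Γ.IsChild g c) :
    Γ.mistake x c =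
      Γ.brValue x (Γ.infoset .minus g) (Γ.pre .minus c) - Γ.infosetValue x g := by
  have hc' := hc
  obtain ⟨a, hp⟩ := hc'
  simp only [mistake, hp]
  split_ifs with hm
  · rfl
  · have : Γ.pre .minus c = Γ.at' .minus g := Subtype.ext (preSeq_child_of_ne hc hm)
    rw [this, infosetValue, sub_self]

theorem mistake_root (x : Γ.Seq .plus → ℝ) : Γ.mistake x Γ.root = 0 := by
  simp [mistake, parent_root]

theorem mistake_nonneg {Γ : Game} {x : Γ.Seq .plus → ℝ} (hx : Γ.IsStrategy .plus x)
    (h : Γ.Node) : 0 ≤ Γ.mistake x h := by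
  by_cases hr : h = Γ.root
  · rw [hr, mistake_root]
  · obtain ⟨g, hc⟩ := exists_parent hr
    rw [mistake_child x hc, infosetValue, brValue_eq, brValue_eq, sub_nonneg]
    exact mul_le_mul_of_nonneg_left (cfValue_at_le_pre x hc) (inv_nonneg.2 (mass_nonneg hx _))

theorem totalMistake_nonneg {Γ : Game} {x : Γ.Seq .plus → ℝ} (hx : Γ.IsStrategy .plus x)
    (h : Γ.Node) : 0 ≤ Γ.totalMistake x h := Finset.sum_nonneg fun c _ => mistake_nonneg hx c

theorem totalMistake_root (x : Γ.Seq .plus → ℝ) : Γ.totalMistake x Γ.root = 0 := by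
  refine Finset.sum_eq_zero fun c hc => ?_
  have h1 : Γ.Anc c Γ.root := (Finset.mem_filter.1 hc).2
  have := h1.depth_le
  rw [depth_root] at this
  rw [depth_eq_zero (Nat.le_zero.1 this), mistake_root]

theorem totalMistake_child (x : Γ.Seq .plus → ℝ) {g c : Γ.Node} (hc : Γ.IsChild g c) :
    Γ.totalMistake x c = Γ.totalMistake x g + Γ.mistake x c := by
  have : (Finset.univ.filter fun d => Γ.Anc d c) =
      insert c (Finset.univ.filter fun d => Γ.Anc d g) := by
    ext d
    simp only [Finset.mem_filter, Finset.mem_univ, true_and, Finset.mem_insert]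
    constructor
    · intro hd
      by_cases hne : d = c
      · exact Or.inl hne
      · obtain ⟨a, ha⟩ := hc
        exact Or.inr (anc_parent hd hne ha)
    · rintro (rfl | hd)
      · exact anc_refl _
      · exact hd.tail hc
  rw [totalMistake, this, Finset.sum_insert, add_comm, totalMistake]
  simp only [Finset.mem_filter, Finset.mem_univ, true_and]
  intro hA
  have h1 := hA.depth_le
  have h2 := depth_child hc
  omega

end GameTree

/-! ### Gluing best responses, and the potential that absorbs the gifts. -/

namespace GameTree

variable {Γ : GameTree} {i : Player}

/-- After the sequence just before `c`, strategies at the next infosets can be combined. -/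
theorem exists_strategy_gluing {Γ : Game} {i : Player} (Y : Γ.Seq i → Γ.Seq i → ℝ)
    (hY : ∀ t, Γ.IsStrategy i (Y t)) (hY1 : ∀ t, Y t t = 1) (c : Γ.Node) :
    ∃ y, Γ.IsStrategy i y ∧ y (Γ.pre i c) = 1 ∧ ∀ d z, Γ.preSeq i d = Γ.preSeq i c →
      ¬ Γ.IsTerminal d → Γ.Anc d z → y (Γ.at' i z) = Y (Γ.at' i d) (Γ.at' i z) := by
  -- `P l k` says that `l` passes through the infoset of `k`, which is one of those immediately
  -- after the sequence before `c`. From there on, the strategy belonging to that infoset is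
  -- followed.
  let P : List (Γ.Obs i ⊕ Γ.Act) → Γ.Node → Prop := fun l k =>
    ¬ Γ.IsTerminal k ∧ Γ.preSeq i k = Γ.preSeq i c ∧ Γ.seq i k <:+ l
  let f : List (Γ.Obs i ⊕ Γ.Act) → ℝ := fun l =>
    if h : ∃ k, P l k then listValue (Y (Γ.at' i h.choose)) l else 1
  -- Infosets that satisfy `P` for one list have equal depth and sequences on the same branch, so
  -- they coincide and the choice is immaterial.
  have f_of : ∀ l k, P l k → f l = listValue (Y (Γ.at' i k)) l := by
    intro l k hk
    have hex : ∃ k, P l k := ⟨k, hk⟩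
    obtain ⟨h1, h2, h3⟩ := hex.choose_spec
    have e : Γ.at' i hex.choose = Γ.at' i k :=
      at'_eq (seq_eq_of_suffix h1 hk.1 (depth_eq_of_preSeq (h2.trans hk.2.1.symm)) h3 hk.2.2)
    simp only [f, dif_pos hex, e]
  have f_start : f (Γ.preSeq i c) = 1 := by
    refine dif_neg ?_
    rintro ⟨k, hk1, hk2, hk3⟩
    rw [← hk2] at hk3
    exact (depth_lt_of_seq_suffix_preSeq hk1 hk3).ne rfl
  have ex : ∀ h, Γ.preSeq i c <:+ Γ.seq i h → Γ.preSeq i c ≠ Γ.seq i h → ¬ Γ.IsTerminal h →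
      ∃ d, ¬ Γ.IsTerminal d ∧ Γ.preSeq i d = Γ.preSeq i c ∧ Γ.Anc d h := by
    intro h h1 h2 ht
    obtain ⟨d, hd, hA⟩ := exists_anc_preSeq_eq h1 (Or.inr h2)
    refine ⟨d, ?_, hd, hA⟩
    by_cases hne : d = h
    · exact hne ▸ ht
    · exact hA.not_terminal hne
  obtain ⟨y0, hy0, h01⟩ := exists_strategy_reaching (Γ.pre i c)
  suffices hex : ∃ y, Γ.IsStrategy i y ∧ (∀ t, ¬ (Γ.pre i c).1 <:+ t.1 → y t = y0 t) ∧
      ∀ t, (Γ.pre i c).1 <:+ t.1 → t.1 ∈ Set.univ → y t = f t.1 by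
    obtain ⟨y, hy, -, hval⟩ := hex
    refine ⟨y, hy, ?_, ?_⟩
    · rw [hval _ List.suffix_rfl (Set.mem_univ _)]
      exact f_start
    · intro d z hd hdt hA
      have hs : Γ.preSeq i c <:+ Γ.seq i z := by
        rw [← hd]
        exact hA.preSeq_suffix.trans (preSeq_suffix_seq z)
      rw [hval (Γ.at' i z) hs (Set.mem_univ _)]
      change f (Γ.seq i z) = _
      rw [f_of _ d ⟨hdt, hd, hA.seq_suffix⟩, listValue_seq]
  refine exists_strategy_replacing hy0 (Γ.pre i c) Set.univ f (fun _ _ _ _ _ => Set.mem_univ _)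
    (Set.mem_univ _) ?_ (f_start.trans h01.symm) ?_ ?_
  · intro l _
    simp only [f]
    split_ifs
    · exact listValue_nonneg (hY _) _
    · exact zero_le_one
  · intro h ht _ hs
    change Γ.preSeq i c <:+ Γ.preSeq i h at hs
    -- On entry to one of these infosets, the value is 1 on both sides, as each strategy plays its
    -- own infoset with certainty. Further down, both values come from the same strategy.
    by_cases he : Γ.preSeq i c = Γ.preSeq i h
    · rw [← he, f_start, f_of _ h ⟨ht, he.symm, List.suffix_rfl⟩, listValue_seq, hY1]
    · obtain ⟨d, hd, hdc, hA⟩ := ex h (hs.trans (preSeq_suffix_seq h)) (by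
        intro e
        rw [e, seq_of_not_terminal ht] at hs
        exact absurd hs.length_le (by simp)) ht
      have hne : d ≠ h := by
        rintro rfl
        exact he hdc.symm
      rw [f_of _ d ⟨hd, hdc, hA.seq_suffix_preSeq hne⟩, f_of _ d ⟨hd, hdc, hA.seq_suffix⟩,
        listValue_seq, listValue_preSeq, (hY _).observe]
  · intro h ht hm _ hs
    obtain ⟨d, hd, hdc, hA⟩ := ex h hs (preSeq_ne_seq ht hm) ht
    refine ⟨h, ht, rfl, fun _ _ => Set.mem_univ _, ?_⟩
    rw [f_of _ d ⟨hd, hdc, hA.seq_suffix⟩, listValue_seq, ← (hY _).flow h ht hm]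
    refine Finset.sum_congr rfl fun e he => ?_
    have hc := (Finset.mem_filter.1 he).2
    rw [f_of _ d ⟨hd, hdc, hA.seq_suffix.trans (seq_suffix_preSeq_child hc)⟩, listValue_preSeq]

/-- The value of `minus` at a node: the utility or the value at her infoset. -/
noncomputable def nodeValue (x : Γ.Seq .plus → ℝ) (h : Γ.Node) : ℝ :=
  if Γ.IsTerminal h then Γ.util h else Γ.infosetValue x h

theorem infosetValue_congr (x : Γ.Seq .plus → ℝ) {h k : Γ.Node}
    (e : Γ.seq .minus h = Γ.seq .minus k) : Γ.infosetValue x h = Γ.infosetValue x k := by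
  have : Γ.infoset .minus h = Γ.infoset .minus k := by
    ext n
    simp [infoset, e]
  rw [infosetValue, infosetValue, this, at'_eq e]

/-- The value just after a sequence is at most the sum of the values that come next. -/
theorem cfValue_pre_le {Γ : Game} {x : Γ.Seq .plus → ℝ} (hx : Γ.IsStrategy .plus x) (c : Γ.Node) :
    cfValue x (Γ.pre .minus c) ≤ ∑ d with Γ.preSeq .minus d = Γ.preSeq .minus c,
      Γ.reach d * x (Γ.at' .plus d) * nodeValue x d := by
  choose Y hY hY1 hYv hYm using fun t => exists_cfValue x t
  -- The glued strategy is a best response at every following infoset simultaneously.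
  obtain ⟨y, hy, h1, hval⟩ := exists_strategy_gluing Y hY hY1 c
  refine (cfValue_le x hy h1).trans ?_
  rw [cfSum_pre]
  let P : Γ.Node → Prop := fun d => Γ.preSeq .minus d = Γ.preSeq .minus c
  -- All terminal nodes share one fiber and are compared termwise; the other fibers are infosets.
  let e : Γ.Node → Option (Γ.Seq .minus) := fun d =>
    if Γ.IsTerminal d then none else some (Γ.at' .minus d)
  refine sum_le_sum_of_fibers P e _ _ fun k hk => ?_
  by_cases ht : Γ.IsTerminal k
  · refine Finset.sum_le_sum fun d hd => ?_
    obtain ⟨hd1, hd2⟩ := (Finset.mem_filter.1 hd).2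
    have hdt : Γ.IsTerminal d := by
      by_contra hdt
      simp [e, ht, hdt] at hd2
    rw [sum_terminal_of_terminal hdt, nodeValue, if_pos hdt, hy.observe, pre_eq hd1, h1]
    exact le_of_eq (by ring)
  · have hiff : ∀ d, P d ∧ e d = e k ↔ d ∈ Γ.infoset .minus k := by
      intro d
      simp only [e, if_neg ht]
      constructor
      · rintro ⟨-, hd⟩
        split_ifs at hd with hdt
        exact ⟨hdt, congrArg Subtype.val (Option.some.inj hd)⟩
      · rintro ⟨hdt, hd⟩
        rw [if_neg hdt, at'_eq hd]
        exact ⟨(seq_inj hdt ht hd).2.trans hk, rfl⟩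
    rw [Finset.sum_congr (Finset.filter_congr fun d _ => hiff d) fun _ _ => rfl,
      Finset.sum_congr (Finset.filter_congr fun d _ => hiff d) fun _ _ => rfl]
    refine (le_of_eq ?_ : _ ≤ cfValue x (Γ.at' .minus k)).trans (le_of_eq ?_)
    · rw [← hYv, cfSum_at ht]
      refine Finset.sum_congr rfl fun d hd => Finset.sum_congr rfl fun z hz => ?_
      have hd' := (Finset.mem_filter.1 hd).2
      rw [hval d z ((hiff d).2 hd').1 hd'.1 (Finset.mem_filter.1 hz).2.2, at'_eq hd'.2]
    · rw [← mass_mul_infosetValue hx ht, mass, Finset.sum_mul]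
      refine Finset.sum_congr rfl fun d hd => ?_
      have hd' := (Finset.mem_filter.1 hd).2
      rw [nodeValue, if_neg hd'.1, infosetValue_congr x hd'.2]

/-- If the infoset has mass 0, so do the nodes just after the action, and both sides vanish;
otherwise the normalization cancels. -/
theorem mass_mul_brValue {Γ : Game} {x : Γ.Seq .plus → ℝ} (hx : Γ.IsStrategy .plus x)
    {g c : Γ.Node} (hc : Γ.IsChild g c) :
    Γ.mass x (Γ.infoset .minus g) * Γ.brValue x (Γ.infoset .minus g) (Γ.pre .minus c) ≤
      ∑ d with Γ.preSeq .minus d = Γ.preSeq .minus c,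
        Γ.reach d * x (Γ.at' .plus d) * nodeValue x d := by
  by_cases h0 : Γ.mass x (Γ.infoset .minus g) = 0
  · rw [h0, zero_mul]
    refine (Finset.sum_eq_zero fun d hd => ?_).ge
    rw [← sum_pre_eq_mass hx hc] at h0
    rw [(Finset.sum_eq_zero_iff_of_nonneg fun d _ =>
      mul_nonneg (reach_pos Γ d).le (hx.nonneg _)).1 h0 d hd, zero_mul]
  · rw [brValue_eq, mul_inv_cancel_left₀ h0]
    exact cfValue_pre_le hx c

/-- The value at a node, minus the errors that `minus` has made (at internal nodes). -/
noncomputable def potential (x : Γ.Seq .plus → ℝ) (h : Γ.Node) : ℝ :=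
  if Γ.IsTerminal h then Γ.util h else Γ.infosetValue x h - Γ.totalMistake x h

/-- The error made at `g` is exactly the difference between the values before and after the action,
so equality holds at internal `c`. At a terminal node no errors are subtracted any more, and the
nonnegative total is the slack. -/
theorem nodeValue_le_potential {Γ : Game} {x : Γ.Seq .plus → ℝ} (hx : Γ.IsStrategy .plus x)
    {g c : Γ.Node} (hc : Γ.IsChild g c) :
    nodeValue x c - Γ.brValue x (Γ.infoset .minus g) (Γ.pre .minus c) ≤
      potential x c - potential x g := by
  have h1 := mistake_child x hc
  have h2 := totalMistake_child x hc
  have h3 := totalMistake_nonneg hx c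
  rw [nodeValue, potential, potential, if_neg (not_terminal_of_child hc)]
  split_ifs
  · linarith
  · linarith

/-- The potential is a submartingale under `x` and an arbitrary `y`. Children are grouped by the
sequence of `minus` just before them: in a group, `y` is constant and the parents share an infoset,
so `nodeValue_le_potential` and `mass_mul_brValue` bound the total gain from below by 0. -/
theorem sum_potential_le {Γ : Game} {x : Γ.Seq .plus → ℝ} {y : Γ.Seq .minus → ℝ}
    (hx : Γ.IsStrategy .plus x) (hy : Γ.IsStrategy .minus y) (d : ℕ) :
    ∑ h with ¬ Γ.IsTerminal h ∧ depth h = d, prob x y h * potential x h ≤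
      ∑ c with depth c = d + 1, prob x y c * potential x c := by
  let par : Γ.Node → Γ.Node := fun c => if h : ∃ g, Γ.IsChild g c then h.choose else c
  have hpar : ∀ g c, Γ.IsChild g c → par c = g := by
    intro g c hc
    have hex : ∃ g, Γ.IsChild g c := ⟨g, hc⟩
    simp only [par, dif_pos hex]
    exact isChild_unique hex.choose_spec hc
  have hex : ∀ c, depth c = d + 1 → ∃ g, Γ.IsChild g c := by
    intro c hc
    refine exists_parent ?_
    rintro rfl
    rw [depth_root] at hc
    omega
  have e1 : ∑ h with ¬ Γ.IsTerminal h ∧ depth h = d, prob x y h * potential x h =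
      ∑ c with depth c = d + 1, prob x y c * potential x (par c) := by
    have : ∀ h ∈ Finset.univ.filter (fun h => ¬ Γ.IsTerminal h ∧ depth h = d),
        prob x y h * potential x h =
          ∑ c with Γ.IsChild h c, prob x y c * potential x (par c) := by
      intro h hh
      have hh' := (Finset.mem_filter.1 hh).2
      rw [← sum_prob_child hx hy hh'.1, Finset.sum_mul]
      refine Finset.sum_congr rfl fun c hc => ?_
      rw [hpar h c (Finset.mem_filter.1 hc).2]
    rw [Finset.sum_congr rfl this, sum_sum_child]
    refine Finset.sum_congr (Finset.filter_congr fun c _ => ?_) fun _ _ => rfl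
    constructor
    · rintro ⟨h, ⟨-, hd⟩, hc⟩
      rw [depth_child hc, hd]
    · intro hc
      obtain ⟨g, hg⟩ := hex c hc
      refine ⟨g, ⟨not_terminal_of_child hg, ?_⟩, hg⟩
      rw [depth_child hg] at hc
      omega
  rw [e1]
  refine sum_le_sum_of_fibers (fun c => depth c = d + 1) (Γ.pre .minus) _ _ fun c hc => ?_
  obtain ⟨g, hg⟩ := hex c hc
  have hiff : ∀ k, depth k = d + 1 ∧ Γ.pre .minus k = Γ.pre .minus c ↔
      Γ.preSeq .minus k = Γ.preSeq .minus c := by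
    intro k
    constructor
    · rintro ⟨-, e⟩
      exact congrArg Subtype.val e
    · intro e
      exact ⟨(depth_eq_of_preSeq e).trans hc, Subtype.ext e⟩
  rw [Finset.sum_congr (Finset.filter_congr fun k _ => hiff k) fun _ _ => rfl,
    Finset.sum_congr (Finset.filter_congr fun k _ => hiff k) fun _ _ => rfl,
    ← sub_nonneg, ← Finset.sum_sub_distrib]
  have hterm : ∀ k ∈ Finset.univ.filter
      (fun k => Γ.preSeq .minus k = Γ.preSeq .minus c),
      y (Γ.pre .minus c) * (Γ.reach k * x (Γ.at' .plus k) * nodeValue x k -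
        Γ.reach k * x (Γ.at' .plus k) *
          Γ.brValue x (Γ.infoset .minus g) (Γ.pre .minus c)) ≤
      prob x y k * potential x k - prob x y k * potential x (par k) := by
    intro k hk
    have hk' := (Finset.mem_filter.1 hk).2
    obtain ⟨m, hm, e⟩ := exists_infoset_parent hg hk'
    have h1 := nodeValue_le_potential hx hm
    have hI : Γ.infoset .minus m = Γ.infoset .minus g := by
      ext n
      simp [infoset, e]
    rw [hI, pre_eq hk'] at h1
    have h2 := mul_le_mul_of_nonneg_left h1 (prob_nonneg hx hy k)
    rw [hpar m k hm]
    have h3 : y (Γ.at' .minus k) = y (Γ.pre .minus c) := by rw [hy.observe, pre_eq hk']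
    rw [prob, h3] at h2 ⊢
    linarith
  refine le_trans ?_ (Finset.sum_le_sum hterm)
  rw [← Finset.mul_sum, Finset.sum_sub_distrib, ← Finset.sum_mul, sum_pre_eq_mass hx hg]
  exact mul_nonneg (hy.nonneg _) (sub_nonneg.2 (mass_mul_brValue hx hg))

/-- If `x` guarantees the value `v`, then so does following `x` up to depth `D`, with the
potentials as payoffs at depth `D`. -/
theorem le_sum_potential {Γ : Game} {x : Γ.Seq .plus → ℝ} {v : ℝ} (hx : Γ.IsStrategy .plus x)
    (hv : ∀ y, Γ.IsStrategy .minus y → v ≤ Γ.payoff x y) (hr : ¬ Γ.IsTerminal Γ.root)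
    {y : Γ.Seq .minus → ℝ} (hy : Γ.IsStrategy .minus y) (D : ℕ) :
    v ≤ ∑ z with Γ.IsTerminal z ∧ depth z ≤ D, prob x y z * Γ.util z +
      ∑ h with ¬ Γ.IsTerminal h ∧ depth h = D, prob x y h * potential x h := by
  have hd0 : ∀ h : Γ.Node, depth h = 0 ↔ h = Γ.root :=
    fun h => ⟨depth_eq_zero, fun e => e ▸ depth_root⟩
  induction D with
  | zero =>
    have e1 : ∑ z with Γ.IsTerminal z ∧ depth z ≤ 0, prob x y z * Γ.util z = 0 := by
      refine Finset.sum_eq_zero fun z hz => ?_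
      obtain ⟨h1, h2⟩ := (Finset.mem_filter.1 hz).2
      rw [depth_eq_zero (Nat.le_zero.1 h2)] at h1
      exact absurd h1 hr
    -- The infoset of the root is the root alone, with mass 1 and no errors behind it. Its potential
    -- is thus the best-response value against `x` in the whole game.
    have e2 : ∑ h with ¬ Γ.IsTerminal h ∧ depth h = 0, prob x y h * potential x h =
        cfValue x (Γ.at' .minus Γ.root) := by
      rw [Finset.sum_eq_single_of_mem Γ.root (by simpa using ⟨hr, depth_root⟩)]
      · have hm : Γ.mass x (Γ.infoset .minus Γ.root) = 1 := by
          rw [mass, Finset.sum_eq_single_of_mem Γ.root (by simpa using ⟨hr, rfl⟩)]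
          · rw [reach_root, hx.at_root, one_mul]
          · intro b hb hne
            have hb' := (Finset.mem_filter.1 hb).2
            have := depth_eq' hb'.1 hr hb'.2
            rw [depth_root] at this
            exact absurd (depth_eq_zero this) hne
        rw [prob, potential, if_neg hr, reach_root, hx.at_root, hy.at_root, totalMistake_root,
          ← mass_mul_infosetValue hx hr, hm]
        ring
      · intro b hb hne
        exact absurd (depth_eq_zero (Finset.mem_filter.1 hb).2.2) hne
    rw [e1, e2, zero_add]
    obtain ⟨y', hy', -, he, -⟩ := exists_cfValue x (Γ.at' .minus Γ.root)
    refine (hv y' hy').trans_eq ?_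
    rw [← he, cfSum, payoff]
    refine Finset.sum_congr (Finset.filter_congr fun z _ => ?_) fun _ _ => rfl
    exact (and_iff_left (anc_root z).seq_suffix).symm
  | succ d ih =>
    refine ih.trans ?_
    -- Terminal nodes at the new depth leave the potential sum and join the collected utilities,
    -- where their potential is the utility.
    have e3 : ∑ z with Γ.IsTerminal z ∧ depth z ≤ d + 1, prob x y z * Γ.util z =
        ∑ z with Γ.IsTerminal z ∧ depth z ≤ d, prob x y z * Γ.util z +
          ∑ z with Γ.IsTerminal z ∧ depth z = d + 1, prob x y z * potential x z := by
      have : (Finset.univ.filter fun z : Γ.Node => Γ.IsTerminal z ∧ depth z ≤ d + 1) =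
          (Finset.univ.filter fun z : Γ.Node => Γ.IsTerminal z ∧ depth z ≤ d) ∪
          (Finset.univ.filter fun z : Γ.Node => Γ.IsTerminal z ∧ depth z = d + 1) := by
        ext z
        simp only [Finset.mem_filter, Finset.mem_univ, true_and, Finset.mem_union]
        rw [← and_or_left, Nat.le_succ_iff]
      rw [this, Finset.sum_union]
      · congr 1
        refine Finset.sum_congr rfl fun z hz => ?_
        rw [potential, if_pos (Finset.mem_filter.1 hz).2.1]
      · refine Finset.disjoint_left.2 fun z h1 h2 => ?_
        have h1' := (Finset.mem_filter.1 h1).2.2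
        have h2' := (Finset.mem_filter.1 h2).2.2
        omega
    have e4 : ∑ c with depth c = d + 1, prob x y c * potential x c =
        ∑ z with Γ.IsTerminal z ∧ depth z = d + 1, prob x y z * potential x z +
        ∑ h with ¬ Γ.IsTerminal h ∧ depth h = d + 1, prob x y h * potential x h := by
      rw [← Finset.sum_filter_add_sum_filter_not _ Γ.IsTerminal, Finset.filter_filter,
        Finset.filter_filter]
      simp only [and_comm]
    have := sum_potential_le hx hy d
    rw [e4] at this
    rw [e3]
    linarith

end GameTree

/-! ### Nodes and sequences of the gadget game. -/

namespace GameTree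

section gadgetStructure

variable {Γ : GameTree} {x : Γ.Seq .plus → ℝ} {I : Set Γ.Node} {i : Player}

theorem CanSolve.depth_top' (hI : Γ.CanSolve x I) {h h' : Γ.Node} (hh : h ∈ Γ.top I)
    (hh' : h' ∈ Γ.top I) : depth h = depth h' := hI.depth_top hh hh'

theorem CanSolve.eq_of_top (hI : Γ.CanSolve x I) {k k' h : Γ.Node} (hk : k ∈ Γ.top I)
    (hk' : k' ∈ Γ.top I) (hA : Γ.Anc k h) (hA' : Γ.Anc k' h) : k = k' :=
  hA.eq_of_depth hA' (hI.depth_top' hk hk')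

theorem CanSolve.mem_of_anc (hI : Γ.CanSolve x I) {k h : Γ.Node} (hk : k ∈ Γ.top I)
    (hA : Γ.Anc k h) (hb : h ∈ Γ.below I) : k ∈ I := by
  obtain ⟨g, hg, hA'⟩ := hb
  exact (hI.eq_of_top hk (hI.mem_top hg) hA hA') ▸ hg

theorem CanSolve.infoset_eq (hI : Γ.CanSolve x I) {k : Γ.Node} (hk : k ∈ I) :
    Γ.infoset .plus k = I := by
  obtain ⟨⟨g, -, -, rfl⟩, -⟩ := hI
  ext n
  simp [infoset, hk.2]

theorem kept_of_anc (hx : Γ.IsStrategy .plus x) (hI : Γ.CanSolve x I) {k g h : Γ.Node}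
    (hh : h ∈ Γ.kept x I) (hk : k ∈ Γ.top I) (hkg : Γ.Anc k g) (hgh : Γ.Anc g h) :
    g ∈ Γ.kept x I := by
  refine ⟨⟨k, hk, hkg⟩, ?_⟩
  rcases hh.2 with hb | hpos
  · exact Or.inl ⟨k, hI.mem_of_anc hk (hkg.trans' hgh) hb, hkg⟩
  · exact Or.inr (hpos.trans_le (hx.anc_le hgh))

theorem below_kept {h : Γ.Node} (hI : Γ.CanSolve x I) (hb : h ∈ Γ.below I) : h ∈ Γ.kept x I := by
  refine ⟨?_, Or.inl hb⟩
  obtain ⟨g, hg, hA⟩ := hb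
  exact ⟨g, hI.mem_top hg, hA⟩

theorem below_iff_child (hI : Γ.CanSolve x I) {g c : Γ.Node} (hg : g ∈ Γ.kept x I)
    (hc : Γ.IsChild g c) : c ∈ Γ.below I ↔ g ∈ Γ.below I := by
  refine ⟨?_, fun h => below_child h hc⟩
  rintro ⟨k, hk, hA⟩
  refine ⟨k, hk, ?_⟩
  obtain ⟨a, ha⟩ := hc
  refine anc_parent hA ?_ ha
  rintro rfl
  exact hI.child_not_top hg.1 ⟨a, ha⟩ (hI.mem_top hk)

/-- Induction downwards from the start nodes, the form in which all facts about copied nodes are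
proved. -/
theorem kept_induction (hx : Γ.IsStrategy .plus x) (hI : Γ.CanSolve x I)
    {P : Γ.kept x I → Prop} (top : ∀ h : Γ.kept x I, h.1 ∈ Γ.top I → P h)
    (child : ∀ g c : Γ.kept x I, Γ.IsChild g.1 c.1 → P g → P c) (h : Γ.kept x I) : P h := by
  induction hd : depth h.1 using Nat.strong_induction_on generalizing h with
  | _ n ih =>
    by_cases ht : h.1 ∈ Γ.top I
    · exact top h ht
    · obtain ⟨⟨g, a⟩, hg⟩ := kept_parent hx hI h.2 ht
      have hc : Γ.IsChild g.1 h.1 := ⟨a, hg⟩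
      refine child g h hc (ih (depth g.1) ?_ g rfl)
      have := depth_child hc
      omega

variable {hx : Γ.IsStrategy .plus x} {hI : Γ.CanSolve x I} {v : GadgetKind}
  {u : GadgetNode (Γ.oppInfosets I) (Γ.kept x I) v → ℝ}

/-- The gadget node `deal K`, from which nature deals a node of `K`. -/
def gadgetDeal (hx : Γ.IsStrategy .plus x) (hI : Γ.CanSolve x I) (v : GadgetKind)
    (u : GadgetNode (Γ.oppInfosets I) (Γ.kept x I) v → ℝ) (K : Γ.oppInfosets I) :
    (gadgetTree hx hI v u).Node := GadgetNode.deal v K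

/-- The `minus`-infoset of a start node, as an index of the gadget game. -/
def oppInfoset (hI : Γ.CanSolve x I) {k : Γ.Node} (hk : k ∈ Γ.top I) : Γ.oppInfosets I :=
  ⟨Γ.infoset .minus k, infoset_mem_oppInfosets hk hI⟩

/-- The gadget node `choice K`, at which `minus` exits or plays on. -/
def gadgetChoice (hx : Γ.IsStrategy .plus x) (hI : Γ.CanSolve x I)
    (u : GadgetNode (Γ.oppInfosets I) (Γ.kept x I) .resolving → ℝ) (K : Γ.oppInfosets I) :
    (gadgetTree hx hI .resolving u).Node := GadgetNode.choice K

/-- The gadget node `exit K`. -/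
def gadgetExit (hx : Γ.IsStrategy .plus x) (hI : Γ.CanSolve x I)
    (u : GadgetNode (Γ.oppInfosets I) (Γ.kept x I) .resolving → ℝ) (K : Γ.oppInfosets I) :
    (gadgetTree hx hI .resolving u).Node := GadgetNode.exit K

theorem gadget_deal_child {K : Γ.oppInfosets I} {h : Γ.kept x I} (hh : h.1 ∈ K.1) :
    (gadgetTree hx hI v u).IsChild (gadgetDeal hx hI v u K) (gadgetCopy hx hI v u h) :=
  gadget_child_deal.2 ⟨h, rfl, hh⟩

theorem gadget_deal_mover (K : Γ.oppInfosets I) :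
    (gadgetTree hx hI v u).mover (gadgetDeal hx hI v u K) = none := by
  cases v <;> rfl

theorem gadget_deal_obs (i : Player) (K : Γ.oppInfosets I) :
    (gadgetTree hx hI v u).obs i (gadgetDeal hx hI v u K) = GadgetObs.wait := by
  cases v <;> cases i <;> rfl

theorem gadget_deal_not_terminal (K : Γ.oppInfosets I) :
    ¬ (gadgetTree hx hI v u).IsTerminal (gadgetDeal hx hI v u K) := by
  obtain ⟨-, k, hk, hkI⟩ := K.2
  exact not_terminal_of_child
    (gadget_deal_child (h := ⟨k, below_kept hI ⟨k, hkI, anc_refl k⟩⟩) hk)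

theorem gadget_preSeq_top {K : Γ.oppInfosets I} {h : Γ.kept x I} (hh : h.1 ∈ K.1) :
    (gadgetTree hx hI v u).preSeq i (gadgetCopy hx hI v u h) =
      (gadgetTree hx hI v u).seq i (gadgetDeal hx hI v u K) :=
  preSeq_child_of_ne (gadget_deal_child hh) (by rw [gadget_deal_mover]; simp)

theorem gadget_parent_deal_maxmargin {u : GadgetNode (Γ.oppInfosets I) (Γ.kept x I) .maxmargin → ℝ}
    (K : Γ.oppInfosets I) : (gadgetTree hx hI .maxmargin u).parent
      (gadgetDeal hx hI .maxmargin u K) = some ((gadgetTree hx hI .maxmargin u).root, .pick K.1) := rfl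

theorem gadget_parent_choice {u : GadgetNode (Γ.oppInfosets I) (Γ.kept x I) .resolving → ℝ}
    (K : Γ.oppInfosets I) : (gadgetTree hx hI .resolving u).parent
      (gadgetChoice hx hI u K) = some ((gadgetTree hx hI .resolving u).root, .pick K.1) := rfl

theorem gadget_parent_exit' {u : GadgetNode (Γ.oppInfosets I) (Γ.kept x I) .resolving → ℝ}
    (K : Γ.oppInfosets I) : (gadgetTree hx hI .resolving u).parent
      (gadgetExit hx hI u K) = some (gadgetChoice hx hI u K, .exit) := rfl

theorem gadget_parent_deal_resolving {u : GadgetNode (Γ.oppInfosets I) (Γ.kept x I) .resolving → ℝ}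
    (K : Γ.oppInfosets I) : (gadgetTree hx hI .resolving u).parent
      (gadgetDeal hx hI .resolving u K) = some (gadgetChoice hx hI u K, .play) := rfl

theorem gadget_preSeq_deal_minus_maxmargin
    {u : GadgetNode (Γ.oppInfosets I) (Γ.kept x I) .maxmargin → ℝ} (K : Γ.oppInfosets I) :
    (gadgetTree hx hI .maxmargin u).preSeq .minus (gadgetDeal hx hI .maxmargin u K) =
      [.inr (.pick K.1), .inl .start] := by
  have hp := gadget_parent_deal_maxmargin (hx := hx) (hI := hI) (u := u) K
  rw [preSeq_child_of_mover hp rfl, seq_of_not_terminal (not_terminal_of_child ⟨_, hp⟩)]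
  rw [preSeq_root]
  rfl

theorem gadget_choice_mover {u : GadgetNode (Γ.oppInfosets I) (Γ.kept x I) .resolving → ℝ}
    (K : Γ.oppInfosets I) :
    (gadgetTree hx hI .resolving u).mover (gadgetChoice hx hI u K) = some .minus := rfl

theorem gadget_preSeq_choice {u : GadgetNode (Γ.oppInfosets I) (Γ.kept x I) .resolving → ℝ}
    (i : Player) (K : Γ.oppInfosets I) :
    (gadgetTree hx hI .resolving u).preSeq i (gadgetChoice hx hI u K) = [.inl .wait] := by
  have hp := gadget_parent_choice (hx := hx) (hI := hI) (u := u) K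
  rw [preSeq_child_of_ne ⟨_, hp⟩ (by simp [gadgetTree, gadgetMover]),
    seq_of_not_terminal (not_terminal_of_child ⟨_, hp⟩)]
  rw [preSeq_root]
  cases i <;> rfl

theorem gadget_seq_choice {u : GadgetNode (Γ.oppInfosets I) (Γ.kept x I) .resolving → ℝ}
    (i : Player) (K : Γ.oppInfosets I) :
    (gadgetTree hx hI .resolving u).seq i (gadgetChoice hx hI u K) =
      [.inl ((gadgetTree hx hI .resolving u).obs i (gadgetChoice hx hI u K)), .inl .wait] := by
  rw [seq_of_not_terminal, gadget_preSeq_choice]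
  exact not_terminal_of_child ⟨_, gadget_parent_deal_resolving (hx := hx) (hI := hI) (u := u) K⟩

theorem gadget_preSeq_deal_minus_resolving
    {u : GadgetNode (Γ.oppInfosets I) (Γ.kept x I) .resolving → ℝ} (K : Γ.oppInfosets I) :
    (gadgetTree hx hI .resolving u).preSeq .minus (gadgetDeal hx hI .resolving u K) =
      [.inr .play, .inl (.choose K.1), .inl .wait] := by
  rw [preSeq_child_of_mover (gadget_parent_deal_resolving (hx := hx) (hI := hI) (u := u) K) rfl,
    gadget_seq_choice]
  rfl

theorem gadget_preSeq_exit_minus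
    {u : GadgetNode (Γ.oppInfosets I) (Γ.kept x I) .resolving → ℝ} (K : Γ.oppInfosets I) :
    (gadgetTree hx hI .resolving u).preSeq .minus (gadgetExit hx hI u K) =
      [.inr .exit, .inl (.choose K.1), .inl .wait] := by
  rw [preSeq_child_of_mover (gadget_parent_exit' (hx := hx) (hI := hI) (u := u) K) rfl,
    gadget_seq_choice]
  rfl

/-- Up to the deal, `plus` sees only empty observations, so she does not learn which infoset the
game starts at. -/
theorem gadget_seq_deal_plus (K K' : Γ.oppInfosets I) :
    (gadgetTree hx hI v u).seq .plus (gadgetDeal hx hI v u K) =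
      (gadgetTree hx hI v u).seq .plus (gadgetDeal hx hI v u K') := by
  rw [seq_of_not_terminal (gadget_deal_not_terminal K),
    seq_of_not_terminal (gadget_deal_not_terminal K'), gadget_deal_obs, gadget_deal_obs]
  congr 1
  cases v
  · rw [preSeq_child_of_ne ⟨_, gadget_parent_deal_maxmargin (hx := hx) (hI := hI) (u := u) K⟩
      (by simp [gadgetTree, gadgetMover]),
      preSeq_child_of_ne ⟨_, gadget_parent_deal_maxmargin (hx := hx) (hI := hI) (u := u) K'⟩
      (by simp [gadgetTree, gadgetMover])]
  · rw [preSeq_child_of_ne ⟨_, gadget_parent_deal_resolving (hx := hx) (hI := hI) (u := u) K⟩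
      (by rw [gadget_choice_mover]; simp),
      preSeq_child_of_ne ⟨_, gadget_parent_deal_resolving (hx := hx) (hI := hI) (u := u) K'⟩
      (by rw [gadget_choice_mover]; simp), gadget_seq_choice, gadget_seq_choice]
    rfl

/-- At start nodes with equal sequences, the sequences in the gadget game are equal. -/
theorem gadget_preSeq_top_congr {k k' : Γ.kept x I} (hk : k.1 ∈ Γ.top I) (hk' : k'.1 ∈ Γ.top I)
    (e : Γ.seq i k.1 = Γ.seq i k'.1) :
    (gadgetTree hx hI v u).preSeq i (gadgetCopy hx hI v u k) =
      (gadgetTree hx hI v u).preSeq i (gadgetCopy hx hI v u k') := by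
  have hK : k.1 ∈ (oppInfoset hI hk).1 := ⟨hk.1, rfl⟩
  have hK' : k'.1 ∈ (oppInfoset hI hk').1 := ⟨hk'.1, rfl⟩
  cases i
  · rw [gadget_preSeq_top hK, gadget_preSeq_top hK', gadget_seq_deal_plus]
  · rw [gadget_preSeq_top hK, gadget_preSeq_top (K := oppInfoset hI hk) ⟨hk'.1, e.symm⟩]

/-- Translates sequences of a game to sequences of a gadget game: `s` is the sequence at the start
node, and `b` the sequence in the gadget game before this node. -/
noncomputable def encodeSeq {N O A : Type} (s : List (O ⊕ A))
    (b : List (GadgetObs N O A ⊕ GadgetAct N A)) :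
    List (O ⊕ A) → List (GadgetObs N O A ⊕ GadgetAct N A)
  | [] => []
  | .inl o :: l => if .inl o :: l = s then .inl (.entry s) :: b else .inl (.old o) :: encodeSeq s b l
  | .inr a :: l => .inr (.old a) :: encodeSeq s b l

theorem encodeSeq_start {N O A : Type} (o : O) (s : List (O ⊕ A))
    (b : List (GadgetObs N O A ⊕ GadgetAct N A)) :
    encodeSeq (.inl o :: s) b (.inl o :: s) = .inl (.entry (.inl o :: s)) :: b := by
  rw [encodeSeq, if_pos rfl]

theorem encodeSeq_inl {N O A : Type} {s l : List (O ⊕ A)} {o : O}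
    (b : List (GadgetObs N O A ⊕ GadgetAct N A)) (h : .inl o :: l ≠ s) :
    encodeSeq s b (.inl o :: l) = .inl (.old o) :: encodeSeq s b l := by
  rw [encodeSeq, if_neg h]

theorem encodeSeq_inr {N O A : Type} (s l : List (O ⊕ A)) (a : A)
    (b : List (GadgetObs N O A ⊕ GadgetAct N A)) :
    encodeSeq s b (.inr a :: l) = .inr (.old a) :: encodeSeq s b l := rfl

/-- The entry observation stores the whole original sequence at the start node, so nothing is lost
from there on. That `s` ends in an observation guarantees that the encoding meets it. -/
theorem decodeSeq_encodeSeq {N O A : Type} {s : List (O ⊕ A)}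
    {b : List (GadgetObs N O A ⊕ GadgetAct N A)} (o : O) (s' : List (O ⊕ A))
    (hs : s = .inl o :: s') {l : List (O ⊕ A)} (hl : s <:+ l) :
    decodeSeq (encodeSeq s b l) = l := by
  induction l with
  | nil =>
    rw [hs] at hl
    simp at hl
  | cons e l ih =>
    rcases e with o' | a
    · rw [encodeSeq]
      split_ifs with he
      · rw [he]
        rfl
      · rw [decodeSeq, ih ((List.suffix_cons_iff.1 hl).resolve_left fun e => he e.symm)]
    · rw [encodeSeq, decodeSeq, ih]
      refine (List.suffix_cons_iff.1 hl).resolve_left fun e => ?_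
      rw [hs] at e
      simp at e

theorem gadget_obs_copy_top {h : Γ.kept x I} (hi : i = .plus → h.1 ∈ I) (ht : h.1 ∈ Γ.top I) :
    (gadgetTree hx hI v u).obs i (gadgetCopy hx hI v u h) = GadgetObs.entry (Γ.seq i h.1) := by
  rw [gadget_obs_copy fun e => ⟨h.1, hi e, anc_refl _⟩, if_pos ht]

theorem gadget_mover_copy_iff {h : Γ.kept x I} (hi : i = .plus → h.1 ∈ Γ.below I) :
    (gadgetTree hx hI v u).mover (gadgetCopy hx hI v u h) = some i ↔ Γ.mover h.1 = some i := by
  rw [gadget_mover_copy]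
  split_ifs with hc
  · rw [hc.1]
    cases i
    · exact absurd (hi rfl) hc.2
    · simp
  · rfl

/-- The sequences at the copied nodes. -/
theorem gadget_seq_copy {k : Γ.kept x I} (hk : k.1 ∈ Γ.top I) (hi : i = .plus → k.1 ∈ I)
    (h : Γ.kept x I) (hA : Γ.Anc k.1 h.1) :
    (gadgetTree hx hI v u).seq i (gadgetCopy hx hI v u h) =
      encodeSeq (Γ.seq i k.1) ((gadgetTree hx hI v u).preSeq i (gadgetCopy hx hI v u k))
        (Γ.seq i h.1) ∧
    (k.1 ≠ h.1 → (gadgetTree hx hI v u).preSeq i (gadgetCopy hx hI v u h) =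
      encodeSeq (Γ.seq i k.1) ((gadgetTree hx hI v u).preSeq i (gadgetCopy hx hI v u k))
        (Γ.preSeq i h.1)) := by
  have start : ∀ h : Γ.kept x I, k.1 = h.1 →
      (gadgetTree hx hI v u).seq i (gadgetCopy hx hI v u h) =
        encodeSeq (Γ.seq i k.1) ((gadgetTree hx hI v u).preSeq i (gadgetCopy hx hI v u k))
          (Γ.seq i h.1) := by
    intro h e
    obtain rfl : k = h := Subtype.ext e
    rw [seq_of_not_terminal (Γ := gadgetTree hx hI v u) (fun ht => hk.1 (gadget_terminal_copy.1 ht)),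
      gadget_obs_copy_top hi hk]
    generalize (gadgetTree hx hI v u).preSeq i (gadgetCopy hx hI v u k) = b
    rw [seq_of_not_terminal hk.1]
    exact (encodeSeq_start _ _ b).symm
  revert hA
  refine kept_induction hx hI (P := fun h => Γ.Anc k.1 h.1 →
    (gadgetTree hx hI v u).seq i (gadgetCopy hx hI v u h) =
      encodeSeq (Γ.seq i k.1) ((gadgetTree hx hI v u).preSeq i (gadgetCopy hx hI v u k))
        (Γ.seq i h.1) ∧
    (k.1 ≠ h.1 → (gadgetTree hx hI v u).preSeq i (gadgetCopy hx hI v u h) =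
      encodeSeq (Γ.seq i k.1) ((gadgetTree hx hI v u).preSeq i (gadgetCopy hx hI v u k))
        (Γ.preSeq i h.1))) ?_ ?_ h
  · intro h ht hA
    have e := hI.eq_of_top hk ht hA (anc_refl _)
    exact ⟨start h e, fun hne => absurd e hne⟩
  · intro g c hc ih hA
    by_cases e : k.1 = c.1
    · exact ⟨start c e, fun hne => absurd e hne⟩
    have hc' := hc
    obtain ⟨a, ha⟩ := hc
    have hAg := anc_parent hA e ha
    have hgb : i = .plus → g.1 ∈ Γ.below I := fun e => ⟨k.1, hi e, hAg⟩
    have hcb : i = .plus → c.1 ∈ Γ.below I := fun e => ⟨k.1, hi e, hA⟩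
    have hp : (gadgetTree hx hI v u).parent (gadgetCopy hx hI v u c) =
        some (gadgetCopy hx hI v u g, .old a) :=
      (gadget_parent_copy (hx := hx) (hI := hI) (v := v)).2 ⟨c, a, rfl, rfl, ha⟩
    have hpre : (gadgetTree hx hI v u).preSeq i (gadgetCopy hx hI v u c) =
        encodeSeq (Γ.seq i k.1) ((gadgetTree hx hI v u).preSeq i (gadgetCopy hx hI v u k))
          (Γ.preSeq i c.1) := by
      by_cases hm : Γ.mover g.1 = some i
      · rw [preSeq_child_of_mover hp ((gadget_mover_copy_iff hgb).2 hm), preSeq_child_of_mover ha hm,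
          (ih hAg).1]
        exact (encodeSeq_inr _ _ a _).symm
      · rw [preSeq_child_of_ne ⟨_, hp⟩ (fun h => hm ((gadget_mover_copy_iff hgb).1 h)),
          preSeq_child_of_ne hc' hm, (ih hAg).1]
    refine ⟨?_, fun _ => hpre⟩
    by_cases ht : Γ.IsTerminal c.1
    · rw [seq_of_terminal ht, seq_of_terminal (gadget_terminal_copy.2 ht), hpre]
    · rw [seq_of_not_terminal (Γ := gadgetTree hx hI v u)
        (fun h => ht (gadget_terminal_copy.1 h)), gadget_obs_copy hcb,
        if_neg (hI.child_not_top g.2.1 hc'), seq_of_not_terminal ht, hpre]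
      -- An observation below the start node is made at a greater depth, so it is not mistaken for
      -- the entry.
      refine (encodeSeq_inl _ fun e' => ?_).symm
      rw [← seq_of_not_terminal ht] at e'
      have h1 := depth_eq' ht hk.1 e'
      have h2 := Anc.depth_le hAg
      have h3 := depth_child hc'
      omega

end gadgetStructure

end GameTree

/-! ### Probabilities and payoffs in the gadget game, in terms of composite strategies. -/

namespace GameTree

section gadgetPayoff

variable {Γ : Game} {x : Γ.Seq .plus → ℝ} {I : Set Γ.Node} {i : Player}
  {hx : Γ.IsStrategy .plus x} {hI : Γ.CanSolve x I} {v : GadgetKind}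
  {u : GadgetNode (Γ.oppInfosets I) (Γ.kept x I) v → ℝ}

/-- Nature deals `k` with probability p(k)x(k)/m(K). Outside Ī it also plays the moves of the fixed
`x`, so the factor grows from x(k) to x(h); inside Ī these moves belong to `plus`, and x(k) remains.
-/
theorem gadget_reach_copy (K : Γ.oppInfosets I) {k : Γ.kept x I} (hk : k.1 ∈ K.1)
    (h : Γ.kept x I) (hA : Γ.Anc k.1 h.1) :
    (gadgetTree hx hI v u).reach (gadgetCopy hx hI v u h) =
      (gadgetTree hx hI v u).reach (gadgetDeal hx hI v u K) * (Γ.mass x K.1)⁻¹ * Γ.reach h.1 *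
        (if h.1 ∈ Γ.below I then x (Γ.at' .plus k.1) else x (Γ.at' .plus h.1)) := by
  have hkt := mem_top_of_mem K.2 hk
  revert hA
  refine kept_induction hx hI (P := fun h => Γ.Anc k.1 h.1 →
    (gadgetTree hx hI v u).reach (gadgetCopy hx hI v u h) =
      (gadgetTree hx hI v u).reach (gadgetDeal hx hI v u K) * (Γ.mass x K.1)⁻¹ * Γ.reach h.1 *
        (if h.1 ∈ Γ.below I then x (Γ.at' .plus k.1) else x (Γ.at' .plus h.1))) ?_ ?_ h
  · intro h ht hA
    obtain rfl : k = h := Subtype.ext (hI.eq_of_top hkt ht hA (anc_refl _))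
    rw [reach_child (gadget_deal_child hk), if_pos (gadget_deal_mover K), gadget_chance_top k ht,
      infoset_eq_of_mem K.2 hk, ite_self]
    ring
  · intro g c hc ih hA
    have hcT := hI.child_not_top g.2.1 hc
    have hne : k.1 ≠ c.1 := fun e => hcT (e ▸ hkt)
    have hc' := hc
    obtain ⟨a, ha⟩ := hc
    have hAg := anc_parent hA hne ha
    have hG : (gadgetTree hx hI v u).IsChild (gadgetCopy hx hI v u g) (gadgetCopy hx hI v u c) :=
      gadget_child_copy.2 ⟨c, rfl, hc'⟩
    rw [reach_child hG, ih hAg, gadget_mover_copy, gadget_chance_not_top c hcT ha, reach_child hc']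
    have hb := below_iff_child hI g.2 hc'
    simp only [hb]
    rcases hm : Γ.mover g.1 with _ | j
    · have := hx.child_eq hc' (by simp [hm])
      simp [this]
      ring_nf
    · cases j
      · by_cases hgb : g.1 ∈ Γ.below I
        · simp [hgb]
        · have hpos : x (Γ.at' .plus g.1) ≠ 0 := (g.2.2.resolve_left hgb).ne'
          simp only [hgb, not_false_eq_true, and_self, if_true, if_false, reduceCtorEq, mul_one]
          field_simp
      · have := hx.child_eq hc' (by simp [hm])
        simp [this]

theorem gadget_plus_deal {w : (gadgetTree hx hI v u).Seq .plus → ℝ}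
    (hw : (gadgetTree hx hI v u).IsStrategy .plus w) (K : Γ.oppInfosets I) :
    w ((gadgetTree hx hI v u).at' .plus (gadgetDeal hx hI v u K)) = 1 := by
  cases v
  · rw [hw.child_eq ⟨_, gadget_parent_deal_maxmargin K⟩ (by simp [gadgetTree, gadgetMover]),
      hw.at_root]
  · rw [hw.child_eq ⟨_, gadget_parent_deal_resolving K⟩ (by rw [gadget_choice_mover]; simp),
      hw.child_eq ⟨_, gadget_parent_choice K⟩ (by simp [gadgetTree, gadgetMover]), hw.at_root]

/-- `plus` decides only inside Ī, so she has made no choice yet at these nodes. -/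
theorem gadget_plus_outside {w : (gadgetTree hx hI v u).Seq .plus → ℝ}
    (hw : (gadgetTree hx hI v u).IsStrategy .plus w) (h : Γ.kept x I)
    (hb : h.1 ∉ Γ.below I ∨ h.1 ∈ Γ.top I) :
    w ((gadgetTree hx hI v u).at' .plus (gadgetCopy hx hI v u h)) = 1 := by
  revert hb
  refine kept_induction hx hI (P := fun h => h.1 ∉ Γ.below I ∨ h.1 ∈ Γ.top I →
    w ((gadgetTree hx hI v u).at' .plus (gadgetCopy hx hI v u h)) = 1) ?_ ?_ h
  · intro h ht _
    rw [hw.child_eq (gadget_deal_child (K := oppInfoset hI ht) ⟨ht.1, rfl⟩)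
      (by rw [gadget_deal_mover]; simp), gadget_plus_deal hw]
  · intro g c hc ih hb
    have hcT := hI.child_not_top g.2.1 hc
    have hgb : g.1 ∉ Γ.below I := fun h => (hb.resolve_right hcT) (below_child h hc)
    rw [hw.child_eq (gadget_child_copy.2 ⟨c, rfl, hc⟩) ?_, ih (Or.inl hgb)]
    rw [gadget_mover_copy]
    split_ifs with hm
    · simp
    · exact fun h => hm ⟨h, hgb⟩

theorem gadget_anc_from_copy {k : Γ.kept x I} {n : (gadgetTree hx hI v u).Node}
    (hA : (gadgetTree hx hI v u).Anc (gadgetCopy hx hI v u k) n) :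
    ∃ h : Γ.kept x I, n = gadgetCopy hx hI v u h ∧ Γ.Anc k.1 h.1 := by
  induction hA with
  | refl => exact ⟨k, rfl, anc_refl _⟩
  | tail _ hc ih =>
    obtain ⟨h, rfl, hA⟩ := ih
    obtain ⟨c, rfl, hc'⟩ := gadget_child_copy.1 hc
    exact ⟨c, rfl, hA.tail hc'⟩

theorem gadget_anc_copy {k : Γ.kept x I} (hk : k.1 ∈ Γ.top I) (h : Γ.kept x I)
    (hA : Γ.Anc k.1 h.1) :
    (gadgetTree hx hI v u).Anc (gadgetCopy hx hI v u k) (gadgetCopy hx hI v u h) := by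
  revert hA
  refine kept_induction hx hI (P := fun h => Γ.Anc k.1 h.1 →
    (gadgetTree hx hI v u).Anc (gadgetCopy hx hI v u k) (gadgetCopy hx hI v u h)) ?_ ?_ h
  · intro h ht hA
    obtain rfl : k = h := Subtype.ext (hI.eq_of_top hk ht hA (anc_refl _))
    exact anc_refl _
  · intro g c hc ih hA
    have hne : k.1 ≠ c.1 := fun e => hI.child_not_top g.2.1 hc (e ▸ hk)
    have hc' := hc
    obtain ⟨a, ha⟩ := hc
    exact (ih (anc_parent hA hne ha)).tail (gadget_child_copy.2 ⟨c, rfl, hc'⟩)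

theorem gadget_anc_deal {K : Γ.oppInfosets I} {n : (gadgetTree hx hI v u).Node} :
    ((gadgetTree hx hI v u).IsTerminal n ∧
      (gadgetTree hx hI v u).Anc (gadgetDeal hx hI v u K) n) ↔
    ∃ h : Γ.kept x I, n = gadgetCopy hx hI v u h ∧ (Γ.IsTerminal h.1 ∧ ∃ k ∈ K.1, Γ.Anc k h.1) := by
  constructor
  · rintro ⟨ht, hA⟩
    obtain ⟨c, hc, hA'⟩ := hA.eq_or_child.resolve_left
      (by rintro rfl; exact gadget_deal_not_terminal K ht)
    obtain ⟨k, rfl, hk⟩ := gadget_child_deal.1 hc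
    obtain ⟨h, rfl, hkh⟩ := gadget_anc_from_copy hA'
    exact ⟨h, rfl, gadget_terminal_copy.1 ht, k.1, hk, hkh⟩
  · rintro ⟨h, rfl, ht, k, hk, hA⟩
    have hkT := mem_top_of_mem K.2 hk
    have hkk := kept_of_anc hx hI h.2 hkT (anc_refl k) hA
    exact ⟨gadget_terminal_copy.2 ht, (Anc.of_child (gadget_deal_child (h := ⟨k, hkk⟩) hk)).trans'
      (gadget_anc_copy (k := ⟨k, hkk⟩) hkT h hA)⟩

theorem entryNode_eq (hI : Γ.CanSolve x I) {k : Γ.Node} (hk : k ∈ Γ.top I) {h : Γ.kept x I}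
    (hA : Γ.Anc k h.1) : entryNode h = k :=
  hI.eq_of_top h.2.1.choose_spec.1 hk h.2.1.choose_spec.2 hA

/-- The strategy `X` of `plus` in the game combines `x` and the strategy `w` in the gadget game. -/
structure IsComposite (hx : Γ.IsStrategy .plus x) (hI : Γ.CanSolve x I) (v : GadgetKind)
    (u : GadgetNode (Γ.oppInfosets I) (Γ.kept x I) v → ℝ)
    (w : (gadgetTree hx hI v u).Seq .plus → ℝ) (X : Γ.Seq .plus → ℝ) : Prop where
  inside : ∀ g ∈ I, ∀ h : Γ.kept x I, Γ.Anc g h.1 → X (Γ.at' .plus h.1) =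
    x (Γ.at' .plus g) * w ((gadgetTree hx hI v u).at' .plus (gadgetCopy hx hI v u h))
  outside : ∀ h, h ∉ Γ.below I → X (Γ.at' .plus h) = x (Γ.at' .plus h)

/-- Inside Ī the factor x(k) of nature and `w` multiply to X; outside Ī nature contributes x(h),
which is X(h), and `w` is 1. So gadget probabilities are those of X up to a constant that depends
only on `K`. -/
theorem IsComposite.prob_copy {w : (gadgetTree hx hI v u).Seq .plus → ℝ}
    {X : Γ.Seq .plus → ℝ} (hX : IsComposite hx hI v u w X)
    (hw : (gadgetTree hx hI v u).IsStrategy .plus w) (K : Γ.oppInfosets I) {k h : Γ.kept x I}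
    (hk : k.1 ∈ K.1) (hA : Γ.Anc k.1 h.1) (y : (gadgetTree hx hI v u).Seq .minus → ℝ) :
    prob w y (gadgetCopy hx hI v u h) =
      (gadgetTree hx hI v u).reach (gadgetDeal hx hI v u K) * (Γ.mass x K.1)⁻¹ *
        (Γ.reach h.1 * X (Γ.at' .plus h.1) *
          y ((gadgetTree hx hI v u).at' .minus (gadgetCopy hx hI v u h))) := by
  rw [prob, gadget_reach_copy K hk h hA]
  by_cases hb : h.1 ∈ Γ.below I
  · rw [if_pos hb, hX.inside k.1 (hI.mem_of_anc (mem_top_of_mem K.2 hk) hA hb) h hA]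
    ring
  · rw [if_neg hb, hX.outside _ hb, gadget_plus_outside hw h (Or.inl hb)]
    ring

/-- Nodes left out of the gadget game have no weight under X, so sums over its copied nodes can be
replaced by sums over the original game. -/
theorem IsComposite.eq_zero {w : (gadgetTree hx hI v u).Seq .plus → ℝ}
    {X : Γ.Seq .plus → ℝ} (hX : IsComposite hx hI v u w X) {k h : Γ.Node} (hk : k ∈ Γ.top I)
    (hA : Γ.Anc k h) (hh : h ∉ Γ.kept x I) : X (Γ.at' .plus h) = 0 := by
  have hb : h ∉ Γ.below I := fun hb => hh (below_kept hI hb)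
  rw [hX.outside h hb]
  exact le_antisymm (not_lt.1 fun hp => hh ⟨⟨k, hk, hA⟩, Or.inr hp⟩) (hx.nonneg _)

theorem gadget_util_copy (hI : Γ.CanSolve x I) (o : Γ.SolveOptions x I)
    {K : Γ.oppInfosets I} {k : Γ.Node}
    (hk : k ∈ K.1) {h : Γ.kept x I} (hA : Γ.Anc k h.1) :
    Γ.gadgetUtil x I o v (.copy v h) =
      o.scale K.1 * (Γ.util h.1 - (Γ.infosetValue x k - o.gift K.1)) := by
  have e := entryNode_eq hI (mem_top_of_mem K.2 hk) hA
  cases v <;> simp only [gadgetUtil, e, infoset_eq_of_mem K.2 hk]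

theorem gadget_util_ne_zero (o : Γ.SolveOptions x I) {v : GadgetKind}
    {n : GadgetNode (Γ.oppInfosets I) (Γ.kept x I) v} (hn : Γ.gadgetUtil x I o v n ≠ 0) :
    ∃ h, n = .copy v h := by
  rcases n with _ | K | K | ⟨v, K⟩ | ⟨v, h⟩
  · cases v <;> simp [gadgetUtil] at hn
  · simp [gadgetUtil] at hn
  · simp [gadgetUtil] at hn
  · cases v <;> simp [gadgetUtil] at hn
  · exact ⟨h, rfl⟩

/-- A gadget game with the utility `u`. -/
noncomputable def gadgetGame (hx : Γ.IsStrategy .plus x) (hI : Γ.CanSolve x I) (v : GadgetKind)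
    (u : GadgetNode (Γ.oppInfosets I) (Γ.kept x I) v → ℝ) : Game where
  toGameTree := gadgetTree hx hI v u
  obs_mover := gadget_obs_mover
  same_actions := gadget_same_actions
  chance_pos := gadget_chance_pos
  chance_sum := gadget_chance_sum

theorem gadget_sum_prob {w : (gadgetTree hx hI v u).Seq .plus → ℝ}
    (hw : (gadgetTree hx hI v u).IsStrategy .plus w)
    {y : (gadgetTree hx hI v u).Seq .minus → ℝ} (hy : (gadgetTree hx hI v u).IsStrategy .minus y)
    (h : (gadgetTree hx hI v u).Node) :
    ∑ n with (gadgetTree hx hI v u).IsTerminal n ∧ (gadgetTree hx hI v u).Anc h n, prob w y n =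
      prob w y h :=
  sum_terminal_eq (fun _ ht => sum_prob_child (Γ := gadgetGame hx hI v u) hw hy ht) h

theorem gadget_reach_pos (n : (gadgetTree hx hI v u).Node) : 0 < (gadgetTree hx hI v u).reach n :=
  reach_pos (gadgetGame hx hI v u) n

theorem gadget_sum' {S : (gadgetTree hx hI v u).Node → Prop} [DecidablePred S]
    {P : Γ.Node → Prop} [DecidablePred P]
    (hS : ∀ n, S n ↔ ∃ c : Γ.kept x I, n = gadgetCopy hx hI v u c ∧ P c.1)
    (F : (gadgetTree hx hI v u).Node → ℝ) (f : Γ.Node → ℝ)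
    (hF : ∀ c : Γ.kept x I, P c.1 → F (gadgetCopy hx hI v u c) = f c.1)
    (hf : ∀ c, P c → c ∉ Γ.kept x I → f c = 0) :
    ∑ n with S n, F n = ∑ c with P c, f c := by
  convert gadget_sum hS F f hF hf

/-- The part of the utility of a gadget game that comes from the infoset `K`. -/
theorem IsComposite.sum_deal {w : (gadgetTree hx hI v u).Seq .plus → ℝ} {X : Γ.Seq .plus → ℝ}
    (hX : IsComposite hx hI v u w X) (hw : (gadgetTree hx hI v u).IsStrategy .plus w)
    {y : (gadgetTree hx hI v u).Seq .minus → ℝ} (hy : (gadgetTree hx hI v u).IsStrategy .minus y)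
    (K : Γ.oppInfosets I) {k : Γ.Node} (hk : k ∈ K.1) {l a : ℝ}
    (hu : ∀ h : Γ.kept x I, (∃ k ∈ K.1, Γ.Anc k h.1) → u (.copy v h) = l * (Γ.util h.1 - a))
    (Y : Γ.Node → ℝ) (hY : ∀ h : Γ.kept x I, (∃ k ∈ K.1, Γ.Anc k h.1) →
      Y h.1 = y ((gadgetTree hx hI v u).at' .minus (gadgetCopy hx hI v u h))) :
    ∑ n with (gadgetTree hx hI v u).IsTerminal n ∧
        (gadgetTree hx hI v u).Anc (gadgetDeal hx hI v u K) n,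
        (gadgetTree hx hI v u).util n * prob w y n =
      l * (gadgetTree hx hI v u).reach (gadgetDeal hx hI v u K) *
        ((Γ.mass x K.1)⁻¹ * ∑ z with Γ.IsTerminal z ∧ Γ.seq .minus k <:+ Γ.seq .minus z,
          Γ.util z * Γ.reach z * X (Γ.at' .plus z) * Y z -
        a * y ((gadgetTree hx hI v u).at' .minus (gadgetDeal hx hI v u K))) := by
  have hkt := mem_top_of_mem K.2 hk
  set κ := (gadgetTree hx hI v u).reach (gadgetDeal hx hI v u K) with hκ
  let P : Γ.Node → Prop := fun z => Γ.IsTerminal z ∧ ∃ k ∈ K.1, Γ.Anc k z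
  have hprob : ∀ c : Γ.kept x I, P c.1 → prob w y (gadgetCopy hx hI v u c) =
      κ * (Γ.mass x K.1)⁻¹ * (Γ.reach c.1 * X (Γ.at' .plus c.1) * Y c.1) := by
    rintro c ⟨-, k', hk', hA⟩
    rw [hY c ⟨k', hk', hA⟩]
    have hkk := kept_of_anc hx hI c.2 (mem_top_of_mem K.2 hk') (anc_refl k') hA
    exact hX.prob_copy hw K (k := ⟨k', hkk⟩) hk' hA y
  have hzero : ∀ c, P c → c ∉ Γ.kept x I → X (Γ.at' .plus c) = 0 := by
    rintro c ⟨-, k', hk', hA⟩ hc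
    exact hX.eq_zero (mem_top_of_mem K.2 hk') hA hc
  have e1 := gadget_sum' (P := P)
    (fun n => gadget_anc_deal (hx := hx) (hI := hI) (u := u) (K := K) (n := n))
    (fun n => (gadgetTree hx hI v u).util n * prob w y n)
    (fun z => l * (Γ.util z - a) *
      (κ * (Γ.mass x K.1)⁻¹ * (Γ.reach z * X (Γ.at' .plus z) * Y z)))
    (fun c hc => by
      rw [hprob c hc, ← hu c hc.2]
      rfl)
    (fun c hc hck => by
      rw [hzero c hc hck]
      ring)
  -- By conservation of probability, the terminal probabilities below `deal K` add up to that of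
  -- `deal K`, which turns the constant `a` into a single term.
  have e2 := gadget_sum' (P := P)
    (fun n => gadget_anc_deal (hx := hx) (hI := hI) (u := u) (K := K) (n := n))
    (fun n => prob w y n)
    (fun z => κ * (Γ.mass x K.1)⁻¹ * (Γ.reach z * X (Γ.at' .plus z) * Y z)) hprob
    (fun c hc hck => by
      rw [hzero c hc hck]
      ring)
  have e5 : ∑ z with Γ.IsTerminal z ∧ Γ.seq .minus k <:+ Γ.seq .minus z,
      Γ.util z * Γ.reach z * X (Γ.at' .plus z) * Y z =
      ∑ z with P z, Γ.util z * Γ.reach z * X (Γ.at' .plus z) * Y z := by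
    refine Finset.sum_congr (Finset.filter_congr fun z _ => and_congr_right fun _ => ?_)
      fun _ _ => rfl
    rw [seq_suffix_seq_iff hkt.1, infoset_eq_of_mem K.2 hk]
  rw [gadget_sum_prob hw hy, prob, ← hκ, gadget_plus_deal hw K, mul_one] at e2
  rw [e1, e5, mul_sub, mul_comm a, mul_assoc l κ (_ * a), ← mul_assoc κ, e2, Finset.mul_sum,
    Finset.mul_sum, Finset.sum_mul, Finset.mul_sum, ← Finset.sum_sub_distrib]
  exact Finset.sum_congr rfl fun z _ => by ring

theorem gadget_depth_deal (K K' : Γ.oppInfosets I) :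
    depth (gadgetDeal hx hI v u K) = depth (gadgetDeal hx hI v u K') := by
  cases v
  · rw [depth_child ⟨_, gadget_parent_deal_maxmargin K⟩,
      depth_child ⟨_, gadget_parent_deal_maxmargin K'⟩]
  · rw [depth_child ⟨_, gadget_parent_deal_resolving K⟩,
      depth_child ⟨_, gadget_parent_deal_resolving K'⟩, depth_child ⟨_, gadget_parent_choice K⟩,
      depth_child ⟨_, gadget_parent_choice K'⟩]

/-- The utility in a gadget game, split along the infosets where it starts. -/
theorem gadget_payoff (hu : ∀ n, u n ≠ 0 → ∃ h, n = .copy v h)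
    (w : (gadgetTree hx hI v u).Seq .plus → ℝ) (y : (gadgetTree hx hI v u).Seq .minus → ℝ) :
    (gadgetTree hx hI v u).payoff w y = ∑ n with ∃ K, n = gadgetDeal hx hI v u K,
      ∑ m with (gadgetTree hx hI v u).IsTerminal m ∧ (gadgetTree hx hI v u).Anc n m,
        (gadgetTree hx hI v u).util m * prob w y m := by
  obtain ⟨K₀⟩ : Nonempty (Γ.oppInfosets I) := by
    have hI' := hI
    obtain ⟨⟨g, hg, -, rfl⟩, -⟩ := hI'
    exact ⟨oppInfoset hI (hI.mem_top (h := g) ⟨hg, rfl⟩)⟩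
  rw [← sum_below (d := depth (gadgetDeal hx hI v u K₀))
    (by
      rintro n ⟨K, rfl⟩
      exact gadget_depth_deal _ _), payoff]
  symm
  -- Terminal nodes that are not below a `deal` node are not copies, and carry utility 0.
  refine Finset.sum_subset_zero_on_sdiff ?_ ?_ ?_
  · intro n hn
    exact Finset.mem_filter.2 ⟨Finset.mem_univ _, (Finset.mem_filter.1 hn).2.1⟩
  · intro n hn
    rw [Finset.mem_sdiff, Finset.mem_filter, Finset.mem_filter] at hn
    obtain ⟨⟨-, ht⟩, hn⟩ := hn
    by_contra hne
    refine hn ⟨Finset.mem_univ _, ht, ?_⟩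
    have hun : u n ≠ 0 := by
      intro h0
      refine hne ?_
      have : (gadgetTree hx hI v u).util n = 0 := h0
      rw [this]
      ring
    obtain ⟨h, rfl⟩ := hu n hun
    have hsp := h.2.1.choose_spec
    exact ⟨_, ⟨oppInfoset hI hsp.1, rfl⟩, ((gadget_anc_deal (K := oppInfoset hI hsp.1)).2
      ⟨h, rfl, gadget_terminal_copy.1 ht, _, ⟨hsp.1.1, rfl⟩, hsp.2⟩).2⟩
  · intro n _
    rw [prob]
    ring

end gadgetPayoff

end GameTree

/-! ### Transfer of strategies between the gadget game and the original game. -/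

namespace GameTree

section gadgetStrategies

variable {Γ : Game} {x : Γ.Seq .plus → ℝ} {I : Set Γ.Node} {i : Player}
  {hx : Γ.IsStrategy .plus x} {hI : Γ.CanSolve x I} {v : GadgetKind}
  {u : GadgetNode (Γ.oppInfosets I) (Γ.kept x I) v → ℝ}

/-- A path that continues the sequence of `k₀` passes through the infoset of `k₀`. For `plus` this
infoset is `I`, and for `minus` it consists of start nodes, so the path enters the copied part
there. -/
theorem exists_start_of_suffix (hx : Γ.IsStrategy .plus x) (hI : Γ.CanSolve x I) {k₀ : Γ.Node}
    (hk₀ : k₀ ∈ Γ.top I) (hi : i = .plus → k₀ ∈ I) {g h : Γ.Node} (hh : h ∈ Γ.kept x I)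
    (hA : Γ.Anc g h) (hs : Γ.seq i k₀ <:+ Γ.seq i g) :
    g ∈ Γ.kept x I ∧ ∃ k : Γ.kept x I, k.1 ∈ Γ.top I ∧ Γ.seq i k.1 = Γ.seq i k₀ ∧
      Γ.Anc k.1 g ∧ (i = .plus → k.1 ∈ I) := by
  obtain ⟨k, ⟨hkt, hk⟩, hkg⟩ := (seq_suffix_seq_iff hk₀.1).1 hs
  have hkI : i = .plus → k ∈ I := by
    rintro rfl
    rw [← hI.infoset_eq (hi rfl)]
    exact ⟨hkt, hk⟩
  have hkT : k ∈ Γ.top I := by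
    cases i
    · exact hI.mem_top (hkI rfl)
    · obtain ⟨-, k', hk', e⟩ := hk₀
      exact ⟨hkt, k', hk', hk.trans e⟩
  exact ⟨kept_of_anc hx hI hh hkT hkg hA,
    ⟨k, kept_of_anc hx hI hh hkT (anc_refl k) (hkg.trans' hA)⟩, hkT, hk, hkg, hkI⟩

/-- A strategy in a gadget game, transferred to the original game. -/
theorem gadget_pullback {k₀ : Γ.kept x I} (hk₀ : k₀.1 ∈ Γ.top I) (hi : i = .plus → k₀.1 ∈ I)
    {y₀ : Γ.Seq i → ℝ} (hy₀ : Γ.IsStrategy i y₀) {w : (gadgetTree hx hI v u).Seq i → ℝ}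
    (hw : (gadgetTree hx hI v u).IsStrategy i w)
    (hpos : 0 < w ((gadgetTree hx hI v u).at' i (gadgetCopy hx hI v u k₀))) :
    ∃ y, Γ.IsStrategy i y ∧ (∀ t : Γ.Seq i, ¬ Γ.seq i k₀.1 <:+ t.1 → y t = y₀ t) ∧
      ∀ h : Γ.kept x I, Γ.seq i k₀.1 <:+ Γ.seq i h.1 → y (Γ.at' i h.1) = y₀ (Γ.at' i k₀.1) *
        (w ((gadgetTree hx hI v u).at' i (gadgetCopy hx hI v u h)) /
          w ((gadgetTree hx hI v u).at' i (gadgetCopy hx hI v u k₀))) := by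
  set p := w ((gadgetTree hx hI v u).at' i (gadgetCopy hx hI v u k₀)) with hp
  let s := Γ.at' i k₀.1
  -- The values of `w` are read off along encoded sequences. The prefix up to the start node is the
  -- same for all start nodes in the infoset of `k₀`.
  let W : List (Γ.Obs i ⊕ Γ.Act) → ℝ := fun l => listValue w (encodeSeq (Γ.seq i k₀.1)
    ((gadgetTree hx hI v u).preSeq i (gadgetCopy hx hI v u k₀)) l)
  let f : List (Γ.Obs i ⊕ Γ.Act) → ℝ := fun l => y₀ s * (W l / p)
  let D : Set (List (Γ.Obs i ⊕ Γ.Act)) :=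
    {l | ∃ h : Γ.kept x I, s.1 <:+ Γ.seq i h.1 ∧ l <:+ Γ.seq i h.1}
  have hseq : ∀ g : Γ.kept x I, s.1 <:+ Γ.seq i g.1 →
      W (Γ.seq i g.1) = w ((gadgetTree hx hI v u).at' i (gadgetCopy hx hI v u g)) ∧
      (s.1 <:+ Γ.preSeq i g.1 →
        W (Γ.preSeq i g.1) = w ((gadgetTree hx hI v u).pre i (gadgetCopy hx hI v u g))) := by
    intro g hg
    obtain ⟨-, k, hkT, hk, hkg, hkI⟩ := exists_start_of_suffix hx hI hk₀ hi g.2 (anc_refl _) hg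
    obtain ⟨h1, h2⟩ := gadget_seq_copy (hx := hx) (hI := hI) (v := v) (u := u) hkT hkI g hkg
    rw [gadget_preSeq_top_congr hkT hk₀ hk, hk] at h1 h2
    refine ⟨(congrArg (listValue w) h1.symm).trans (listValue_seq w _), fun hs => ?_⟩
    refine (congrArg (listValue w) (h2 ?_).symm).trans (listValue_preSeq w _)
    intro e
    change Γ.seq i k₀.1 <:+ _ at hs
    rw [← hk, ← e] at hs
    exact (depth_lt_of_seq_suffix_preSeq hkT.1 hs).ne rfl
  -- An infoset reached by `D` may contain nodes without a copy, but it has a copied node too, and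
  -- checking the constraints there is enough.
  have hD : ∀ h, ¬ Γ.IsTerminal h → Γ.seq i h ∈ D → s.1 <:+ Γ.seq i h →
      ∃ g : Γ.kept x I, ¬ Γ.IsTerminal g.1 ∧ Γ.seq i g.1 = Γ.seq i h := by
    rintro h ht ⟨h₁, -, hh₁⟩ hs
    obtain ⟨g, ⟨hgt, hg⟩, hA⟩ := (seq_suffix_seq_iff ht).1 hh₁
    rw [← hg] at hs
    exact ⟨⟨g, (exists_start_of_suffix hx hI hk₀ hi h₁.2 hA hs).1⟩, hgt, hg⟩
  suffices hex : ∃ y, Γ.IsStrategy i y ∧ (∀ t, ¬ s.1 <:+ t.1 → y t = y₀ t) ∧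
      ∀ t, s.1 <:+ t.1 → t.1 ∈ D → y t = f t.1 by
    obtain ⟨y, hy, h1, h2⟩ := hex
    refine ⟨y, hy, h1, fun h hh => ?_⟩
    rw [h2 (Γ.at' i h.1) hh ⟨h, hh, List.suffix_rfl⟩]
    change y₀ s * (W (Γ.seq i h.1) / p) = _
    rw [(hseq h hh).1]
  refine exists_strategy_replacing hy₀ s D f ?_ ⟨k₀, List.suffix_rfl, List.suffix_rfl⟩ ?_ ?_ ?_ ?_
  · rintro l l' - hl ⟨h, h1, h2⟩
    exact ⟨h, h1, hl.trans h2⟩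
  · intro l _
    exact mul_nonneg (hy₀.nonneg _) (div_nonneg (listValue_nonneg hw _) hpos.le)
  · change y₀ s * (W (Γ.seq i k₀.1) / p) = _
    rw [(hseq k₀ List.suffix_rfl).1, ← hp, div_self hpos.ne', mul_one]
  · intro h ht hhD hs
    obtain ⟨g, hgt, hg⟩ := hD h ht hhD (hs.trans (preSeq_suffix_seq h))
    have hpre := (seq_inj hgt ht hg).2
    rw [← hpre] at hs ⊢
    rw [← hg]
    have hs' := hs.trans (preSeq_suffix_seq g.1)
    simp only [f]
    rw [(hseq g hs').1, (hseq g hs').2 hs, hw.observe]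
  · intro h ht hm hhD hs
    obtain ⟨g, hgt, hg⟩ := hD h ht hhD hs
    have hmg := mover_eq_of_seq ht hgt hg.symm hm
    rw [← hg] at hs
    have hgb : i = .plus → g.1 ∈ Γ.below I := by
      intro e
      obtain ⟨-, k, -, -, hkg, hkI⟩ := exists_start_of_suffix hx hI hk₀ hi g.2 (anc_refl _) hs
      exact ⟨k.1, hkI e, hkg⟩
    -- Where the player herself moves in the gadget game, no child has been pruned.
    have hck : ∀ c, Γ.IsChild g.1 c → c ∈ Γ.kept x I := by
      intro c hc
      cases i
      · exact kept_child_of_below g.2 (hgb rfl) hc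
      · exact kept_child_of_mover hx g.2 (by rw [hmg]; simp) hc
    have hsc : ∀ c, Γ.IsChild g.1 c → s.1 <:+ Γ.preSeq i c := fun c hc =>
      hs.trans (seq_suffix_preSeq_child hc)
    refine ⟨g.1, hgt, hg, ?_, ?_⟩
    · intro c hc
      exact ⟨⟨c, hck c hc⟩, (hsc c hc).trans (preSeq_suffix_seq c), preSeq_suffix_seq c⟩
    · simp only [f]
      rw [← Finset.mul_sum, ← Finset.sum_div, (hseq g hs).1,
        ← hw.flow _ (fun h => hgt (gadget_terminal_copy.1 h)) ((gadget_mover_copy_iff hgb).2 hmg)]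
      congr 2
      refine (gadget_sum' (fun n => gadget_child_copy (n := n) (h := g)) _ _ ?_ ?_).symm
      · intro c hc
        exact ((hseq c ((hsc c.1 hc).trans (preSeq_suffix_seq c.1))).2 (hsc c.1 hc)).symm
      · intro c hc hnk
        exact absurd (hck c hc) hnk

/-- A strategy of `plus` in a gadget game, combined with the blueprint. -/
theorem exists_composite {w : (gadgetTree hx hI v u).Seq .plus → ℝ}
    (hw : (gadgetTree hx hI v u).IsStrategy .plus w) :
    ∃ X, Γ.IsStrategy .plus X ∧ IsComposite hx hI v u w X := by
  have hI' := hI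
  obtain ⟨⟨k, hkt, -, hkI⟩, -⟩ := hI'
  have hk : k ∈ I := hkI ▸ ⟨hkt, rfl⟩
  have hkk : k ∈ Γ.kept x I := below_kept hI ⟨k, hk, anc_refl k⟩
  have h1 : w ((gadgetTree hx hI v u).at' .plus (gadgetCopy hx hI v u ⟨k, hkk⟩)) = 1 :=
    gadget_plus_outside hw ⟨k, hkk⟩ (Or.inr (hI.mem_top hk))
  -- The pullback starts at `I` and replaces `x` there; as `w` is 1 at the start node, there is no
  -- rescaling beyond the factor x(I).
  obtain ⟨X, hX, hout, hin⟩ := gadget_pullback (k₀ := ⟨k, hkk⟩) (hI.mem_top hk) (fun _ => hk) hx hw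
    (by rw [h1]; exact zero_lt_one)
  refine ⟨X, hX, ?_, ?_⟩
  · intro g hg h hA
    rw [hkI] at hg
    rw [hin h (by rw [← hg.2]; exact hA.seq_suffix), h1, div_one, at'_eq hg.2]
  · intro h hb
    refine hout (Γ.at' .plus h) fun hs => hb ?_
    obtain ⟨g, hg, hA⟩ := (seq_suffix_seq_iff hkt).1 hs
    exact ⟨g, hkI ▸ hg, hA⟩

/-- No deeper than `I`, a node is either outside Ī or in `I` itself, where `plus` has not yet used
`w`. -/
theorem IsComposite.infoset_eq_one {w : (gadgetTree hx hI v u).Seq .plus → ℝ}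
    {X : Γ.Seq .plus → ℝ} (hX : IsComposite hx hI v u w X)
    (hw : (gadgetTree hx hI v u).IsStrategy .plus w) {h : Γ.Node} (hd : ∀ k ∈ I, depth h ≤ depth k) :
    X (Γ.at' .plus h) = x (Γ.at' .plus h) := by
  by_cases hb : h ∈ Γ.below I
  · have hb' := hb
    obtain ⟨k, hk, hA⟩ := hb'
    obtain rfl : k = h := anc_eq_of_depth hA (le_antisymm hA.depth_le (hd k hk))
    rw [hX.inside k hk ⟨k, below_kept hI hb⟩ hA, gadget_plus_outside hw _ (Or.inr (hI.mem_top hk)),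
      mul_one]
  · exact hX.outside h hb

theorem decode_seq_copy {k : Γ.kept x I} (hk : k.1 ∈ Γ.top I) (hi : i = .plus → k.1 ∈ I)
    (h : Γ.kept x I) (hA : Γ.Anc k.1 h.1) (hne : k.1 ≠ h.1) :
    decodeSeq ((gadgetTree hx hI v u).preSeq i (gadgetCopy hx hI v u h)) = Γ.preSeq i h.1 := by
  obtain ⟨-, h2⟩ := gadget_seq_copy (hx := hx) (hI := hI) (v := v) (u := u) hk hi h hA
  refine (congrArg decodeSeq (h2 hne)).trans ?_
  exact decodeSeq_encodeSeq _ _ (seq_of_not_terminal hk.1) (hA.seq_suffix_preSeq hne)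

theorem preSeq_ne_nil {g h : Γ.Node} (hA : Γ.Anc g h) (hne : g ≠ h) : Γ.preSeq i h ≠ [] := by
  intro e
  have := hA.seq_suffix_preSeq (i := i) hne
  rw [e, seq_of_not_terminal (hA.not_terminal hne)] at this
  simp at this

end gadgetStrategies

end GameTree

namespace GameTree

section gadgetStrategies

variable {Γ : Game} {x : Γ.Seq .plus → ℝ} {I : Set Γ.Node} {i : Player}
  {hx : Γ.IsStrategy .plus x} {hI : Γ.CanSolve x I} {v : GadgetKind}
  {u : GadgetNode (Γ.oppInfosets I) (Γ.kept x I) v → ℝ}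

/-- Decoding forgets everything before the start node. The empty result also tells start nodes from
the copied nodes below them. -/
theorem decode_seq_deal (K : Γ.oppInfosets I) :
    decodeSeq ((gadgetTree hx hI v u).seq i (gadgetDeal hx hI v u K)) = [] := by
  rw [seq_of_not_terminal (gadget_deal_not_terminal K), gadget_deal_obs]
  change decodeSeq ((gadgetTree hx hI v u).preSeq i (gadgetDeal hx hI v u K)) = []
  cases v
  · cases i
    · rw [preSeq_child_of_ne ⟨_, gadget_parent_deal_maxmargin K⟩ (by simp [gadgetTree, gadgetMover]),
        seq_of_not_terminal (not_terminal_of_child ⟨_, gadget_parent_deal_maxmargin K⟩),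
        preSeq_root]
      rfl
    · rw [gadget_preSeq_deal_minus_maxmargin]
      rfl
  · cases i
    · rw [preSeq_child_of_ne ⟨_, gadget_parent_deal_resolving K⟩
        (by rw [gadget_choice_mover]; simp), gadget_seq_choice]
      rfl
    · rw [gadget_preSeq_deal_minus_resolving]
      rfl

theorem decode_preSeq_top {h : Γ.kept x I} (ht : h.1 ∈ Γ.top I) :
    decodeSeq ((gadgetTree hx hI v u).preSeq i (gadgetCopy hx hI v u h)) = [] := by
  rw [gadget_preSeq_top (K := oppInfoset hI ht) ⟨ht.1, rfl⟩, decode_seq_deal]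

theorem exists_start (hx : Γ.IsStrategy .plus x) (hI : Γ.CanSolve x I) (h : Γ.kept x I) :
    ∃ k : Γ.kept x I, k.1 ∈ Γ.top I ∧ Γ.Anc k.1 h.1 ∧ (h.1 ∈ Γ.below I → k.1 ∈ I) := by
  obtain ⟨hk, hA⟩ := h.2.1.choose_spec
  exact ⟨⟨_, kept_of_anc hx hI h.2 hk (anc_refl _) hA⟩, hk, hA, hI.mem_of_anc hk hA⟩

/-- Decoding the sequence just before a copied node that is not a start node. -/
theorem decode_preSeq_copy (h : Γ.kept x I) (hi : i = .plus → h.1 ∈ Γ.below I)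
    (ht : h.1 ∉ Γ.top I) :
    decodeSeq ((gadgetTree hx hI v u).preSeq i (gadgetCopy hx hI v u h)) = Γ.preSeq i h.1 ∧
      Γ.preSeq i h.1 ≠ [] := by
  obtain ⟨k, hk, hA, hkI⟩ := exists_start hx hI h
  have hne : k.1 ≠ h.1 := fun e => ht (e ▸ hk)
  exact ⟨decode_seq_copy hk (fun e => hkI (hi e)) h hA hne, preSeq_ne_nil hA hne⟩

/-- The strategy that follows the blueprint in a gadget game. -/
theorem exists_blueprint (hx : Γ.IsStrategy .plus x) (hI : Γ.CanSolve x I) (v : GadgetKind)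
    (u : GadgetNode (Γ.oppInfosets I) (Γ.kept x I) v → ℝ) :
    ∃ w, (gadgetTree hx hI v u).IsStrategy .plus w ∧ IsComposite hx hI v u w x := by
  have hI' := hI
  obtain ⟨⟨k, hkt, hkm, hkI⟩, hpos⟩ := hI'
  have hk : k ∈ I := hkI ▸ ⟨hkt, rfl⟩
  have hp := hpos k hk
  -- The blueprint conditioned on having reached `I`. The empty list stands for everything before
  -- the start nodes and gets the value 1.
  let φ : List (Γ.Obs .plus ⊕ Γ.Act) → ℝ := fun l =>
    if l = [] then 1 else listValue x l / x (Γ.at' .plus k)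
  have hφ : ∀ h, Γ.preSeq .plus h ≠ [] →
      φ (Γ.preSeq .plus h) = x (Γ.at' .plus h) / x (Γ.at' .plus k) := by
    intro h hne
    simp only [φ, if_neg hne, listValue_preSeq, hx.observe]
  have hφ' : ∀ h, ¬ Γ.IsTerminal h →
      φ (Γ.seq .plus h) = x (Γ.at' .plus h) / x (Γ.at' .plus k) := by
    intro h ht
    have hne : Γ.seq .plus h ≠ [] := by
      rw [seq_of_not_terminal ht]
      simp
    simp only [φ, if_neg hne, listValue_seq]
  have hone : ∀ g ∈ I, x (Γ.at' .plus g) / x (Γ.at' .plus k) = 1 := by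
    intro g hg
    rw [hkI] at hg
    rw [at'_eq hg.2, div_self hp.ne']
  have hwait : ∀ l : List (GadgetObs Γ.Node (Γ.Obs .plus) Γ.Act ⊕ GadgetAct Γ.Node Γ.Act),
      φ (decodeSeq (.inl .wait :: l)) = φ (decodeSeq l) := fun l => rfl
  refine ⟨fun s => φ (decodeSeq (N := Γ.Node) (O := Γ.Obs .plus) (A := Γ.Act) s.1),
    isStrategy_of_list (Γ := gadgetTree hx hI v u) (i := .plus)
      (X := fun l => φ (decodeSeq (N := Γ.Node) (O := Γ.Obs .plus) (A := Γ.Act) l)) ?_ ?_ ?_ ?_,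
    ?_, ?_⟩
  · intro n
    simp only [φ]
    split_ifs
    · exact zero_le_one
    · exact div_nonneg (listValue_nonneg hx _) hp.le
  · exact if_pos rfl
  · intro n ht
    have trivial_case : (gadgetTree hx hI v u).obs .plus n = GadgetObs.wait →
        φ (decodeSeq ((gadgetTree hx hI v u).seq .plus n)) =
          φ (decodeSeq ((gadgetTree hx hI v u).preSeq .plus n)) := by
      intro e
      rw [seq_of_not_terminal ht, e]
      exact hwait _
    rcases n with _ | K | K | ⟨v, K⟩ | ⟨v, h⟩
    · exact trivial_case (by cases v <;> rfl)
    · exact trivial_case rfl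
    · exact trivial_case rfl
    · exact trivial_case (gadget_deal_obs .plus K)
    · change ¬ (gadgetTree hx hI v u).IsTerminal (gadgetCopy hx hI v u h) at ht
      by_cases hb : h.1 ∈ Γ.below I
      · have htn : ¬ Γ.IsTerminal h.1 := fun e => ht (gadget_terminal_copy.2 e)
        change φ (decodeSeq ((gadgetTree hx hI v u).seq .plus (gadgetCopy hx hI v u h))) =
          φ (decodeSeq ((gadgetTree hx hI v u).preSeq .plus (gadgetCopy hx hI v u h)))
        rw [decode_copy .plus h (fun _ => hb) htn, hφ' _ htn]
        by_cases hT : h.1 ∈ Γ.top I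
        · rw [decode_preSeq_top hT, hone _ (hI.mem_of_top hT hb)]
          exact (if_pos rfl).symm
        · obtain ⟨e1, e2⟩ := decode_preSeq_copy (hx := hx) (hI := hI) (v := v) (u := u) h
            (fun _ => hb) hT
          rw [e1, hφ _ e2]
      · exact trivial_case (by cases v <;> simp [gadgetTree, gadgetObs, hb])
  · intro n ht hm
    rcases n with _ | K | K | ⟨v, K⟩ | ⟨v, h⟩
    · cases v <;> simp [gadgetTree, gadgetMover] at hm
    · simp [gadgetTree, gadgetMover] at hm
    · simp [gadgetTree, gadgetMover] at hm
    · have := (gadget_deal_mover (hx := hx) (hI := hI) (u := u) K).symm.trans hm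
      simp at this
    · change ¬ (gadgetTree hx hI v u).IsTerminal (gadgetCopy hx hI v u h) at ht
      obtain ⟨hm', hb⟩ := gadget_mover_eq hm
      have hb := hb rfl
      have htn : ¬ Γ.IsTerminal h.1 := fun e => ht (gadget_terminal_copy.2 e)
      refine Eq.trans ?_ (congrArg φ (decode_copy .plus h (fun _ => hb) htn).symm)
      rw [hφ' _ htn, ← hx.flow' htn hm', Finset.sum_div]
      refine gadget_sum' (fun n => gadget_child_copy (n := n) (h := h)) _
        (fun c => x (Γ.at' .plus c) / x (Γ.at' .plus k)) ?_ ?_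
      · intro c hc
        obtain ⟨e1, e2⟩ := decode_preSeq_copy (hx := hx) (hI := hI) (v := v) (u := u)
          (i := .plus) c (fun _ => below_child hb hc) (hI.child_not_top h.2.1 hc)
        rw [e1, hφ _ e2]
      · intro c hc hnk
        exact absurd (kept_child_of_below h.2 hb hc) hnk
  · intro g hg h hA
    have hb : h.1 ∈ Γ.below I := ⟨g, hg, hA⟩
    have hval : φ (decodeSeq ((gadgetTree hx hI v u).seq .plus (gadgetCopy hx hI v u h))) =
        x (Γ.at' .plus h.1) / x (Γ.at' .plus k) := by
      by_cases ht : Γ.IsTerminal h.1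
      · have hT : h.1 ∉ Γ.top I := fun e => e.1 ht
        obtain ⟨e1, e2⟩ := decode_preSeq_copy (hx := hx) (hI := hI) (v := v) (u := u)
          (i := .plus) h (fun _ => hb) hT
        rw [seq_of_terminal (gadget_terminal_copy.2 ht), e1, hφ _ e2]
      · rw [decode_copy .plus h (fun _ => hb) ht, hφ' _ ht]
    change _ = _ * φ (decodeSeq ((gadgetTree hx hI v u).seq .plus (gadgetCopy hx hI v u h)))
    have hgk : x (Γ.at' .plus g) = x (Γ.at' .plus k) := by
      rw [hkI] at hg
      rw [at'_eq hg.2]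
    rw [hval, hgk, mul_div_cancel₀ _ hp.ne']
  · intro h _
    rfl

/-- In a gadget game, the blueprint guarantees a nonnegative value. -/
theorem blueprint_payoff_nonneg {o : Γ.SolveOptions x I}
    (hu : u = Γ.gadgetUtil x I o v) {w : (gadgetTree hx hI v u).Seq .plus → ℝ}
    (hw : (gadgetTree hx hI v u).IsStrategy .plus w) (hc : IsComposite hx hI v u w x)
    {y : (gadgetTree hx hI v u).Seq .minus → ℝ} (hy : (gadgetTree hx hI v u).IsStrategy .minus y) :
    0 ≤ (gadgetTree hx hI v u).payoff w y := by
  rw [gadget_payoff (by rw [hu]; exact fun n => gadget_util_ne_zero o)]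
  refine Finset.sum_nonneg fun n hn => ?_
  obtain ⟨K, rfl⟩ := (Finset.mem_filter.1 hn).2
  have hK := K.2
  obtain ⟨-, k, hk, hkI⟩ := hK
  have hkT := mem_top_of_mem K.2 hk
  have hkk : k ∈ Γ.kept x I := below_kept hI ⟨k, hkI, anc_refl k⟩
  -- The default 0 at nodes without a copy is harmless, because `x` vanishes at those of them that
  -- lie below `K`.
  let Y : Γ.Node → ℝ := fun z => if hz : z ∈ Γ.kept x I then
    y ((gadgetTree hx hI v u).at' .minus (gadgetCopy hx hI v u ⟨z, hz⟩)) else 0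
  have hY : ∀ h : Γ.kept x I, Y h.1 =
      y ((gadgetTree hx hI v u).at' .minus (gadgetCopy hx hI v u h)) := fun h => dif_pos h.2
  rw [hc.sum_deal hw hy K hk (l := o.scale K.1) (a := Γ.infosetValue x k - o.gift K.1) ?_ Y
    fun h _ => hY h]
  swap
  · rintro h ⟨k', hk', hA⟩
    rw [hu, gadget_util_copy hI o hk' hA]
    have : k' ∈ Γ.infoset .minus k := (infoset_eq_of_mem K.2 hk).symm ▸ hk'
    rw [infosetValue_congr x this.2]
  refine mul_nonneg (mul_nonneg (o.scale_pos K.1 K.2).le (gadget_reach_pos _).le) ?_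
  set q := y ((gadgetTree hx hI v u).at' .minus (gadgetDeal hx hI v u K)) with hq
  have hq0 : 0 ≤ q := hy.nonneg _
  have hqk : y ((gadgetTree hx hI v u).at' .minus (gadgetCopy hx hI v u ⟨k, hkk⟩)) = q :=
    hy.child_eq (gadget_deal_child hk) (by rw [gadget_deal_mover]; simp)
  -- The best-response value at `k`, weighted by the probability `q` with which `minus` enters `K`;
  -- subtracting a nonnegative gift from the alternate payoff then only helps `plus`.
  have key : q * cfValue x (Γ.at' .minus k) ≤
      ∑ z with Γ.IsTerminal z ∧ Γ.seq .minus k <:+ Γ.seq .minus z,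
        Γ.util z * Γ.reach z * x (Γ.at' .plus z) * Y z := by
    rcases hq0.eq_or_lt with h0 | hpos
    · rw [← h0, zero_mul]
      refine (Finset.sum_eq_zero fun z hz => ?_).ge
      obtain ⟨hzt, hz'⟩ := (Finset.mem_filter.1 hz).2
      have : Y z = 0 := by
        by_cases hzk : z ∈ Γ.kept x I
        · rw [hY ⟨z, hzk⟩]
          obtain ⟨k', hk', hA⟩ := (seq_suffix_seq_iff hkT.1).1 hz'
          rw [infoset_eq_of_mem K.2 hk] at hk'
          have hA' := ((gadget_anc_deal (hx := hx) (hI := hI) (u := u) (K := K)).2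
            ⟨⟨z, hzk⟩, rfl, hzt, k', hk', hA⟩).2
          exact le_antisymm ((hy.anc_le hA').trans h0.ge) (hy.nonneg _)
        · exact dif_neg hzk
      rw [this, mul_zero]
    -- Conditioned on `K`, the gadget strategy becomes a strategy of the original game that plays
    -- the sequence at `k` with certainty, so it competes in the minimum that defines the value at
    -- `k`.
    · obtain ⟨y₀, hy₀, h1⟩ := exists_strategy_reaching (Γ.at' .minus k)
      obtain ⟨y', hy', -, hval⟩ := gadget_pullback (k₀ := ⟨k, hkk⟩) hkT (by simp) hy₀ hy
        (by rw [hqk]; exact hpos)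
      rw [hqk, h1] at hval
      have h1' : y' (Γ.at' .minus k) = 1 := by
        rw [hval ⟨k, hkk⟩ List.suffix_rfl, hqk, div_self hpos.ne', mul_one]
      refine (mul_le_mul_of_nonneg_left (cfValue_le x hy' h1') hq0).trans_eq ?_
      rw [cfSum, Finset.mul_sum]
      refine Finset.sum_congr rfl fun z hz => ?_
      obtain ⟨hzt, hz'⟩ := (Finset.mem_filter.1 hz).2
      by_cases hzk : z ∈ Γ.kept x I
      · rw [hval ⟨z, hzk⟩ hz', hY ⟨z, hzk⟩]
        field_simp
      · obtain ⟨k', hk', hA⟩ := (seq_suffix_seq_iff hkT.1).1 hz'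
        rw [infoset_eq_of_mem K.2 hk] at hk'
        rw [hc.eq_zero (mem_top_of_mem K.2 hk') hA hzk]
        ring
  have hm : 0 < Γ.mass x K.1 := mass_pos hx hk (hI.2 k hkI)
  have h2 := mul_le_mul_of_nonneg_left key (inv_nonneg.2 hm.le)
  rw [← mass_mul_infosetValue hx hkT.1, infoset_eq_of_mem K.2 hk] at h2
  have h3 : (Γ.mass x K.1)⁻¹ * (q * (Γ.mass x K.1 * Γ.infosetValue x k)) =
      q * Γ.infosetValue x k := by field_simp
  have h4 := mul_nonneg (o.gift_nonneg K.1 K.2) hq0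
  have h5 : (Γ.infosetValue x k - o.gift K.1) * q = q * Γ.infosetValue x k - o.gift K.1 * q := by
    ring
  rw [h3] at h2
  change 0 ≤ _ - (Γ.infosetValue x k - o.gift K.1) * q
  rw [h5]
  have h6 : ∑ z with Γ.IsTerminal z ∧ (Γ.at' .minus k).1 <:+ Γ.seq .minus z,
        Γ.util z * Γ.reach z * x (Γ.at' .plus z) * Y z =
      ∑ z with Γ.IsTerminal z ∧ Γ.seq .minus k <:+ Γ.seq .minus z,
        Γ.util z * Γ.reach z * x (Γ.at' .plus z) * Y z := rfl
  linarith

end gadgetStrategies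

end GameTree

/-! ### Opponent strategies of the original game, conditioned on one infoset, inside the gadget
game. -/

namespace GameTree

section conditional

variable {Γ : Game} {x : Γ.Seq .plus → ℝ} {I : Set Γ.Node}
  {hx : Γ.IsStrategy .plus x} {hI : Γ.CanSolve x I} {v : GadgetKind}
  {u : GadgetNode (Γ.oppInfosets I) (Γ.kept x I) v → ℝ}

theorem gadget_depth_deal_lt (K : Γ.oppInfosets I) (h : Γ.kept x I) :
    depth (gadgetDeal hx hI v u K) < depth (gadgetCopy hx hI v u h) := by
  refine kept_induction hx hI (P := fun h =>
    depth (gadgetDeal hx hI v u K) < depth (gadgetCopy hx hI v u h)) ?_ ?_ h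
  · intro h ht
    rw [depth_child (gadget_deal_child (K := oppInfoset hI ht) ⟨ht.1, rfl⟩),
      gadget_depth_deal K (oppInfoset hI ht)]
    exact Nat.lt_succ_self _
  · intro g c hc ih
    rw [depth_child (gadget_child_copy.2 ⟨c, rfl, hc⟩)]
    omega

theorem gadget_depth_choice {u : GadgetNode (Γ.oppInfosets I) (Γ.kept x I) .resolving → ℝ}
    (K : Γ.oppInfosets I) : depth (gadgetChoice hx hI u K) = 1 := by
  rw [depth_child ⟨_, gadget_parent_choice K⟩, depth_root]

theorem gadget_depth_exit {u : GadgetNode (Γ.oppInfosets I) (Γ.kept x I) .resolving → ℝ}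
    (K : Γ.oppInfosets I) : depth (gadgetExit hx hI u K) = 2 := by
  rw [depth_child ⟨_, gadget_parent_exit' K⟩, gadget_depth_choice]

theorem gadget_depth_deal_resolving {u : GadgetNode (Γ.oppInfosets I) (Γ.kept x I) .resolving → ℝ}
    (K : Γ.oppInfosets I) : depth (gadgetDeal hx hI .resolving u K) = 2 := by
  rw [depth_child ⟨_, gadget_parent_deal_resolving K⟩, gadget_depth_choice]

theorem gadget_depth_deal_maxmargin {u : GadgetNode (Γ.oppInfosets I) (Γ.kept x I) .maxmargin → ℝ}
    (K : Γ.oppInfosets I) : depth (gadgetDeal hx hI .maxmargin u K) = 1 := by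
  rw [depth_child ⟨_, gadget_parent_deal_maxmargin K⟩, depth_root]

/-- Unlike `plus`, `minus` knows the start infoset: her own choice at the root or her observation at
`choice K` records it. -/
theorem gadget_deal_inj {K K' : Γ.oppInfosets I}
    (e : (gadgetTree hx hI v u).preSeq .minus (gadgetDeal hx hI v u K) =
      (gadgetTree hx hI v u).preSeq .minus (gadgetDeal hx hI v u K')) : K = K' := by
  cases v
  · rw [gadget_preSeq_deal_minus_maxmargin, gadget_preSeq_deal_minus_maxmargin] at e
    refine Subtype.ext ?_
    have h1 := (List.cons.inj e).1
    exact GadgetAct.pick.inj (Sum.inr.inj h1)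
  · rw [gadget_preSeq_deal_minus_resolving, gadget_preSeq_deal_minus_resolving] at e
    refine Subtype.ext ?_
    have h1 := (List.cons.inj (List.cons.inj e).2).1
    exact GadgetObs.choose.inj (Sum.inl.inj h1)

theorem gadget_exit_inj {u : GadgetNode (Γ.oppInfosets I) (Γ.kept x I) .resolving → ℝ}
    {K K' : Γ.oppInfosets I}
    (e : (gadgetTree hx hI .resolving u).preSeq .minus (gadgetExit hx hI u K) =
      (gadgetTree hx hI .resolving u).preSeq .minus (gadgetExit hx hI u K')) : K = K' := by
  rw [gadget_preSeq_exit_minus, gadget_preSeq_exit_minus] at e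
  refine Subtype.ext ?_
  have h1 := (List.cons.inj (List.cons.inj e).2).1
  exact GadgetObs.choose.inj (Sum.inl.inj h1)

theorem gadget_exit_ne_deal {u : GadgetNode (Γ.oppInfosets I) (Γ.kept x I) .resolving → ℝ}
    {K K' : Γ.oppInfosets I} : (gadgetTree hx hI .resolving u).preSeq .minus (gadgetExit hx hI u K) ≠
      (gadgetTree hx hI .resolving u).preSeq .minus (gadgetDeal hx hI .resolving u K') := by
  rw [gadget_preSeq_exit_minus, gadget_preSeq_deal_minus_resolving]
  intro e
  have h1 := (List.cons.inj e).1
  cases Sum.inr.inj h1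

/-- Copied nodes with equal sequences of `minus` are copies of nodes with equal sequences. -/
theorem gadget_preSeq_copy_minus {h h' : Γ.kept x I}
    (e : (gadgetTree hx hI v u).preSeq .minus (gadgetCopy hx hI v u h) =
      (gadgetTree hx hI v u).preSeq .minus (gadgetCopy hx hI v u h')) :
    Γ.at' .minus h.1 = Γ.at' .minus h'.1 ∧ h.1 ∈ Γ.top I ∧ h'.1 ∈ Γ.top I ∨
    h.1 ∉ Γ.top I ∧ h'.1 ∉ Γ.top I ∧ Γ.pre .minus h.1 = Γ.pre .minus h'.1 := by
  -- Decoding yields the empty list just before start nodes and a nonempty one further below, which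
  -- excludes the mixed cases.
  have e' := congrArg decodeSeq e
  by_cases ht : h.1 ∈ Γ.top I <;> by_cases ht' : h'.1 ∈ Γ.top I
  · left
    rw [gadget_preSeq_top (K := oppInfoset hI ht) ⟨ht.1, rfl⟩,
      gadget_preSeq_top (K := oppInfoset hI ht') ⟨ht'.1, rfl⟩] at e
    have := gadget_deal_inj (seq_inj (gadget_deal_not_terminal _) (gadget_deal_not_terminal _) e).2
    have h1 : h.1 ∈ (oppInfoset hI ht).1 := ⟨ht.1, rfl⟩
    rw [this] at h1
    exact ⟨at'_eq h1.2, ht, ht'⟩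
  · obtain ⟨e1, e2⟩ := decode_preSeq_copy (hx := hx) (hI := hI) (v := v) (u := u) (i := .minus) h'
      (by simp) ht'
    rw [decode_preSeq_top ht] at e'
    exact absurd (e1.symm.trans e'.symm) e2
  · obtain ⟨e1, e2⟩ := decode_preSeq_copy (hx := hx) (hI := hI) (v := v) (u := u) (i := .minus) h
      (by simp) ht
    rw [decode_preSeq_top ht'] at e'
    exact absurd (e1.symm.trans e') e2
  · right
    obtain ⟨e1, -⟩ := decode_preSeq_copy (hx := hx) (hI := hI) (v := v) (u := u) (i := .minus) h
      (by simp) ht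
    obtain ⟨e2, -⟩ := decode_preSeq_copy (hx := hx) (hI := hI) (v := v) (u := u) (i := .minus) h'
      (by simp) ht'
    exact ⟨ht, ht', Subtype.ext (e1.symm.trans (e'.trans e2))⟩

/-- A strategy of `minus` conditioned on having reached an infoset, as a strategy in the gadget
game. -/
theorem gadget_exists_conditional (K : Γ.oppInfosets I) {k : Γ.Node} (hk : k ∈ K.1)
    {y : Γ.Seq .minus → ℝ} (hy : Γ.IsStrategy .minus y) (hpos : 0 < y (Γ.at' .minus k)) :
    ∃ y', (gadgetTree hx hI v u).IsStrategy .minus y' ∧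
      (∀ K', y' ((gadgetTree hx hI v u).at' .minus (gadgetDeal hx hI v u K')) =
        if K' = K then 1 else 0) ∧
      ∀ h : Γ.kept x I, Γ.seq .minus k <:+ Γ.seq .minus h.1 →
        y' ((gadgetTree hx hI v u).at' .minus (gadgetCopy hx hI v u h)) =
          y (Γ.at' .minus h.1) / y (Γ.at' .minus k) := by
  have hkT := mem_top_of_mem K.2 hk
  -- The conditional probability below `K`; below the other start infosets, `minus` is never
  -- present.
  let c : Γ.kept x I → ℝ := fun h => if Γ.seq .minus k <:+ Γ.seq .minus h.1 then
    y (Γ.at' .minus h.1) / y (Γ.at' .minus k) else 0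
  have hc0 : ∀ h, 0 ≤ c h := by
    intro h
    simp only [c]
    split_ifs
    · exact div_nonneg (hy.nonneg _) hpos.le
    · exact le_rfl
  have hctop : ∀ h : Γ.kept x I, h.1 ∈ Γ.top I → c h = if h.1 ∈ K.1 then 1 else 0 := by
    intro h ht
    have hiff : Γ.seq .minus k <:+ Γ.seq .minus h.1 ↔ h.1 ∈ K.1 := by
      rw [← infoset_eq_of_mem K.2 hk]
      constructor
      · intro hs
        refine ⟨ht.1, (seq_eq_of_suffix hkT.1 ht.1 (hI.depth_top' hkT ht) hs List.suffix_rfl).symm⟩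
      · intro hm
        rw [hm.2]
    simp only [c, hiff]
    split_ifs with hh
    · rw [← infoset_eq_of_mem K.2 hk] at hh
      rw [at'_eq hh.2, div_self hpos.ne']
    · rfl
  -- A child of a copied node is never a start node, so both lie below `K` or neither does.
  have hchild : ∀ g d : Γ.kept x I, Γ.IsChild g.1 d.1 →
      (Γ.seq .minus k <:+ Γ.seq .minus d.1 ↔ Γ.seq .minus k <:+ Γ.seq .minus g.1) := by
    intro g d hgd
    refine ⟨fun hs => ?_, fun hs => hs.trans (Anc.of_child hgd).seq_suffix⟩
    obtain ⟨k', hk', hA⟩ := (seq_suffix_seq_iff hkT.1).1 hs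
    rw [infoset_eq_of_mem K.2 hk] at hk'
    have hgd' := hgd
    obtain ⟨a, ha⟩ := hgd'
    refine (seq_suffix_seq_iff hkT.1).2 ⟨k', ?_, anc_parent hA ?_ ha⟩
    · rwa [infoset_eq_of_mem K.2 hk]
    · rintro e
      exact hI.child_not_top g.2.1 hgd (e ▸ mem_top_of_mem K.2 hk')
  -- `minus` picks `K` at the root of a maxmargin game; in a resolving game she plays on at `K` and
  -- exits everywhere else.
  let f : (gadgetTree hx hI v u).Node → ℝ := fun n => match n with
    | .root _ => 1
    | .choice _ => 1
    | .exit K' => if K' = K then 0 else 1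
    | .deal _ K' => if K' = K then 1 else 0
    | .copy _ h => c h
  suffices hex : ∃ y', (gadgetTree hx hI v u).IsStrategy .minus y' ∧
      ∀ n, y' ((gadgetTree hx hI v u).at' .minus n) = f n by
    obtain ⟨y', hy', hf⟩ := hex
    exact ⟨y', hy', fun K' => hf _, fun h hh => (hf _).trans (if_pos hh)⟩
  have hcopy : ∀ h h' : Γ.kept x I,
      (gadgetTree hx hI v u).preSeq .minus (gadgetCopy hx hI v u h) =
      (gadgetTree hx hI v u).preSeq .minus (gadgetCopy hx hI v u h') → c h = c h' := by
    intro h h' e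
    have hnt : ∀ h : Γ.kept x I, h.1 ∉ Γ.top I →
        (Γ.seq .minus k <:+ Γ.seq .minus h.1 ↔ Γ.seq .minus k <:+ Γ.preSeq .minus h.1) := by
      intro h ht
      refine ⟨fun hs => ?_, fun hs => hs.trans (preSeq_suffix_seq _)⟩
      obtain ⟨k', hk', hA⟩ := (seq_suffix_seq_iff hkT.1).1 hs
      rw [← hk'.2]
      refine hA.seq_suffix_preSeq ?_
      rintro rfl
      rw [infoset_eq_of_mem K.2 hk] at hk'
      exact ht (mem_top_of_mem K.2 hk')
    rcases gadget_preSeq_copy_minus e with ⟨e', ht, ht'⟩ | ⟨ht, ht', e'⟩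
    · have e2 : Γ.seq .minus h.1 = Γ.seq .minus h'.1 := congrArg Subtype.val e'
      simp only [c, e', e2]
    · have e2 : y (Γ.at' .minus h.1) = y (Γ.at' .minus h'.1) := by
        rw [hy.observe, hy.observe, e']
      have e3 : Γ.preSeq .minus h.1 = Γ.preSeq .minus h'.1 := congrArg Subtype.val e'
      simp only [c, e2, hnt h ht, hnt h' ht', e3]
  refine exists_strategy_of_node ?_ rfl ?_ ?_ ?_
  · intro n
    rcases n with _ | K' | K' | ⟨v, K'⟩ | ⟨v, h⟩
    · exact zero_le_one
    · exact zero_le_one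
    · change (0 : ℝ) ≤ if K' = K then 0 else 1
      split_ifs <;> norm_num
    · change (0 : ℝ) ≤ if K' = K then 1 else 0
      split_ifs <;> norm_num
    · exact hc0 h
  · intro n n' e
    -- Equal sequences force equal depths, and depth separates the kinds of nodes, except for `exit`
    -- and `deal`, which the last action tells apart.
    have hd := depth_eq_of_preSeq e
    have hroot : depth (Γ := gadgetTree hx hI v u) (GadgetNode.root v) = 0 := depth_root
    cases v
    · have hD : ∀ K', depth (Γ := gadgetTree hx hI .maxmargin u) (GadgetNode.deal .maxmargin K') = 1 :=
        gadget_depth_deal_maxmargin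
      have hL : ∀ h, 1 < depth (Γ := gadgetTree hx hI .maxmargin u) (GadgetNode.copy .maxmargin h) :=
        fun h => (hD K).symm.trans_lt (gadget_depth_deal_lt K h)
      rcases n with _ | _ | _ | ⟨_, K'⟩ | ⟨_, h⟩ <;> rcases n' with _ | _ | _ | ⟨_, K''⟩ | ⟨_, h'⟩
      case root.root => rfl
      case deal.deal => rw [gadget_deal_inj e]
      case copy.copy => exact hcopy h h' e
      all_goals
        exfalso
        try have h1 := hL h
        try have h2 := hL h'
        try have h3 := hD K'
        try have h4 := hD K''
        omega
    · have hD : ∀ K', depth (Γ := gadgetTree hx hI .resolving u) (GadgetNode.deal .resolving K') = 2 :=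
        gadget_depth_deal_resolving
      have hC : ∀ K', depth (Γ := gadgetTree hx hI .resolving u) (GadgetNode.choice K') = 1 :=
        gadget_depth_choice
      have hE : ∀ K', depth (Γ := gadgetTree hx hI .resolving u) (GadgetNode.exit K') = 2 :=
        gadget_depth_exit
      have hL : ∀ h, 2 < depth (Γ := gadgetTree hx hI .resolving u) (GadgetNode.copy .resolving h) :=
        fun h => (hD K).symm.trans_lt (gadget_depth_deal_lt K h)
      rcases n with _ | K' | K' | ⟨_, K'⟩ | ⟨_, h⟩ <;>
        rcases n' with _ | K'' | K'' | ⟨_, K''⟩ | ⟨_, h'⟩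
      case root.root => rfl
      case choice.choice => rfl
      case exit.exit => rw [gadget_exit_inj e]
      case exit.deal => exact absurd e gadget_exit_ne_deal
      case deal.exit => exact absurd e.symm gadget_exit_ne_deal
      case deal.deal => rw [gadget_deal_inj e]
      case copy.copy => exact hcopy h h' e
      all_goals
        exfalso
        try have h1 := hL h
        try have h2 := hL h'
        try have h3 := hD K'
        try have h4 := hD K''
        try have h5 := hC K'
        try have h6 := hC K''
        try have h7 := hE K'
        try have h8 := hE K''
        omega
  · intro n n' hc hm
    obtain ⟨b, hb⟩ := hc
    rcases n' with _ | K' | K' | ⟨_, K'⟩ | ⟨_, h⟩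
    · exact absurd hb (by simp [gadgetTree, gadgetParent])
    · have := (isChild_unique ⟨_, hb⟩ ⟨_, gadget_parent_choice K'⟩)
      rw [this]
      rfl
    · have := (isChild_unique ⟨_, hb⟩ ⟨_, gadget_parent_exit' K'⟩)
      rw [this] at hm
      exact absurd (gadget_choice_mover K') hm
    · cases v
      · have := (isChild_unique ⟨_, hb⟩ ⟨_, gadget_parent_deal_maxmargin K'⟩)
        rw [this] at hm
        exact absurd rfl hm
      · have := (isChild_unique ⟨_, hb⟩ ⟨_, gadget_parent_deal_resolving K'⟩)
        rw [this] at hm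
        exact absurd (gadget_choice_mover K') hm
    · change c h = f n
      by_cases ht : h.1 ∈ Γ.top I
      · have := isChild_unique ⟨_, hb⟩
          (gadget_deal_child (K := oppInfoset hI ht) (h := h) ⟨ht.1, rfl⟩)
        rw [this, hctop h ht]
        change _ = if oppInfoset hI ht = K then (1 : ℝ) else 0
        refine if_congr ?_ rfl rfl
        constructor
        · intro hh
          exact Subtype.ext (infoset_eq_of_mem K.2 hh)
        · rintro rfl
          exact ⟨ht.1, rfl⟩
      · obtain ⟨⟨g, a⟩, ha⟩ := kept_parent hx hI h.2 ht
        have hgh : Γ.IsChild g.1 h.1 := ⟨a, ha⟩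
        have := isChild_unique ⟨_, hb⟩
          (gadget_child_copy.2 ⟨h, rfl, hgh⟩ : (gadgetTree hx hI v u).IsChild
            (gadgetCopy hx hI v u g) (gadgetCopy hx hI v u h))
        rw [this] at hm ⊢
        change c h = c g
        rw [ne_eq, gadget_mover_copy_iff (by simp)] at hm
        simp only [c, hchild g h hgh, hy.child_eq hgh hm]
  · intro n ht hm
    rcases n with _ | K' | K' | ⟨_, K'⟩ | ⟨_, h⟩
    · cases v
      · rw [Finset.sum_eq_single_of_mem (gadgetDeal hx hI .maxmargin u K)]
        · exact if_pos rfl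
        · exact Finset.mem_filter.2 ⟨Finset.mem_univ _, _, gadget_parent_deal_maxmargin K⟩
        · intro n hn hne
          obtain ⟨b, hb⟩ := (Finset.mem_filter.1 hn).2
          rcases n with _ | K' | K' | ⟨_, K'⟩ | ⟨_, h⟩
          · exact absurd hb (by simp [gadgetTree, gadgetParent])
          · refine if_neg ?_
            rintro rfl
            exact hne rfl
          · rcases gadgetParent_copy (hx := hx) (hI := hI) (v := .maxmargin) h
              with ⟨_, h1⟩ | ⟨_, _, _, _, h1⟩ <;>
              cases h1.symm.trans hb
      · simp [gadgetTree, gadgetMover] at hm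
    · have hne : gadgetExit hx hI u K' ≠ gadgetDeal hx hI .resolving u K' := by
        intro e
        cases e
      rw [show (Finset.univ.filter fun n =>
          (gadgetTree hx hI .resolving u).IsChild (GadgetNode.choice K') n) =
        {gadgetExit hx hI u K', gadgetDeal hx hI .resolving u K'} from ?_, Finset.sum_pair hne]
      · change (if K' = K then (0 : ℝ) else 1) + (if K' = K then 1 else 0) = 1
        split_ifs <;> norm_num
      · ext n
        rw [Finset.mem_filter, Finset.mem_insert, Finset.mem_singleton]
        constructor
        · rintro ⟨-, b, hb⟩
          rcases n with _ | K' | K' | ⟨_, K'⟩ | ⟨_, h⟩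
          · exact absurd hb (by simp [gadgetTree, gadgetParent])
          · cases hb
          · have := isChild_unique ⟨_, hb⟩ ⟨_, gadget_parent_exit' K'⟩
            cases this
            exact Or.inl rfl
          · have := isChild_unique ⟨_, hb⟩ ⟨_, gadget_parent_deal_resolving K'⟩
            cases this
            exact Or.inr rfl
          · rcases gadgetParent_copy (hx := hx) (hI := hI) (v := .resolving) h
              with ⟨_, h1⟩ | ⟨_, _, _, _, h1⟩ <;>
              cases h1.symm.trans hb
        · rintro (rfl | rfl)
          · exact ⟨Finset.mem_univ _, _, gadget_parent_exit' K'⟩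
          · exact ⟨Finset.mem_univ _, _, gadget_parent_deal_resolving K'⟩
    · simp [gadgetTree, gadgetMover] at hm
    · have := (gadget_deal_mover (hx := hx) (hI := hI) (u := u) K').symm.trans hm
      simp at this
    · change ¬ (gadgetTree hx hI v u).IsTerminal (gadgetCopy hx hI v u h) at ht
      rw [gadget_terminal_copy] at ht
      have hm' := (gadget_mover_eq hm).1
      -- The prefix condition is frozen at the parent `h`; by `hchild` it is the same at all
      -- children, so only the flow of `y` remains.
      let C : Γ.Node → ℝ := fun d => if Γ.seq .minus k <:+ Γ.seq .minus h.1 then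
        y (Γ.at' .minus d) / y (Γ.at' .minus k) else 0
      refine (gadget_sum' (fun n => gadget_child_copy (n := n) (h := h)) f C ?_ ?_).trans ?_
      · intro d hd
        change c d = _
        simp only [c, C, hchild h d hd]
      · intro d hd hdk
        exact absurd (kept_child_of_mover hx h.2 (by rw [hm']; simp) hd) hdk
      · change _ = c h
        simp only [c, C]
        split_ifs
        · rw [← Finset.sum_div, hy.flow' ht hm']
        · exact Finset.sum_const_zero

end conditional

end GameTree

/-! ### Safety: a single solve preserves the guaranteed value. -/

namespace GameTree

section equilibrium

variable {Γ : Game} {x : Γ.Seq .plus → ℝ} {I : Set Γ.Node}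
  {hx : Γ.IsStrategy .plus x} {hI : Γ.CanSolve x I} {v : GadgetKind}
  {u : GadgetNode (Γ.oppInfosets I) (Γ.kept x I) v → ℝ}

/-- A nonnegative value in a gadget game means nonnegative margins at all infosets where the
gadget game starts. -/
theorem IsComposite.margin {o : Γ.SolveOptions x I} (hu : u = Γ.gadgetUtil x I o v)
    {w : (gadgetTree hx hI v u).Seq .plus → ℝ} {X : Γ.Seq .plus → ℝ}
    (hw : (gadgetTree hx hI v u).IsStrategy .plus w) (hX : IsComposite hx hI v u w X)
    (hnn : ∀ y, (gadgetTree hx hI v u).IsStrategy .minus y → 0 ≤ (gadgetTree hx hI v u).payoff w y)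
    (K : Γ.oppInfosets I) {k : Γ.Node} (hk : k ∈ K.1) {y : Γ.Seq .minus → ℝ}
    (hy : Γ.IsStrategy .minus y) :
    y (Γ.at' .minus k) * (Γ.mass x K.1 * (Γ.infosetValue x k - o.gift K.1)) ≤
      cfSum X (Γ.at' .minus k) y := by
  have hkT := mem_top_of_mem K.2 hk
  rcases (hy.nonneg (Γ.at' .minus k)).eq_or_lt with h0 | hpos
  · rw [← h0, zero_mul, cfSum]
    refine (Finset.sum_eq_zero fun z hz => ?_).ge
    have hle := hy.le_of_suffix (Finset.mem_filter.1 hz).2.2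
    rw [le_antisymm (hle.trans h0.ge) (hy.nonneg _), mul_zero]
  -- With this opponent, all other start infosets contribute 0, and the nonnegative gadget payoff
  -- becomes the margin at `K` alone, up to positive factors.
  obtain ⟨y', hy', hdeal, hcopy⟩ := gadget_exists_conditional (hx := hx) (hI := hI) (u := u) K hk
    hy hpos
  have h1 := hnn y' hy'
  rw [gadget_payoff (by rw [hu]; exact fun n => gadget_util_ne_zero o),
    Finset.sum_eq_single_of_mem (gadgetDeal hx hI v u K)
      (Finset.mem_filter.2 ⟨Finset.mem_univ _, K, rfl⟩)] at h1
  · have hm : 0 < Γ.mass x K.1 := by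
      obtain ⟨-, k', hk', hkI⟩ := K.2
      exact mass_pos hx hk' (hI.2 k' hkI)
    rw [hX.sum_deal hw hy' K hk (l := o.scale K.1) (a := Γ.infosetValue x k - o.gift K.1) ?_
      (fun z => y (Γ.at' .minus z) / y (Γ.at' .minus k)) ?_, hdeal, if_pos rfl, mul_one] at h1
    · have h2 := nonneg_of_mul_nonneg_right h1
        (mul_pos (o.scale_pos K.1 K.2) (gadget_reach_pos (gadgetDeal hx hI v u K)))
      have h3 : ∑ z with Γ.IsTerminal z ∧ Γ.seq .minus k <:+ Γ.seq .minus z,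
          Γ.util z * Γ.reach z * X (Γ.at' .plus z) * (y (Γ.at' .minus z) / y (Γ.at' .minus k)) =
          cfSum X (Γ.at' .minus k) y / y (Γ.at' .minus k) := by
        rw [cfSum, Finset.sum_div]
        exact Finset.sum_congr rfl fun z _ => by ring
      rw [h3, sub_nonneg, ← div_eq_inv_mul, le_div_iff₀ hm, le_div_iff₀ hpos] at h2
      linarith
    · rintro h ⟨k', hk', hA⟩
      rw [hu, gadget_util_copy hI o hk' hA]
      have : k' ∈ Γ.infoset .minus k := (infoset_eq_of_mem K.2 hk).symm ▸ hk'
      rw [infosetValue_congr x this.2]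
    · rintro h ⟨k', hk', hA⟩
      refine (hcopy h ?_).symm
      refine (seq_suffix_seq_iff hkT.1).2 ⟨k', ?_, hA⟩
      rwa [infoset_eq_of_mem K.2 hk]
  · intro n hn hne
    obtain ⟨K', rfl⟩ := (Finset.mem_filter.1 hn).2
    have hz : y' ((gadgetTree hx hI v u).at' .minus (gadgetDeal hx hI v u K')) = 0 := by
      rw [hdeal, if_neg]
      rintro rfl
      exact hne rfl
    refine Finset.sum_eq_zero fun m hm => ?_
    have hle := hy'.anc_le (Finset.mem_filter.1 hm).2.2
    rw [hz] at hle
    rw [prob, le_antisymm hle (hy'.nonneg _), mul_zero, mul_zero]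

theorem payoff_eq_sum_prob (Γ : GameTree) (x : Γ.Seq .plus → ℝ) (y : Γ.Seq .minus → ℝ) :
    Γ.payoff x y = ∑ z with Γ.IsTerminal z, prob x y z * Γ.util z :=
  Finset.sum_congr rfl fun z _ => by rw [prob]; ring

/-- The margins bound the loss of value at an infoset. -/
theorem IsComposite.sum_potential_le_cfSum {o : Γ.SolveOptions x I} (hu : u = Γ.gadgetUtil x I o v)
    {w : (gadgetTree hx hI v u).Seq .plus → ℝ} {X : Γ.Seq .plus → ℝ}
    (hw : (gadgetTree hx hI v u).IsStrategy .plus w) (hX : IsComposite hx hI v u w X)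
    (hnn : ∀ y, (gadgetTree hx hI v u).IsStrategy .minus y → 0 ≤ (gadgetTree hx hI v u).payoff w y)
    {k k₀ : Γ.Node} (hk₀ : k₀ ∈ I) (ht : ¬ Γ.IsTerminal k) (hd : depth k = depth k₀)
    {y : Γ.Seq .minus → ℝ} (hy : Γ.IsStrategy .minus y) :
    ∑ h with h ∈ Γ.infoset .minus k, prob x y h * potential x h ≤ cfSum X (Γ.at' .minus k) y := by
  have hprob : ∀ h ∈ Γ.infoset .minus k, ∀ c, Γ.infosetValue x k - Γ.totalMistake x h ≤ c →
      prob x y h * potential x h ≤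
        y (Γ.at' .minus k) * c * (Γ.reach h * x (Γ.at' .plus h)) := by
    intro h hh c hc
    have hp : potential x h = Γ.infosetValue x k - Γ.totalMistake x h := by
      rw [potential, if_neg hh.1, infosetValue_congr x hh.2]
    rw [hp]
    refine (mul_le_mul_of_nonneg_left hc (prob_nonneg hx hy h)).trans_eq ?_
    rw [prob, at'_eq hh.2]
    ring
  have hsum : ∀ c, (∀ h ∈ Γ.infoset .minus k, Γ.infosetValue x k - Γ.totalMistake x h ≤ c) →
      ∑ h with h ∈ Γ.infoset .minus k, prob x y h * potential x h ≤
        y (Γ.at' .minus k) * (Γ.mass x (Γ.infoset .minus k) * c) := by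
    intro c hc
    refine (Finset.sum_le_sum fun h hh => hprob h (Finset.mem_filter.1 hh).2 c
      (hc h (Finset.mem_filter.1 hh).2)).trans_eq ?_
    rw [← Finset.mul_sum, mass]
    ring
  by_cases hK : Γ.infoset .minus k ∈ Γ.oppInfosets I
  -- An infoset that meets `I`: the gift is at most the errors subtracted in the potential, so the
  -- margin suffices.
  · refine (hsum _ fun h hh => ?_).trans (hX.margin hu hw hnn ⟨_, hK⟩ ⟨ht, rfl⟩ hy)
    exact sub_le_sub_left (o.gift_le _ hK h hh) _
  -- An infoset that misses `I`: the errors are simply dropped, and the best-response value of `x`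
  -- applies, as nothing below has changed.
  · refine (hsum _ fun h _ => sub_le_self _ (totalMistake_nonneg hx h)).trans ?_
    rw [mass_mul_infosetValue hx ht]
    refine (mul_cfValue_le x _ hy).trans_eq ?_
    refine Finset.sum_congr rfl fun z hz => ?_
    obtain ⟨-, hz⟩ := (Finset.mem_filter.1 hz).2
    rw [hX.outside z]
    -- If a terminal node lay in Ī too, its ancestors in `I` and in this infoset would have the same
    -- depth and hence coincide.
    rintro ⟨g, hg, hA⟩
    obtain ⟨h, hh, hA'⟩ := (seq_suffix_seq_iff ht).1 hz
    have hdh : depth h = depth g := by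
      rw [depth_eq' hh.1 ht hh.2, hd]
      exact hI.depth_top' (hI.mem_top hk₀) (hI.mem_top hg)
    obtain rfl := hA'.eq_of_depth hA hdh
    exact hK ⟨⟨k, ht, rfl⟩, h, hh, hg⟩

/-- Combining a strategy with nonnegative value in a gadget game with the blueprint preserves the
guaranteed value. -/
theorem IsComposite.le_payoff {o : Γ.SolveOptions x I} (hu : u = Γ.gadgetUtil x I o v)
    {w : (gadgetTree hx hI v u).Seq .plus → ℝ} {X : Γ.Seq .plus → ℝ}
    (hw : (gadgetTree hx hI v u).IsStrategy .plus w) (hX : IsComposite hx hI v u w X)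
    (hnn : ∀ y, (gadgetTree hx hI v u).IsStrategy .minus y → 0 ≤ (gadgetTree hx hI v u).payoff w y)
    {a : ℝ} (ha : ∀ y, Γ.IsStrategy .minus y → a ≤ Γ.payoff x y)
    {y : Γ.Seq .minus → ℝ} (hy : Γ.IsStrategy .minus y) : a ≤ Γ.payoff X y := by
  obtain ⟨k₀, hk₀⟩ : ∃ k, k ∈ I := by
    have hI' := hI
    obtain ⟨⟨k, hkt, -, hkI⟩, -⟩ := hI'
    exact ⟨k, hkI ▸ ⟨hkt, rfl⟩⟩
  have hd : ∀ k ∈ I, depth k = depth k₀ := fun k hk =>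
    hI.depth_top' (hI.mem_top hk) (hI.mem_top hk₀)
  have hr : ¬ Γ.IsTerminal Γ.root := by
    intro hr
    obtain ⟨c, hc, -⟩ | h := (anc_root k₀).eq_or_child
    · exact hI.not_terminal hk₀ hr
    · obtain ⟨c, hc, -⟩ := h
      exact hr c hc
  -- The tree is cut at the depth of `I`: utilities collected up to there, potentials at the cut.
  refine (le_sum_potential hx ha hr hy (depth k₀)).trans ?_
  rw [payoff_eq_sum_prob,
    ← Finset.sum_filter_add_sum_filter_not (Finset.univ.filter fun z => Γ.IsTerminal z)
      (fun z => depth z ≤ depth k₀) fun z => prob X y z * Γ.util z,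
    Finset.filter_filter, Finset.filter_filter]
  refine add_le_add ?_ ?_
  · refine Finset.sum_le_sum fun z hz => ?_
    rw [prob, prob, hX.infoset_eq_one hw]
    intro k hk
    rw [hd k hk]
    exact (Finset.mem_filter.1 hz).2.2
  · have e : ∑ z with Γ.IsTerminal z ∧ ¬ depth z ≤ depth k₀, prob X y z * Γ.util z =
        ∑ h with ¬ Γ.IsTerminal h ∧ depth h = depth k₀,
          ∑ z with Γ.IsTerminal z ∧ Γ.Anc h z, prob X y z * Γ.util z := by
      rw [← sum_below (H := fun h => ¬ Γ.IsTerminal h ∧ depth h = depth k₀) (d := depth k₀)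
        fun h hh => hh.2]
      refine Finset.sum_congr (Finset.filter_congr fun z _ => and_congr_right fun hz => ?_)
        fun _ _ => rfl
      constructor
      · intro hlt
        obtain ⟨h, hA, hh⟩ := exists_anc_depth (not_le.1 hlt).le
        refine ⟨h, ⟨hA.not_terminal ?_, hh⟩, hA⟩
        rintro rfl
        exact hlt hh.le
      · rintro ⟨h, ⟨ht, hh⟩, hA⟩ hle
        obtain rfl := anc_eq_of_depth hA (le_antisymm hA.depth_le (hle.trans hh.ge))
        exact ht hz
    rw [e]
    -- At the cut, the comparison is made separately at each infoset of `minus`.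
    refine sum_le_sum_of_fibers _ (fun h => Γ.at' .minus h) _ _ fun k hk => ?_
    have hfib : ∀ n, ((¬ Γ.IsTerminal n ∧ depth n = depth k₀) ∧ Γ.at' .minus n = Γ.at' .minus k) ↔
        n ∈ Γ.infoset .minus k := by
      intro n
      constructor
      · rintro ⟨⟨ht, -⟩, e⟩
        exact ⟨ht, congrArg Subtype.val e⟩
      · intro hn
        exact ⟨⟨hn.1, (depth_eq' hn.1 hk.1 hn.2).trans hk.2⟩, at'_eq hn.2⟩
    rw [Finset.sum_congr (Finset.filter_congr fun n _ => hfib n) fun _ _ => rfl,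
      Finset.sum_congr (Finset.filter_congr fun n _ => hfib n) fun _ _ => rfl]
    refine (hX.sum_potential_le_cfSum hu hw hnn hk₀ hk.1 hk.2 hy).trans_eq ?_
    rw [cfSum_at hk.1]
    refine Finset.sum_congr rfl fun h _ => Finset.sum_congr rfl fun z _ => ?_
    rw [prob]
    ring

/-- An equilibrium strategy of a gadget game, combined with an equilibrium strategy that is used as
the blueprint, is an equilibrium strategy. -/
theorem IsComposite.isNEStrategy {o : Γ.SolveOptions x I} (hu : u = Γ.gadgetUtil x I o v)
    (hne : Γ.IsNEStrategy x)
    {w : (gadgetTree hx hI v u).Seq .plus → ℝ} (hw : (gadgetTree hx hI v u).IsNEStrategy w)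
    {X : Γ.Seq .plus → ℝ} (hXs : Γ.IsStrategy .plus X) (hX : IsComposite hx hI v u w X) :
    Γ.IsNEStrategy X := by
  obtain ⟨y', hws, hy's, hw1, hw2⟩ := hw
  obtain ⟨b, hb, hbc⟩ := exists_blueprint hx hI v u
  -- Against the equilibrium opponent, `w` does at least as well as the blueprint, which gets at
  -- least 0; any other opponent only gives `w` more.
  have hnn : ∀ y, (gadgetTree hx hI v u).IsStrategy .minus y →
      0 ≤ (gadgetTree hx hI v u).payoff w y := fun y hy =>
    (blueprint_payoff_nonneg hu hb hbc hy's).trans ((hw1 b hb).trans (hw2 y hy))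
  obtain ⟨y, -, hy, hx1, hx2⟩ := hne
  have hle := fun z hz => hX.le_payoff hu hws hnn hx2 (y := z) hz
  -- The opponent of the old equilibrium also supports X: X guarantees the value of `x`, and against
  -- `y` nothing exceeds that value.
  exact ⟨y, hXs, hy, fun x' hx' => (hx1 x' hx').trans (hle y hy),
    fun z hz => (hx1 X hXs).trans (hle z hz)⟩

end equilibrium

end GameTree

/-! ### Affine combinations and the nested run. -/

namespace GameTree

theorem isAffineEquilibrium_of_mem_affineSpan {Γ : GameTree} {x : Γ.Seq .plus → ℝ}
    (hx : x ∈ affineSpan ℝ {x | Γ.IsNEStrategy x}) : Γ.IsAffineEquilibrium x := by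
  rw [← Subtype.range_coe (s := {x | Γ.IsNEStrategy x})] at hx
  obtain ⟨s, w, hw, e⟩ := eq_affineCombination_of_mem_affineSpan hx
  rw [s.affineCombination_eq_linear_combination _ _ hw] at e
  refine ⟨s.card, fun j => w (s.equivFin.symm j), fun j => (s.equivFin.symm j).1.1,
    fun j => (s.equivFin.symm j).1.2, ?_, ?_⟩
  · rw [s.equivFin.symm.sum_comp (fun i => w i), s.sum_coe_sort]
    exact hw
  · rw [s.equivFin.symm.sum_comp (fun i => w i • (i.1.1 : Γ.Seq .plus → ℝ)),
      s.sum_coe_sort (fun i => w i • (i.1 : Γ.Seq .plus → ℝ))]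
    exact e

section combination

variable {Γ : Game} {x : Γ.Seq .plus → ℝ} {I : Set Γ.Node}
  {hx : Γ.IsStrategy .plus x} {hI : Γ.CanSolve x I} {v : GadgetKind}
  {u : GadgetNode (Γ.oppInfosets I) (Γ.kept x I) v → ℝ}

/-- An affine equilibrium strategy of a gadget game, combined with the blueprint. -/
theorem exists_affine_composite {o : Γ.SolveOptions x I} (hu : u = Γ.gadgetUtil x I o v)
    (hne : Γ.IsNEStrategy x) {w : (gadgetTree hx hI v u).Seq .plus → ℝ}
    (hw : (gadgetTree hx hI v u).IsAffineEquilibrium w) :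
    ∃ X ∈ affineSpan ℝ {x | Γ.IsNEStrategy x}, (∀ h, X (Γ.at' .plus h) = X (Γ.pre .plus h)) ∧
      IsComposite hx hI v u w X := by
  obtain ⟨n, α, ws, hws, hα, rfl⟩ := hw
  -- Safety is applied to each equilibrium strategy of the combination separately; the combination
  -- itself may fail to be a strategy with a guaranteed value.
  have hex : ∀ j, ∃ X, Γ.IsStrategy .plus X ∧ Γ.IsNEStrategy X ∧ IsComposite hx hI v u (ws j) X := by
    intro j
    have hj := hws j
    obtain ⟨y, hs, -⟩ := hj
    obtain ⟨X, hX, hc⟩ := exists_composite hs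
    exact ⟨X, hX, hc.isNEStrategy hu hne (hws j) hX, hc⟩
  choose X hXs hXne hXc using hex
  refine ⟨∑ j, α j • X j, ?_, ?_, ?_, ?_⟩
  · rw [← Finset.univ.affineCombination_eq_linear_combination _ _ hα]
    refine affineSpan_mono ℝ ?_ (affineCombination_mem_affineSpan hα X)
    rintro _ ⟨j, rfl⟩
    exact hXne j
  · intro h
    simp only [Finset.sum_apply, Pi.smul_apply, (hXs _).observe]
  · intro g hg h hA
    simp only [Finset.sum_apply, Pi.smul_apply, smul_eq_mul, Finset.mul_sum]
    refine Finset.sum_congr rfl fun j _ => ?_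
    rw [(hXc j).inside g hg h hA]
    ring
  -- Outside Ī all the composites equal `x`, and the coefficients add up to 1: this is why affine,
  -- not just linear, combinations are needed.
  · intro h hh
    simp only [Finset.sum_apply, Pi.smul_apply, smul_eq_mul, (hXc _).outside h hh,
      ← Finset.sum_mul, hα, one_mul]

theorem IsDecisionInfoset.mover_eq {i : Player} (hd : Γ.IsDecisionInfoset i I) {h : Γ.Node}
    (hh : h ∈ I) : Γ.mover h = some i := by
  obtain ⟨g, ht, hm, rfl⟩ := hd
  exact mover_eq_of_seq ht hh.1 hh.2.symm hm

end combination

end GameTree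

namespace Game

open GameTree

/-- A node lies below at most one next infoset. -/
theorem IsNext.eq_of_below {Γ : Game} {done I J : Set Γ.Node} (hI : Γ.IsNext done I)
    (hJ : Γ.IsNext done J) {h : Γ.Node} (h1 : h ∈ Γ.below I) (h2 : h ∈ Γ.below J) : I = J := by
  obtain ⟨g, hg, hA⟩ := h1
  obtain ⟨k, hk, hB⟩ := h2
  -- Both entry nodes are ancestors of `h`, hence comparable. If they differed, the upper one, at
  -- which `plus` moves, would have to be among the infosets already done.
  have key : g = k := by
    by_contra hne
    rcases le_total (depth g) (depth k) with hd | hd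
    · exact (hI.2 g hg).1 ((hJ.2 k hk).2 g (hA.of_depth_le hB hd) hne (hI.1.mover_eq hg))
    · exact (hJ.2 k hk).1 ((hI.2 g hg).2 k (hB.of_depth_le hA hd) (Ne.symm hne) (hJ.1.mover_eq hk))
  subst key
  obtain ⟨⟨a, -, -, rfl⟩, -⟩ := hI
  obtain ⟨⟨b, -, -, rfl⟩, -⟩ := hJ
  ext n
  simp only [infoset, Set.mem_ofPred_eq, ← hg.2, ← hk.2]

/-- The statement reproduces itself down the run, because the blueprint passed to a gadget game is
an equilibrium strategy of that game. An arbitrary `done` is allowed for this reason. -/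
theorem KLSSRun.isAffineEquilibrium {Γ : Game} {done : Set Γ.Node} {x x' : Γ.Seq .plus → ℝ}
    (hrun : KLSSRun Γ done x x') (hne : Γ.IsNEStrategy x) : Γ.IsAffineEquilibrium x' := by
  induction hrun with
  | run Γ done x x' hx hx' o sol cont sol_ne nested inside outside ih =>
    -- `V I` is the composite for a next infoset that is reached, and `x` itself for any other set,
    -- so that sums over all sets of nodes can be taken. Members of the affine span need not be
    -- strategies, so their behaviour at observations is recorded as well.
    have hex : ∀ I, ∃ V ∈ affineSpan ℝ {x | Γ.IsNEStrategy x},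
        (∀ h, V (Γ.at' .plus h) = V (Γ.pre .plus h)) ∧
        (∀ hN : Γ.IsNext done I, ∀ hI : Γ.CanSolve x I,
          (∀ h ∈ Γ.below I, V (Γ.at' .plus h) = x' (Γ.at' .plus h)) ∧
          ∀ h, h ∉ Γ.below I → V (Γ.at' .plus h) = x (Γ.at' .plus h)) ∧
        (¬ (Γ.IsNext done I ∧ Γ.CanSolve x I) → V = x) := by
      intro I
      by_cases hI : Γ.IsNext done I ∧ Γ.CanSolve x I
      · obtain ⟨V, hV, hobs, hc⟩ := exists_affine_composite (o := o I hI.1 hI.2) rfl hne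
          (ih I hI.1 hI.2 (sol_ne I hI.1 hI.2))
        refine ⟨V, hV, hobs, fun _ _ => ⟨?_, hc.outside⟩, fun hn => absurd hI hn⟩
        rintro h ⟨g, hg, hA⟩
        have hk := below_kept hI.2 ⟨g, hg, hA⟩
        exact (hc.inside g hg ⟨h, hk⟩ hA).trans (inside I hI.1 hI.2 g hg ⟨h, hk⟩ hA).symm
      · exact ⟨x, subset_affineSpan _ _ hne, hx.observe, fun h1 h2 => absurd ⟨h1, h2⟩ hI,
          fun _ => rfl⟩
    choose V hV hobs hin hout using hex
    -- At most one difference is nonzero at a given node, since at most one next infoset lies above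
    -- it.
    have hat : ∀ h, x' (Γ.at' .plus h) =
        x (Γ.at' .plus h) + ∑ I, (V I (Γ.at' .plus h) - x (Γ.at' .plus h)) := by
      intro h
      by_cases hh : ∃ I, (Γ.IsNext done I ∧ Γ.CanSolve x I) ∧ h ∈ Γ.below I
      · obtain ⟨I, hI, hb⟩ := hh
        rw [Finset.sum_eq_single_of_mem I (Finset.mem_univ _), (hin I hI.1 hI.2).1 h hb]
        · ring
        · intro J _ hJI
          by_cases hJ : Γ.IsNext done J ∧ Γ.CanSolve x J
          · rw [(hin J hJ.1 hJ.2).2 h fun hb' => hJI (hJ.1.eq_of_below hI.1 hb' hb), sub_self]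
          · rw [hout J hJ, sub_self]
      · rw [outside h fun I h1 h2 h3 => hh ⟨I, ⟨h1, h2⟩, h3⟩, Finset.sum_eq_zero, add_zero]
        intro I _
        by_cases hI : Γ.IsNext done I ∧ Γ.CanSolve x I
        · rw [(hin I hI.1 hI.2).2 h fun hb => hh ⟨I, hI, hb⟩, sub_self]
        · rw [hout I hI, sub_self]
    -- Every sequence is one at a node or just before it, and the latter case reduces to the former,
    -- since an observation changes no probability.
    have e : x' = x + ∑ I, (V I - x) := by
      funext s
      rw [Pi.add_apply, Finset.sum_apply]
      simp only [Pi.sub_apply]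
      obtain ⟨k, rfl | rfl⟩ := s.cases
      · rw [← hx'.observe, hat, hx.observe]
        simp only [hobs]
      · exact hat k
    refine isAffineEquilibrium_of_mem_affineSpan ?_
    have hxS : x ∈ affineSpan ℝ {x | Γ.IsNEStrategy x} := subset_affineSpan _ _ hne
    rw [e, add_comm, ← vadd_eq_add]
    refine AffineSubspace.vadd_mem_of_mem_direction (Submodule.sum_mem _ fun I _ => ?_) hxS
    exact AffineSubspace.vsub_mem_direction (hV I) hxS

end Game

theorem mainTheorem1 (Γ : Game) (x x' : Γ.Seq Player.plus → ℝ) (hx : Γ.IsNEStrategy x)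
    (hrun : Game.KLSSRun Γ ∅ x x') : Γ.IsAffineEquilibrium x' :=
  hrun.isAffineEquilibrium hx
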